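/- Let $K$ be a totally real number field with ring of integers $\mathcal O_K$, and let $\mathcal A=\left(\frac{a,b}{K}\right)$ be a totally definite quaternion algebra over $K$, i.e. its reduced norm $\mathrm{nrd}$ takes totally positive values on all non-zero elements. An order in $\mathcal A$ is a subring that is an $\mathcal O_K$-lattice (a finitely generated $\mathcal O_K$-submodule spanning $\mathcal A$ over $K$). For an order $\mathcal G$ put $\mathcal G^1=\{x\in\mathcal G:\mathrm{nrd}(x)=1\}$ and, for a totally positive $\alpha\in\mathcal O_K$, $r_{\mathcal G}(\alpha)=\#\{x\in\mathcal G:\mathrm{nrd}(x)=\alpha\}$. The class number of $\mathcal G$ is the number of classes of lattices $L\subset\mathcal A$ with right order $\{x\in\mathcal A: Lx\subseteq L\}=\mathcal G$ modulo $L\sim xL$, $x\in\mathcal A^\times$. The index $[\mathcal H:\mathcal G]_{\mathcal O_K}$ is the fractional ideal generated by $\det f$ for all $K$-linear $f:\mathcal A\to\mathcal A$ with $f(\mathcal H)\subseteq\mathcal G$, and the reduced discriminant $\mathrm{discrd}\,\mathcal H$ is the ideal generated by all $\mathrm{trd}((xy-yx)\bar z)$, $x,y,z\in\mathcal H$. **Theorem.**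 Let $\mathcal H$ be a maximal order in $\mathcal A$, and write $\mathfrak D=\mathrm{discrd}\,\mathcal H=\mathfrak p\mathfrak p_2\cdots\mathfrak p_k$ as a product of distinct prime ideals of $\mathcal O_K$. Let $\mathfrak q$ be a non-zero prime ideal with $\mathfrak q\nmid\mathfrak D$. Let $\mathcal G\subseteq\mathcal H$ be an order such that - $\mathcal G$ is perceptive in $\mathcal H$: for every $x\in\mathcal H$ there is $u\in\mathcal H^1$ with $ux\in\mathcal G$; - $\mathcal G$ is of the kind $\mathfrak p\mathfrak q$: $[\mathcal H:\mathcal G]_{\mathcal O_K}=\mathfrak p\mathfrak q$; - $\mathcal G$ has class number $1$. Then for every totally positive $\alpha\in\mathcal O_K$ the numbers $\#\mathcal G^1$ and $r_{\mathcal G}(\alpha)$ are finite and $$r_{\mathcal G}(\alpha)=2\,\#\mathcal G^1\sum_{\mathfrak p^2,\mathfrak p_2,\dots,\mathfrak p_k\,\nmid\,\delta\mathcal O_K\,\mid\,\alpha\mathcal O_K}\mathrm N(\delta\mathcal O_K)\;-\;\#\mathcal G^1\sum_{\mathfrak q,\mathfrak p^2,\mathfrak p_2,\dots,\mathfrak p_k\,\nmid\,\delta\mathcal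 O_K\,\mid\,\alpha\mathcal O_K}\mathrm N(\delta\mathcal O_K).$$ The sums run over the principal ideals $\delta\mathcal O_K$ that divide $\alpha\mathcal O_K$ and are divisible by none of the ideals listed to the left of $\nmid$; $\mathrm N$ is the absolute norm. -/

import Mathlib

open scoped Quaternion NumberField

noncomputable section

namespace QuatOrder

variable {K : Type*} [Field K]

/-- The reduced norm `x * conj x` on the quaternion algebra `(a, b / K)`, where
`ℍ[K,a,b] = K ⊕ K i ⊕ K j ⊕ K k` with `i² = a`, `j² = b`, `k = i j = - j i`. The product is a
scalar (see `mul_star_eq_nrd`), and we read off that scalar. -/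
def nrd {a b : K} (x : ℍ[K,a,b]) : K := (x * star x).re

/-- The reduced trace `x + conj x`, again a scalar (see `add_star_eq_trd`). -/
def trd {a b : K} (x : ℍ[K,a,b]) : K := (x + star x).re

theorem mul_star_eq_nrd {a b : K} (x : ℍ[K,a,b]) :
    x * star x = algebraMap K ℍ[K,a,b] (nrd x) := by
  ext <;> simp [nrd, QuaternionAlgebra.algebraMap_eq] <;> ring

theorem add_star_eq_trd {a b : K} (x : ℍ[K,a,b]) :
    x + star x = algebraMap K ℍ[K,a,b] (trd x) := by
  ext <;> simp [trd, QuaternionAlgebra.algebraMap_eq]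

/-- `α ≻ 0`: positive at every real embedding. -/
def TotallyPositive (α : K) : Prop := ∀ σ : K →+* ℝ, 0 < σ α

variable (K) in
/-- The quaternion algebra `(a, b / K)` over the totally real field `K` is (totally) definite: its
reduced norm is a totally positive definite quadratic form. -/
def IsDefinite (a b : K) : Prop := ∀ x : ℍ[K,a,b], x ≠ 0 → TotallyPositive (nrd x)

variable [NumberField K] {a b : K}

/-- The usual `𝓞 K`-algebra structure on a quaternion algebra. Mathlib reaches it along two paths
(through `QuaternionAlgebra` and through `K`-algebras in general); this selects the first one, so
that orders and lattices use the same module structure. -/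
instance algebraInt : Algebra (𝓞 K) ℍ[K,a,b] := QuaternionAlgebra.instAlgebra

/-- An `𝓞 K`-order: a subring that contains `𝓞 K` and is an `𝓞 K`-lattice, i.e. finitely generated
over `𝓞 K` and spanning the quaternion algebra over `K`. -/
def IsOrder (G : Subalgebra (𝓞 K) ℍ[K,a,b]) : Prop :=
  Submodule.IsLattice K (Subalgebra.toSubmodule G)

/-- An inclusion-maximal order. -/
def IsMaximalOrder (H : Subalgebra (𝓞 K) ℍ[K,a,b]) : Prop := Maximal IsOrder H

/-- The elements of `G` of reduced norm `α`. -/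
def normSet (G : Subalgebra (𝓞 K) ℍ[K,a,b]) (α : K) : Set ℍ[K,a,b] :=
  {x | x ∈ G ∧ nrd x = α}

/-- `G¹`, the elements of `G` of reduced norm one. -/
def units1 (G : Subalgebra (𝓞 K) ℍ[K,a,b]) : Set ℍ[K,a,b] := normSet G 1

/-- `r_G(α)`, the number of elements of `G` of reduced norm `α`. -/
def repCount (G : Subalgebra (𝓞 K) ℍ[K,a,b]) (α : 𝓞 K) : ℕ :=
  (normSet G (algebraMap (𝓞 K) K α)).ncard

/-- `G` is a perceptive suborder of `H`: every orbit `H¹ x` with `x ∈ H` meets `G`. -/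
def IsPerceptive (G H : Subalgebra (𝓞 K) ℍ[K,a,b]) : Prop :=
  G ≤ H ∧ ∀ x ∈ H, ∃ u ∈ units1 H, u * x ∈ G

/-- The reduced discriminant of a lattice: the fractional ideal generated by all
`trd ((x y - y x) * conj z)` with `x, y, z ∈ L`. -/
def discrd (L : Submodule (𝓞 K) ℍ[K,a,b]) : Submodule (𝓞 K) K :=
  Submodule.span (𝓞 K)
    {d | ∃ x ∈ L, ∃ y ∈ L, ∃ z ∈ L, d = trd ((x * y - y * x) * star z)}

/-- The `𝓞 K`-index `[L : M]`: the fractional ideal generated by the determinants of the `K`-linear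
endomorphisms that map `L` into `M`. -/
def latticeIndex (L M : Submodule (𝓞 K) ℍ[K,a,b]) : Submodule (𝓞 K) K :=
  Submodule.span (𝓞 K)
    {d | ∃ f : ℍ[K,a,b] →ₗ[K] ℍ[K,a,b], (∀ x ∈ L, f x ∈ M) ∧ d = LinearMap.det f}

/-- The lattices `L` whose right order `{x | L x ⊆ L}` is `G`. -/
def LatticeWithRightOrder (G : Subalgebra (𝓞 K) ℍ[K,a,b]) : Type _ :=
  {L : Submodule (𝓞 K) ℍ[K,a,b] //
    Submodule.IsLattice K L ∧ ∀ x, x ∈ G ↔ ∀ y ∈ L, y * x ∈ L}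

/-- Right equivalence of lattices: `L = x M` for some invertible quaternion `x`. -/
def rightEquiv (G : Subalgebra (𝓞 K) ℍ[K,a,b]) : Setoid (LatticeWithRightOrder G) where
  r L M := ∃ x : (ℍ[K,a,b])ˣ,
    L.1 = M.1.map (LinearMap.mulLeft (𝓞 K) (x : ℍ[K,a,b]))
  iseqv :=
    { refl := fun L => ⟨1, by simp [LinearMap.mulLeft_one]⟩
      symm := by
        rintro L M ⟨x, h⟩
        refine ⟨x⁻¹, ?_⟩
        rw [h, ← Submodule.map_comp, ← LinearMap.mulLeft_mul]
        simp [LinearMap.mulLeft_one]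
      trans := by
        rintro L M N ⟨x, h⟩ ⟨y, h'⟩
        refine ⟨x * y, ?_⟩
        rw [h, h', ← Submodule.map_comp, ← LinearMap.mulLeft_mul]
        simp }

/-- The (right) class number `# Cls G`. -/
def classNumber (G : Subalgebra (𝓞 K) ℍ[K,a,b]) : ℕ := Nat.card (Quotient (rightEquiv G))

/-- The principal ideals `δ 𝓞 K` that divide `α 𝓞 K` and satisfy `P`. -/
def divisors (α : 𝓞 K) (P : Ideal (𝓞 K) → Prop) : Set (Ideal (𝓞 K)) :=
  {I | Submodule.IsPrincipal I ∧ I ∣ Ideal.span {α} ∧ P I}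

theorem divisors_finite {α : 𝓞 K} (hα : α ≠ 0) (P : Ideal (𝓞 K) → Prop) :
    (divisors α P).Finite := by
  have h : Ideal.span {α} ≠ (0 : Ideal (𝓞 K)) := by simpa using hα
  have : Fintype {I : Ideal (𝓞 K) // I ∣ Ideal.span {α}} :=
    UniqueFactorizationMonoid.fintypeSubtypeDvd _ h
  exact (Set.finite_coe_iff.mp (Finite.of_fintype
    {I : Ideal (𝓞 K) // I ∣ Ideal.span {α}})).subset fun I hI => hI.2.1

/-- The sum of the norms `N(δ 𝓞 K)` over the ideals `δ 𝓞 K` that divide `α 𝓞 K` and satisfy `P`;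
a finite sum for `α ≠ 0`. -/
def divisorSum (α : 𝓞 K) (P : Ideal (𝓞 K) → Prop) : ℕ :=
  ∑ᶠ I ∈ divisors α P, Ideal.absNorm I

end QuatOrder

end

/-! The count in `G` is compared with the count in `H`, and the count in `H` is Eichler's formula,
r_H(α) = #H¹ · σ(α), where σ sums N(δ) over the divisors δ prime to 𝔇.

Class number one of `G` makes every left ideal of `H` that contains an ideal prime to the conductor
principal (`exists_eq_mul_of_coprime`): intersect the conjugate right ideal with `G`, generate
there, extend back. At a prime 𝔯 outside the conductor and 𝔇, the finite ring H/𝔯H is not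
commutative, so by Wedderburn it has non-zero elements of norm zero. A generator of the resulting
left ideal has norm generating 𝔯. Norms are totally positive, so the narrow class group is trivial
(`PrincipalAwayFrom.hasPositiveGenerators`). Hence 𝓞 K is a PID and totally positive units are
squares (`exists_eq_sq_of_totallyPositive`). Left ideals of norm ϖ are then principal at every prime
ϖ, since multiplication by a suitable x̄/ϖ makes them prime to the conductor
(`PrincipalAwayFrom.principalAtPrimes`).

At a prime ϖ dividing 𝔇 there is one left ideal of norm ϖ, so r_H(ϖα) = r_H(α). At any other prime
H/ϖH is the ring of 2 × 2 matrices over O/ϖ, there are N(ϖ) + 1 such ideals (`ncard_idealsOfNorm`),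
and counting pairs x ∈ J gives the Hecke recursion (`ncard_mul_of_unramified`). Induction on the
norm yields `ncard_elementsOfNorm`.

Since the index is 𝔭𝔮, `G` is the common kernel of functionals l mod p and l' mod q, each with a
subring as kernel. The largest left ideals J, J' in these kernels have norms p and q. Perceptivity
allows x to be moved into `G` by H¹, so the number of u ∈ H¹ with ux ∈ G depends only on whether x
lies in J and J'. It equals #G¹ · (1 + N(p)[x ∈ J]) · (1 + N(q)[x ∈ J']) (`ncard_translators`).
Summing over x of norm α counts every element of norm α in `G` exactly #H¹ times. As p is ramified,
x ∈ J means p ∣ α; the x ∈ J' are counted by r_H(α/q). Thus r_G(α) = #G¹ · (1 + N(p)[p ∣ α]) · (σ(α)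
+ N(q)σ(α/q)). The first factor relaxes 𝔭 ∤ δ to 𝔭² ∤ δ, and N(q)σ(α/q) is σ(α) minus the part of
σ(α) prime to 𝔮, which produces the factor 2 and the subtracted sum. -/

noncomputable section

set_option linter.unusedSectionVars false

/-! ### Algebras with a standard involution; integrality of trace and norm. -/

namespace QuatOrder

/-- An `O`-algebra with a standard involution `conj`, reduced trace `rtr` and reduced norm `rn`. -/
class HasReducedNorm (O H : Type*) [CommRing O] [Ring H] [Algebra O H] where
  /-- the standard involution -/
  conj : H → H
  /-- the reduced trace -/
  rtr : H → O
  /-- the reduced norm -/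
  rn : H → O
  add_conj : ∀ x, x + conj x = algebraMap O H (rtr x)
  mul_conj : ∀ x, x * conj x = algebraMap O H (rn x)
  conj_mul : ∀ x y, conj (x * y) = conj y * conj x
  conj_add : ∀ x y, conj (x + y) = conj x + conj y
  conj_algebraMap : ∀ r, conj (algebraMap O H r) = algebraMap O H r
  algebraMap_injective : Function.Injective (algebraMap O H)

namespace HasReducedNorm

variable {O H : Type*} [CommRing O] [Ring H] [Algebra O H] [HasReducedNorm O H]

local notation "cj" => HasReducedNorm.conj O (H := H)
local notation "tr" => HasReducedNorm.rtr (O := O) (H := H)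
local notation "nm" => HasReducedNorm.rn (O := O) (H := H)
local notation "ι" => algebraMap O H

theorem conj_eq (x : H) : cj x = ι (tr x) - x := by
  rw [← add_conj]; abel

theorem conj_conj (x : H) : cj (cj x) = x := by
  have h := congrArg cj (add_conj (O := O) x)
  rw [conj_add, conj_algebraMap, ← add_conj (O := O) x, add_comm] at h
  exact add_right_cancel h

theorem conj_mul_self (x : H) : cj x * x = ι (nm x) := by
  rw [← mul_conj, conj_eq, sub_mul, mul_sub, Algebra.commutes]

theorem conj_one : cj 1 = 1 := by
  have := conj_algebraMap (O := O) (H := H) 1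
  rwa [map_one] at this

theorem conj_zero : cj 0 = 0 := by
  have := conj_algebraMap (O := O) (H := H) 0
  rwa [map_zero] at this

theorem conj_neg (x : H) : cj (-x) = - cj x := by
  rw [eq_neg_iff_add_eq_zero, ← conj_add, neg_add_cancel, conj_zero]

theorem conj_sub (x y : H) : cj (x - y) = cj x - cj y := by
  rw [sub_eq_add_neg, conj_add, conj_neg, sub_eq_add_neg]

theorem conj_smul (r : O) (x : H) : cj (r • x) = r • cj x := by
  rw [Algebra.smul_def, conj_mul, conj_algebraMap, ← Algebra.commutes, Algebra.smul_def]

theorem rn_conj (x : H) : nm (cj x) = nm x := by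
  apply algebraMap_injective (O := O) (H := H)
  rw [← mul_conj, conj_conj, conj_mul_self]

theorem rtr_conj (x : H) : tr (cj x) = tr x := by
  apply algebraMap_injective (O := O) (H := H)
  rw [← add_conj, conj_conj, ← add_conj, add_comm]

theorem rn_mul (x y : H) : nm (x * y) = nm x * nm y := by
  apply algebraMap_injective (O := O) (H := H)
  rw [← mul_conj, conj_mul, mul_assoc, ← mul_assoc y, mul_conj, Algebra.commutes, ← mul_assoc,
    mul_conj, map_mul]

theorem rn_algebraMap (r : O) : nm (ι r) = r ^ 2 := by
  apply algebraMap_injective (O := O) (H := H)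
  rw [← mul_conj, conj_algebraMap, sq, map_mul]

theorem rn_one : nm (1 : H) = 1 := by
  have := rn_algebraMap (O := O) (H := H) 1
  rwa [map_one, one_pow] at this

theorem rn_zero : nm (0 : H) = 0 := by
  have := rn_algebraMap (O := O) (H := H) 0
  rwa [map_zero, zero_pow two_ne_zero] at this

theorem rn_smul (r : O) (x : H) : nm (r • x) = r ^ 2 * nm x := by
  rw [Algebra.smul_def, rn_mul, rn_algebraMap]

theorem rtr_add (x y : H) : tr (x + y) = tr x + tr y := by
  apply algebraMap_injective (O := O) (H := H)
  rw [← add_conj, conj_add, map_add, ← add_conj, ← add_conj]; abel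

theorem rtr_smul (r : O) (x : H) : tr (r • x) = r * tr x := by
  apply algebraMap_injective (O := O) (H := H)
  rw [← add_conj, conj_smul, ← smul_add, add_conj, map_mul, Algebra.smul_def]

theorem rtr_algebraMap (r : O) : tr (ι r) = 2 * r := by
  apply algebraMap_injective (O := O) (H := H)
  rw [← add_conj, conj_algebraMap, two_mul, map_add]

theorem rtr_neg (x : H) : tr (-x) = - tr x := by
  have := rtr_smul (O := O) (-1) x
  simpa using this

theorem rtr_sub (x y : H) : tr (x - y) = tr x - tr y := by
  rw [sub_eq_add_neg, rtr_add, rtr_neg, sub_eq_add_neg]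

theorem rtr_zero : tr (0 : H) = 0 := by
  have := rtr_smul (O := O) 0 (0 : H)
  simpa using this

theorem rn_add (x y : H) : nm (x + y) = nm x + nm y + tr (x * cj y) := by
  apply algebraMap_injective (O := O) (H := H)
  rw [← mul_conj, conj_add, map_add, map_add, ← add_conj, ← mul_conj, ← mul_conj, conj_mul,
    conj_conj]
  noncomm_ring

theorem rtr_mul_conj_comm (x y : H) : tr (x * cj y) = tr (y * cj x) := by
  rw [← rtr_conj, conj_mul, conj_conj]

/-- The elements x + ȳ and x̄ + y are conjugate, so have equal norm. Their polar terms are tr(xy)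
and tr(x̄ȳ) = tr(yx). -/
theorem rtr_mul_comm (x y : H) : tr (x * y) = tr (y * x) := by
  have h1 := rn_add (O := O) x (cj y)
  have h2 := rn_add (O := O) (cj x) y
  rw [conj_conj] at h1
  rw [← rn_conj, conj_add, conj_conj, h1, rn_conj, rn_conj] at h2
  have h3 := add_left_cancel h2
  rw [h3, ← rtr_conj, conj_mul, conj_conj, conj_conj]

theorem mul_self_eq (x : H) : x * x = tr x • x - ι (nm x) := by
  rw [← mul_conj, conj_eq, mul_sub, Algebra.smul_def, Algebra.commutes]; abel

theorem mul_mul_self (w a : H) : w * a * w = tr (a * w) • w - nm w • cj a := by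
  have h : a * w = ι (tr (a * w)) - cj w * cj a := by
    rw [← add_conj, conj_mul]; abel
  rw [mul_assoc, h, mul_sub, ← mul_assoc, mul_conj, ← Algebra.commutes, ← Algebra.smul_def,
    ← Algebra.smul_def, ← h]

end HasReducedNorm

section Quaternion

variable {K : Type*} [Field K] {a b : K}

instance : HasReducedNorm K ℍ[K,a,b] where
  conj := star
  rtr := trd
  rn := nrd
  add_conj := add_star_eq_trd
  mul_conj := mul_star_eq_nrd
  conj_mul := star_mul
  conj_add := star_add
  conj_algebraMap := by
    intro r
    ext <;> simp [QuaternionAlgebra.algebraMap_eq]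
  algebraMap_injective := (algebraMap K ℍ[K,a,b]).injective

instance : IsScalarTower (𝓞 K) K ℍ[K,a,b] := inferInstance

theorem algebraMap_int_eq (r : 𝓞 K) :
    algebraMap (𝓞 K) ℍ[K,a,b] r = algebraMap K ℍ[K,a,b] (r : K) :=
  IsScalarTower.algebraMap_apply _ _ _ r

/-- For non-scalar x the quadratic X² - tr(x)X + n(x) is the minimal polynomial, hence divides a
monic integral polynomial and is integral by Gauss's lemma. Scalars are separate because their
minimal polynomial is linear. -/
theorem exists_trd_nrd_of_isIntegral [NumberField K] {x : ℍ[K,a,b]} (hx : IsIntegral (𝓞 K) x) :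
    (∃ t, trd x = algebraMap (𝓞 K) K t) ∧ ∃ n, nrd x = algebraMap (𝓞 K) K n := by
  obtain ⟨p, hp, hpx⟩ := hx
  by_cases hxK : ∃ c : K, x = algebraMap K _ c
  · obtain ⟨c, rfl⟩ := hxK
    have hc : IsIntegral (𝓞 K) c := by
      refine ⟨p, hp, ?_⟩
      apply (algebraMap K ℍ[K,a,b]).injective
      rw [map_zero, ← hpx, Polynomial.hom_eval₂]
      congr 1
    obtain ⟨d, rfl⟩ := IsIntegrallyClosed.isIntegral_iff.mp hc
    exact ⟨⟨2 * d, by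
        have := HasReducedNorm.rtr_algebraMap (O := K) (H := ℍ[K,a,b]) (algebraMap _ K d)
        rw [map_mul, map_ofNat]; exact this⟩, ⟨d ^ 2, by
        have := HasReducedNorm.rn_algebraMap (O := K) (H := ℍ[K,a,b]) (algebraMap _ K d)
        rw [map_pow]; exact this⟩⟩
  · open Polynomial in
    set q : K[X] := X ^ 2 - C (trd x) * X + C (nrd x) with hq
    have hqm : q.Monic := by rw [hq]; monicity!
    have hqd : q.natDegree = 2 := by rw [hq]; compute_degree!
    have hqx : aeval x q = 0 := by
      have h := HasReducedNorm.mul_self_eq (O := K) x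
      simp only [hq, map_add, map_sub, map_mul, aeval_X, aeval_C, sq]
      rw [h, Algebra.smul_def]
      change algebraMap K _ (trd x) * x - algebraMap K _ (nrd x) - algebraMap K _ (trd x) * x
        + algebraMap K _ (nrd x) = 0
      abel
    have hint : IsIntegral K x := ⟨q, hqm, hqx⟩
    have hdeg : 2 ≤ (minpoly K x).natDegree := by
      by_contra hlt
      have h1 : (minpoly K x).natDegree = 1 := by
        have := minpoly.natDegree_pos hint
        omega
      rw [minpoly.natDegree_eq_one_iff] at h1
      obtain ⟨c, hc⟩ := h1
      exact hxK ⟨c, hc.symm⟩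
    have hmq : minpoly K x = q :=
      (Polynomial.eq_of_monic_of_dvd_of_natDegree_le (minpoly.monic hint) hqm
        (minpoly.dvd K x hqx) (by omega)).symm
    have hdvd : q ∣ p.map (algebraMap (𝓞 K) K) := by
      rw [← hmq]
      refine minpoly.dvd _ _ ?_
      rw [aeval_def, eval₂_map]
      exact hpx
    obtain ⟨g, hg⟩ := IsIntegrallyClosed.eq_map_mul_C_of_dvd K hp hdvd
    rw [hqm.leadingCoeff, C_1, mul_one] at hg
    refine ⟨⟨- g.coeff 1, ?_⟩, ⟨g.coeff 0, ?_⟩⟩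
    · have := congrArg (fun r => coeff r 1) hg
      simp only [coeff_map] at this
      rw [map_neg, this, hq]
      simp [coeff_C]
    · have := congrArg (fun r => coeff r 0) hg
      simp only [coeff_map] at this
      rw [this, hq]
      simp

end Quaternion

end QuatOrder

/-! ### Orders, lattices, maximal orders and the use of class number one. -/

namespace QuatOrder

variable {K : Type*} [Field K] [NumberField K] {a b : K}

theorem IsOrder.isIntegral {G : Subalgebra (𝓞 K) ℍ[K,a,b]} (hG : IsOrder G) {x : ℍ[K,a,b]}
    (hx : x ∈ G) : IsIntegral (𝓞 K) x :=
  IsIntegral.of_mem_of_fg G hG.fg x hx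

theorem IsOrder.exists_trd {G : Subalgebra (𝓞 K) ℍ[K,a,b]} (hG : IsOrder G) {x : ℍ[K,a,b]}
    (hx : x ∈ G) : ∃ t, trd x = algebraMap (𝓞 K) K t :=
  (exists_trd_nrd_of_isIntegral (hG.isIntegral hx)).1

theorem IsOrder.exists_nrd {G : Subalgebra (𝓞 K) ℍ[K,a,b]} (hG : IsOrder G) {x : ℍ[K,a,b]}
    (hx : x ∈ G) : ∃ t, nrd x = algebraMap (𝓞 K) K t :=
  (exists_trd_nrd_of_isIntegral (hG.isIntegral hx)).2

theorem IsOrder.star_mem {G : Subalgebra (𝓞 K) ℍ[K,a,b]} (hG : IsOrder G) {x : ℍ[K,a,b]}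
    (hx : x ∈ G) : star x ∈ G := by
  obtain ⟨t, ht⟩ := hG.exists_trd hx
  have : star x = algebraMap (𝓞 K) _ t - x := by
    rw [algebraMap_int_eq]
    change _ = algebraMap K _ (algebraMap (𝓞 K) K t) - x
    rw [← ht, ← add_star_eq_trd]; abel
  rw [this]
  exact sub_mem (G.algebraMap_mem t) hx

theorem algebraMap_int_injective :
    Function.Injective (algebraMap (𝓞 K) ℍ[K,a,b]) := by
  have : (algebraMap (𝓞 K) ℍ[K,a,b] : 𝓞 K → ℍ[K,a,b]) =
      algebraMap K ℍ[K,a,b] ∘ algebraMap (𝓞 K) K := funext algebraMap_int_eq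
  rw [this]
  exact (algebraMap K ℍ[K,a,b]).injective.comp (FaithfulSMul.algebraMap_injective _ _)

/-- The reduced norm and trace on an order. -/
abbrev IsOrder.hasReducedNorm {G : Subalgebra (𝓞 K) ℍ[K,a,b]} (hG : IsOrder G) :
    HasReducedNorm (𝓞 K) G where
  conj x := ⟨star x.1, hG.star_mem x.2⟩
  rtr x := (hG.exists_trd x.2).choose
  rn x := (hG.exists_nrd x.2).choose
  add_conj x := by
    apply Subtype.ext
    change x.1 + star x.1 = algebraMap (𝓞 K) ℍ[K,a,b] _
    rw [add_star_eq_trd, algebraMap_int_eq]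
    exact congrArg _ (hG.exists_trd x.2).choose_spec
  mul_conj x := by
    apply Subtype.ext
    change x.1 * star x.1 = algebraMap (𝓞 K) ℍ[K,a,b] _
    rw [mul_star_eq_nrd, algebraMap_int_eq]
    exact congrArg _ (hG.exists_nrd x.2).choose_spec
  conj_mul x y := Subtype.ext (star_mul _ _)
  conj_add x y := Subtype.ext (star_add _ _)
  conj_algebraMap r := by
    apply Subtype.ext
    change star (algebraMap (𝓞 K) ℍ[K,a,b] r) = algebraMap (𝓞 K) ℍ[K,a,b] r
    rw [algebraMap_int_eq]
    exact HasReducedNorm.conj_algebraMap (O := K) (H := ℍ[K,a,b]) _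
  algebraMap_injective := fun r s h => algebraMap_int_injective (congrArg Subtype.val h)

theorem IsOrder.trd_eq {G : Subalgebra (𝓞 K) ℍ[K,a,b]} (hG : IsOrder G) (x : G) :
    trd x.1 = algebraMap (𝓞 K) K (hG.hasReducedNorm.rtr x) :=
  (hG.exists_trd x.2).choose_spec

theorem IsOrder.nrd_eq {G : Subalgebra (𝓞 K) ℍ[K,a,b]} (hG : IsOrder G) (x : G) :
    nrd x.1 = algebraMap (𝓞 K) K (hG.hasReducedNorm.rn x) :=
  (hG.exists_nrd x.2).choose_spec

/-- Lattices are commensurable. -/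
theorem exists_smul_mem {L M : Submodule (𝓞 K) ℍ[K,a,b]} (hL : L.FG)
    (hM : Submodule.IsLattice K M) : ∃ n : 𝓞 K, n ≠ 0 ∧ ∀ x ∈ L, n • x ∈ M := by
  have key : ∀ x : ℍ[K,a,b], ∃ n : 𝓞 K, n ≠ 0 ∧ n • x ∈ M := by
    intro x
    have hx : x ∈ Submodule.span K (M : Set ℍ[K,a,b]) := by
      rw [hM.span_eq_top]; trivial
    induction hx using Submodule.span_induction with
    | mem x hx => exact ⟨1, one_ne_zero, by rwa [one_smul]⟩
    | zero => exact ⟨1, one_ne_zero, by simp⟩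
    | add x y _ _ hx hy =>
      obtain ⟨n, hn, hnx⟩ := hx
      obtain ⟨m, hm, hmy⟩ := hy
      refine ⟨n * m, mul_ne_zero hn hm, ?_⟩
      rw [smul_add]
      refine add_mem ?_ ?_
      · rw [mul_comm, mul_smul]; exact M.smul_mem _ hnx
      · rw [mul_smul]; exact M.smul_mem _ hmy
    | smul c x _ hx =>
      obtain ⟨n, hn, hnx⟩ := hx
      obtain ⟨r, s, hs, rfl⟩ := IsFractionRing.div_surjective (A := 𝓞 K) c
      have hs0 : s ≠ 0 := nonZeroDivisors.ne_zero hs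
      refine ⟨n * s, mul_ne_zero hn hs0, ?_⟩
      have hsK : algebraMap (𝓞 K) K s ≠ 0 := by simpa using hs0
      have : (n * s) • (algebraMap (𝓞 K) K r / algebraMap (𝓞 K) K s) • x = r • n • x := by
        rw [← algebraMap_smul K (n * s), ← algebraMap_smul K r, ← algebraMap_smul K n, smul_smul,
          smul_smul, map_mul]
        congr 1
        field_simp
      rw [this]
      exact M.smul_mem _ hnx
  induction L, hL using Submodule.fg_induction with
  | singleton x =>
    obtain ⟨n, hn, hnx⟩ := key x
    refine ⟨n, hn, fun y hy => ?_⟩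
    obtain ⟨r, rfl⟩ := Submodule.mem_span_singleton.mp hy
    rw [smul_comm]
    exact M.smul_mem _ hnx
  | sup L₁ L₂ _ _ h₁ h₂ =>
    obtain ⟨n, hn, hnx⟩ := h₁
    obtain ⟨m, hm, hmy⟩ := h₂
    refine ⟨n * m, mul_ne_zero hn hm, fun z hz => ?_⟩
    obtain ⟨x, hx, y, hy, rfl⟩ := Submodule.mem_sup.mp hz
    rw [smul_add]
    refine add_mem ?_ ?_
    · rw [mul_comm, mul_smul]; exact M.smul_mem _ (hnx x hx)
    · rw [mul_smul]; exact M.smul_mem _ (hmy y hy)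

theorem fg_of_smul_mem {L M : Submodule (𝓞 K) ℍ[K,a,b]} (hL : L.FG) {c : 𝓞 K} (hc : c ≠ 0)
    (h : ∀ x ∈ M, c • x ∈ L) : M.FG := by
  have : Module.Finite (𝓞 K) L := Module.Finite.iff_fg.mpr hL
  have hn : IsNoetherian (𝓞 K) L := inferInstance
  let f : M →ₗ[𝓞 K] L := LinearMap.restrict (LinearMap.lsmul (𝓞 K) ℍ[K,a,b] c) h
  have hf : Function.Injective f := by
    intro x y hxy
    have h1 : c • x.1 = c • y.1 := congrArg Subtype.val hxy
    rw [← algebraMap_smul K, ← algebraMap_smul K] at h1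
    exact Subtype.ext (smul_right_injective _ (by simpa using hc) h1)
  have : IsNoetherian (𝓞 K) M := isNoetherian_of_injective f hf
  exact Module.Finite.iff_fg.mp inferInstance

theorem isLattice_of_smul_mem {L M : Submodule (𝓞 K) ℍ[K,a,b]} (hL : Submodule.IsLattice K L)
    (hML : M ≤ L) {c : 𝓞 K} (hc : c ≠ 0) (h : ∀ x ∈ L, c • x ∈ M) : Submodule.IsLattice K M where
  fg := fg_of_smul_mem hL.fg one_ne_zero fun x hx => by rw [one_smul]; exact hML hx
  span_eq_top := by
    rw [eq_top_iff, ← hL.span_eq_top, Submodule.span_le]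
    intro x hx
    have h1 := Submodule.subset_span (R := K) (h x hx)
    have h2 := Submodule.smul_mem _ (algebraMap (𝓞 K) K c)⁻¹ h1
    rwa [← algebraMap_smul K c, smul_smul, inv_mul_cancel₀ (by simpa using hc), one_smul] at h2

theorem IsMaximalOrder.le_of_le {H R : Subalgebra (𝓞 K) ℍ[K,a,b]} (hH : IsMaximalOrder H)
    (hHR : H ≤ R) (hR : (Subalgebra.toSubmodule R).FG) : R ≤ H := by
  refine hH.2 (y := R) ⟨hR, ?_⟩ hHR
  rw [eq_top_iff, ← (hH.1 : Submodule.IsLattice K _).span_eq_top]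
  exact Submodule.span_mono hHR

/-- A maximal order contains every element of integral norm that pairs integrally with it. -/
theorem IsMaximalOrder.mem_of_integral {H : Subalgebra (𝓞 K) ℍ[K,a,b]} (hH : IsMaximalOrder H)
    {w : ℍ[K,a,b]} (ht : ∀ z ∈ H, ∃ t, trd (z * w) = algebraMap (𝓞 K) K t)
    (hn : ∃ t, nrd w = algebraMap (𝓞 K) K t) : w ∈ H := by
  set S := Subalgebra.toSubmodule H with hS
  set W := Submodule.span (𝓞 K) {w} with hW
  have hSS : S * S = S := by rw [hS]; exact (Subalgebra.isIdempotentElem_toSubmodule H).eq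
  -- By wzw = tr(zw)w - n(w)z̄ with integral coefficients.
  have hWSW : W * S * W ≤ S ⊔ W := by
    rw [Submodule.mul_le]
    intro m hm y hy
    refine Submodule.mul_induction_on hm ?_ ?_
    · intro x hx z hz
      obtain ⟨r, rfl⟩ := Submodule.mem_span_singleton.mp hx
      obtain ⟨s, rfl⟩ := Submodule.mem_span_singleton.mp hy
      obtain ⟨t, ht⟩ := ht z hz
      obtain ⟨n, hn⟩ := hn
      have h : w * z * w = trd (z * w) • w - nrd w • star z :=
        HasReducedNorm.mul_mul_self (O := K) w z
      rw [ht, hn, algebraMap_smul, algebraMap_smul] at h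
      rw [smul_mul_assoc, smul_mul_assoc, mul_smul_comm, h]
      refine Submodule.smul_mem _ _ (Submodule.smul_mem _ _ (sub_mem ?_ ?_))
      · exact Submodule.smul_mem _ _ (Submodule.mem_sup_right (Submodule.mem_span_singleton_self w))
      · exact Submodule.smul_mem _ _ (Submodule.mem_sup_left (IsOrder.star_mem hH.1 hz))
    · intro x z hx hz
      rw [add_mul]; exact add_mem hx hz
  set M := S ⊔ S * W * S with hM
  -- This is what makes H + HwH closed under multiplication, so it is an order containing H and
  -- maximality applies.
  have hX : S * W * S * (S * W * S) ≤ M := by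
    calc S * W * S * (S * W * S) = S * (W * (S * S) * W) * S := by simp only [mul_assoc]
      _ = S * (W * S * W) * S := by rw [hSS]
      _ ≤ S * (S ⊔ W) * S := by gcongr
      _ = M := by rw [Submodule.mul_sup, Submodule.sup_mul, hSS, hSS]
  have hMM : M * M ≤ M := by
    rw [hM, Submodule.sup_mul, Submodule.mul_sup, Submodule.mul_sup, hSS]
    refine sup_le (sup_le le_sup_left ?_) (sup_le ?_ hX)
    · rw [← mul_assoc, ← mul_assoc, hSS]; exact le_sup_right
    · rw [mul_assoc, hSS]; exact le_sup_right
  let R : Subalgebra (𝓞 K) ℍ[K,a,b] := M.toSubalgebra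
    (Submodule.mem_sup_left H.one_mem) (fun x y hx hy => hMM (Submodule.mul_mem_mul hx hy))
  have hfg : M.FG := by
    have h1 : S.FG := (hH.1 : Submodule.IsLattice K _).fg
    exact h1.sup ((h1.mul (Submodule.fg_span_singleton w)).mul h1)
  have hle := hH.le_of_le (R := R) (fun x hx => Submodule.mem_sup_left hx) hfg
  apply hle
  have : (1 : ℍ[K,a,b]) * w * 1 ∈ S * W * S :=
    Submodule.mul_mem_mul (Submodule.mul_mem_mul H.one_mem (Submodule.mem_span_singleton_self w))
      H.one_mem
  rw [one_mul, mul_one] at this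
  exact Submodule.mem_sup_right this

/-- The right order of a right ideal of a maximal order `H` is `H`. -/
theorem IsMaximalOrder.mem_of_mul_mem {H : Subalgebra (𝓞 K) ℍ[K,a,b]} (hH : IsMaximalOrder H)
    {L : Submodule (𝓞 K) ℍ[K,a,b]} (hL : L.FG) (hLH : ∀ x ∈ L, ∀ h ∈ H, x * h ∈ L)
    {c : 𝓞 K} (hc : c ≠ 0) (hcL : algebraMap (𝓞 K) _ c ∈ L) {x : ℍ[K,a,b]}
    (hx : ∀ l ∈ L, l * x ∈ L) : x ∈ H := by
  let R : Subalgebra (𝓞 K) ℍ[K,a,b] :=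
    { carrier := {x | ∀ l ∈ L, l * x ∈ L}
      mul_mem' := fun {x y} hx hy l hl => by rw [← mul_assoc]; exact hy _ (hx l hl)
      add_mem' := fun {x y} hx hy l hl => by rw [mul_add]; exact add_mem (hx l hl) (hy l hl)
      algebraMap_mem' := fun r l hl => by
        rw [← Algebra.commutes, ← Algebra.smul_def]; exact L.smul_mem r hl }
  refine hH.le_of_le (R := R) (fun h hh l hl => hLH l hl h hh) ?_ hx
  refine fg_of_smul_mem hL hc fun y hy => ?_
  rw [Algebra.smul_def]
  exact hy _ hcL

/-- An order of class number one: right ideals of a maximal overorder that are prime to the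
conductor are principal. -/
theorem exists_eq_mul_of_coprime {G H : Subalgebra (𝓞 K) ℍ[K,a,b]}
    (hH : IsMaximalOrder H) (hG : IsOrder G) (hGH : G ≤ H) (hcls : classNumber G = 1)
    {𝔫 𝔠 : Ideal (𝓞 K)} (h𝔫0 : 𝔫 ≠ ⊥) (h𝔫 : ∀ r ∈ 𝔫, ∀ x ∈ H, r • x ∈ G)
    (h𝔠0 : 𝔠 ≠ ⊥) (hcop : 𝔠 ⊔ 𝔫 = ⊤)
    {L : Submodule (𝓞 K) ℍ[K,a,b]} (hLle : L ≤ Subalgebra.toSubmodule H)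
    (hLH : ∀ x ∈ L, ∀ h ∈ H, x * h ∈ L)
    (h𝔠L : ∀ c ∈ 𝔠, algebraMap (𝓞 K) _ c ∈ L) :
    ∃ y ∈ L, ∀ x ∈ L, ∃ h ∈ H, x = y * h := by
  have hHL : Submodule.IsLattice K (Subalgebra.toSubmodule H) := hH.1
  obtain ⟨c, hc, hc0⟩ := Submodule.exists_mem_ne_zero_of_ne_bot h𝔠0
  obtain ⟨d, hd, hd0⟩ := Submodule.exists_mem_ne_zero_of_ne_bot h𝔫0
  have hcH : ∀ c ∈ 𝔠, ∀ x ∈ H, c • x ∈ L := fun c hc x hx => by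
    rw [Algebra.smul_def]; exact hLH _ (h𝔠L c hc) x hx
  have hLlat : Submodule.IsLattice K L :=
    isLattice_of_smul_mem hHL hLle hc0 (fun x hx => hcH c hc x hx)
  obtain ⟨e, he, f, hf, hef⟩ := Submodule.mem_sup.mp
    (show (1 : 𝓞 K) ∈ 𝔠 ⊔ 𝔫 by rw [hcop]; trivial)
  have split : ∀ x : ℍ[K,a,b], x = e • x + f • x := fun x => by
    rw [← add_smul, hef, one_smul]
  -- Away from 𝔫 this agrees with L, away from 𝔠 with G; its right order is therefore G, and class
  -- number one gives L' = yG.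
  set L' := L ⊓ Subalgebra.toSubmodule G with hL'
  have hfL' : ∀ x ∈ L, ∀ r ∈ 𝔫, r • x ∈ L' := fun x hx r hr =>
    ⟨L.smul_mem _ hx, h𝔫 r hr x (hLle hx)⟩
  have hcL' : ∀ c ∈ 𝔠, algebraMap (𝓞 K) _ c ∈ L' := fun c hc => ⟨h𝔠L c hc, G.algebraMap_mem c⟩
  have hL'lat : Submodule.IsLattice K L' :=
    isLattice_of_smul_mem hLlat inf_le_left hd0 (fun x hx => hfL' x hx d hd)
  have hL'G : ∀ x, x ∈ G ↔ ∀ y ∈ L', y * x ∈ L' := by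
    refine fun x => ⟨fun hx y hy => ⟨hLH y hy.1 x (hGH hx), G.mul_mem hy.2 hx⟩, fun hx => ?_⟩
    have h1 : ∀ c ∈ 𝔠, c • x ∈ G := fun c hc => by
      rw [Algebra.smul_def]; exact (hx _ (hcL' c hc)).2
    have h2 : ∀ r ∈ 𝔫, r • x ∈ H := fun r hr => by
      refine hH.mem_of_mul_mem hLlat.fg hLH hc0 (h𝔠L c hc) fun l hl => ?_
      rw [mul_smul_comm, ← smul_mul_assoc]
      exact (hx _ (hfL' l hl r hr)).1
    -- Write x = ex + fx with e ∈ 𝔠, f ∈ 𝔫. The first summand is in G because 𝔠 ⊆ L', the second in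
    -- H because the right order of L is H; once x ∈ H, also fx ∈ 𝔫H ⊆ G.
    have hxH : x ∈ H := by
      rw [split x]; exact add_mem (hGH (h1 e he)) (h2 f hf)
    rw [split x]
    exact add_mem (h1 e he) (h𝔫 f hf x hxH)
  have hsub := Nat.card_eq_one_iff_unique.mp hcls
  have hGG : ∀ x, x ∈ G ↔ ∀ y ∈ Subalgebra.toSubmodule G, y * x ∈ Subalgebra.toSubmodule G :=
    fun x => ⟨fun hx y hy => G.mul_mem hy hx, fun h => by simpa using h 1 G.one_mem⟩
  have heq := hsub.1.elim
    (Quotient.mk (rightEquiv G) ⟨L', hL'lat, hL'G⟩) (Quotient.mk (rightEquiv G) ⟨_, hG, hGG⟩)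
  obtain ⟨y, hy⟩ := Quotient.exact heq
  change L' = (Subalgebra.toSubmodule G).map _ at hy
  have hmem : ∀ x, x ∈ L' ↔ ∃ g ∈ G, (y : ℍ[K,a,b]) * g = x := fun x => by
    rw [hy, Submodule.mem_map]; rfl
  refine ⟨y, ((hmem y).mpr ⟨1, G.one_mem, mul_one _⟩).1, fun l hl => ?_⟩
  -- With fl = yg and e = yg', l = el + fl = y(g'l + g).
  obtain ⟨g, hg, hgl⟩ := (hmem _).mp (hfL' l hl f hf)
  obtain ⟨g', hg', hgl'⟩ := (hmem _).mp (hcL' e he)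
  refine ⟨g' * l + g, add_mem (H.mul_mem (hGH hg') (hLle hl)) (hGH hg), ?_⟩
  rw [mul_add, ← mul_assoc, hgl, hgl', ← Algebra.smul_def]
  exact split l

end QuatOrder

/-! ### Extended ideals 𝔞H and elements whose norm lies in a prime. -/

namespace QuatOrder

open HasReducedNorm

section Abstract

variable {O : Type*} (H : Type*) [CommRing O] [Ring H] [Algebra O H]

/-- The two-sided ideal `𝔞 H`. -/
def extend (𝔞 : Ideal O) : Ideal H where
  carrier := (𝔞 • (⊤ : Submodule O H) : Submodule O H)
  add_mem' := add_mem
  zero_mem' := zero_mem _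
  smul_mem' h x hx := by
    refine Submodule.smul_induction_on (p := fun x => h • x ∈ 𝔞 • (⊤ : Submodule O H)) hx ?_ ?_
    · intro r hr n _
      rw [smul_eq_mul, mul_smul_comm]
      exact Submodule.smul_mem_smul hr trivial
    · intro x y hx hy
      rw [smul_add]; exact add_mem hx hy

variable {H}

theorem mem_extend {𝔞 : Ideal O} {x : H} :
    x ∈ extend H 𝔞 ↔ x ∈ (𝔞 • (⊤ : Submodule O H) : Submodule O H) := Iff.rfl

theorem smul_mem_extend {𝔞 : Ideal O} {r : O} (hr : r ∈ 𝔞) (x : H) : r • x ∈ extend H 𝔞 := by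
  rw [mem_extend]
  exact Submodule.smul_mem_smul hr trivial

theorem algebraMap_mem_extend {𝔞 : Ideal O} {r : O} (hr : r ∈ 𝔞) :
    algebraMap O H r ∈ extend H 𝔞 := by
  rw [Algebra.algebraMap_eq_smul_one]; exact smul_mem_extend hr 1

@[elab_as_elim]
theorem extend_induction {𝔞 : Ideal O} {motive : H → Prop} {x : H} (hx : x ∈ extend H 𝔞)
    (smul : ∀ r ∈ 𝔞, ∀ y, motive (r • y))
    (add : ∀ x y, motive x → motive y → motive (x + y)) : motive x := by
  rw [mem_extend] at hx
  exact Submodule.smul_induction_on hx (fun r hr n _ => smul r hr n) add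

instance (𝔞 : Ideal O) : (extend H 𝔞).IsTwoSided where
  mul_mem_of_left y hx := by
    refine extend_induction hx ?_ ?_
    · intro r hr n
      rw [smul_mul_assoc]; exact smul_mem_extend hr _
    · intro x z hx hz
      rw [add_mul]; exact add_mem hx hz

theorem extend_mono {𝔞 𝔟 : Ideal O} (h : 𝔞 ≤ 𝔟) : extend H 𝔞 ≤ extend H 𝔟 := by
  intro x hx
  rw [mem_extend] at hx ⊢
  exact Submodule.smul_mono_left h hx

theorem extend_span_singleton {r : O} {x : H} :
    x ∈ extend H (Ideal.span {r}) ↔ ∃ y, x = r • y := by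
  refine ⟨fun hx => ?_, ?_⟩
  · refine extend_induction hx ?_ ?_
    · intro s hs n
      obtain ⟨t, rfl⟩ := Ideal.mem_span_singleton'.mp hs
      exact ⟨t • n, by rw [smul_smul, mul_comm]⟩
    · rintro _ _ ⟨y, rfl⟩ ⟨z, rfl⟩
      exact ⟨y + z, (smul_add _ _ _).symm⟩
  · rintro ⟨y, rfl⟩
    exact smul_mem_extend (Ideal.mem_span_singleton_self r) y

theorem smul_mem_extend_mul {𝔞 𝔟 : Ideal O} {r : O} (hr : r ∈ 𝔞) {x : H}
    (hx : x ∈ extend H 𝔟) : r • x ∈ extend H (𝔞 * 𝔟) := by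
  refine extend_induction hx ?_ ?_
  · intro s hs y
    rw [smul_smul]; exact smul_mem_extend (Ideal.mul_mem_mul hr hs) y
  · intro x y hx hy
    rw [smul_add]; exact add_mem hx hy

/-- Ideals of a Dedekind domain cancel in `𝔯 v ⊆ 𝔯 𝔢 H`. -/
theorem mem_extend_of_smul_mem [IsDedekindDomain O] [Module.IsTorsionFree O H] {𝔯 𝔢 : Ideal O}
    (h𝔯 : 𝔯 ≠ ⊥) {v : H} (h : ∀ r ∈ 𝔯, r • v ∈ extend H (𝔯 * 𝔢)) : v ∈ extend H 𝔢 := by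
  obtain ⟨t, ht, ht0⟩ := Submodule.exists_mem_ne_zero_of_ne_bot h𝔯
  -- Multiplying by the complementary 𝔟 turns 𝔯 into the principal ideal (t), where cancellation is
  -- torsion-freeness.
  obtain ⟨𝔟, h𝔟⟩ : 𝔯 ∣ Ideal.span {t} := Ideal.dvd_iff_le.mpr (by simpa using ht)
  have key : ∀ s ∈ 𝔟 * 𝔯, s • v ∈ extend H (𝔟 * (𝔯 * 𝔢)) := by
    intro s hs
    refine Submodule.mul_induction_on hs ?_ ?_
    · intro m hm n hn
      rw [mul_smul]
      exact smul_mem_extend_mul hm (h n hn)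
    · intro x y hx hy
      rw [add_smul]; exact add_mem hx hy
  have h1 := key t (by rw [mul_comm, ← h𝔟]; exact Ideal.mem_span_singleton_self t)
  rw [← mul_assoc, mul_comm 𝔟, ← h𝔟] at h1
  have h2 : ∀ x ∈ extend H (Ideal.span {t} * 𝔢), ∃ y ∈ extend H 𝔢, x = t • y := by
    intro x hx
    refine extend_induction hx ?_ ?_
    · intro r hr y
      obtain ⟨z, hz, rfl⟩ := Ideal.mem_span_singleton_mul.mp hr
      exact ⟨z • y, smul_mem_extend hz y, mul_smul _ _ _⟩
    · rintro _ _ ⟨y, hy, rfl⟩ ⟨z, hz, rfl⟩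
      exact ⟨y + z, add_mem hy hz, (smul_add _ _ _).symm⟩
  obtain ⟨y, hy, hxy⟩ := h2 _ h1
  rwa [smul_right_injective H ht0 hxy]

variable [HasReducedNorm O H]

theorem rtr_mul_mem {𝔞 : Ideal O} {x : H} (hx : x ∈ extend H 𝔞) (z : H) :
    rtr (x * z) ∈ 𝔞 := by
  refine extend_induction hx ?_ ?_
  · intro r hr y
    rw [smul_mul_assoc, rtr_smul]; exact Ideal.mul_mem_right _ _ hr
  · intro x y hx hy
    rw [add_mul, rtr_add]; exact add_mem hx hy

theorem rn_mem {𝔞 : Ideal O} {x : H} (hx : x ∈ extend H 𝔞) : rn x ∈ 𝔞 := by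
  refine (extend_induction (motive := fun x => x ∈ extend H 𝔞 ∧ rn x ∈ 𝔞) hx ?_ ?_).2
  · intro r hr y
    refine ⟨smul_mem_extend hr y, ?_⟩
    rw [rn_smul, sq, mul_assoc]; exact Ideal.mul_mem_right _ _ hr
  · intro x y hx hy
    refine ⟨add_mem hx.1 hy.1, ?_⟩
    rw [rn_add]
    exact add_mem (add_mem hx.2 hy.2) (rtr_mul_mem hx.1 _)

theorem conj_mem_extend {𝔞 : Ideal O} {x : H} (hx : x ∈ extend H 𝔞) :
    conj O x ∈ extend H 𝔞 := by
  refine extend_induction hx ?_ ?_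
  · intro r hr y
    rw [conj_smul]; exact smul_mem_extend hr _
  · intro x y hx hy
    rw [conj_add]; exact add_mem hx hy

theorem algebraMap_mem_extend_iff {𝔯 : Ideal O} (h𝔯 : 𝔯.IsPrime) {r : O} :
    algebraMap O H r ∈ extend H 𝔯 ↔ r ∈ 𝔯 := by
  refine ⟨fun h => ?_, algebraMap_mem_extend⟩
  have := rn_mem h
  rw [rn_algebraMap] at this
  exact h𝔯.mem_of_pow_mem 2 this

/-- If `H/𝔯H` is finite and not commutative, it has non-zero elements of norm zero. -/
theorem exists_rn_mem_of_not_comm {𝔯 : Ideal O} (h𝔯 : 𝔯.IsPrime) [Finite (H ⧸ extend H 𝔯)]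
    (hnc : ∃ x y : H, x * y - y * x ∉ extend H 𝔯) : ∃ x ∉ extend H 𝔯, rn x ∈ 𝔯 := by
  by_contra! hcon
  have hnt : Nontrivial (H ⧸ extend H 𝔯) := by
    refine Ideal.Quotient.nontrivial_iff.mpr fun h => ?_
    obtain ⟨x, y, hxy⟩ := hnc
    exact hxy (h ▸ Submodule.mem_top)
  have hnz : NoZeroDivisors (H ⧸ extend H 𝔯) := by
    refine ⟨fun {x y} hxy => ?_⟩
    obtain ⟨x, rfl⟩ := Ideal.Quotient.mk_surjective x
    obtain ⟨y, rfl⟩ := Ideal.Quotient.mk_surjective y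
    rw [← map_mul, Ideal.Quotient.eq_zero_iff_mem] at hxy
    rw [Ideal.Quotient.eq_zero_iff_mem, Ideal.Quotient.eq_zero_iff_mem]
    have h1 := rn_mem hxy
    rw [rn_mul] at h1
    by_contra! hne
    exact (h𝔯.mem_or_mem h1).elim (hcon x hne.1) (hcon y hne.2)
  have hdom : IsDomain (H ⧸ extend H 𝔯) := NoZeroDivisors.to_isDomain _
  -- Wedderburn's little theorem.
  have hfield := Finite.isDomain_to_isField (H ⧸ extend H 𝔯)
  obtain ⟨x, y, hxy⟩ := hnc
  apply hxy
  rw [← Ideal.Quotient.eq_zero_iff_mem, map_sub, map_mul, map_mul, hfield.mul_comm, sub_self]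

/-- The norms of the elements of `H x + 𝔯 H` are in `𝔯` if the norm of `x` is. -/
theorem rn_mem_of_mem_sup {𝔯 : Ideal O} {x z : H} (hx : rn x ∈ 𝔯)
    (hz : z ∈ Ideal.span {x} ⊔ extend H 𝔯) : rn z ∈ 𝔯 := by
  obtain ⟨u, hu, v, hv, rfl⟩ := Submodule.mem_sup.mp hz
  obtain ⟨h, rfl⟩ := Ideal.mem_span_singleton'.mp hu
  rw [rn_add, rn_mul]
  refine add_mem (add_mem (Ideal.mul_mem_left _ _ hx) (rn_mem hv)) ?_
  rw [rtr_mul_conj_comm]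
  exact rtr_mul_mem hv _

/-- Write (n(y)) = 𝔯𝔢. If r = hy then rȳ = n(y)h, so 𝔯ȳ ⊆ 𝔯𝔢H and y ∈ 𝔢H after cancelling and
conjugating. A maximal 𝔪 ⊇ 𝔢 would have y ∈ 𝔪H, hence 𝔯 ⊆ Hy would force 𝔪 = 𝔯, against y ∉ 𝔯H. -/
theorem span_rn_eq [IsDedekindDomain O] [Module.IsTorsionFree O H] {𝔯 : Ideal O}
    (h𝔯 : 𝔯.IsMaximal) (h𝔯0 : 𝔯 ≠ ⊥) {y : H}
    (h1 : ∀ r ∈ 𝔯, algebraMap O H r ∈ Ideal.span {y}) (h2 : rn y ∈ 𝔯)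
    (h3 : y ∉ extend H 𝔯) : Ideal.span {rn y} = 𝔯 := by
  obtain ⟨𝔢, h𝔢⟩ : 𝔯 ∣ Ideal.span {rn y} := Ideal.dvd_iff_le.mpr (by simpa using h2)
  have hy : y ∈ extend H 𝔢 := by
    rw [← conj_conj (O := O) y]
    refine conj_mem_extend (mem_extend_of_smul_mem h𝔯0 fun r hr => ?_)
    obtain ⟨h, hh⟩ := Ideal.mem_span_singleton'.mp (h1 r hr)
    rw [← h𝔢, Algebra.smul_def, ← hh, mul_assoc, mul_conj, ← Algebra.commutes]
    exact (extend H _).mul_mem_right _ (algebraMap_mem_extend (Ideal.mem_span_singleton_self _))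
  by_cases htop : 𝔢 = ⊤
  · rw [h𝔢, htop, Ideal.mul_top]
  obtain ⟨𝔪, h𝔪, h𝔢𝔪⟩ := Ideal.exists_le_maximal 𝔢 htop
  have hy𝔪 := extend_mono h𝔢𝔪 hy
  have hle : 𝔯 ≤ 𝔪 := fun r hr => by
    rw [← algebraMap_mem_extend_iff (H := H) h𝔪.isPrime]
    obtain ⟨h, hh⟩ := Ideal.mem_span_singleton'.mp (h1 r hr)
    rw [← hh]
    exact (extend H _).mul_mem_left _ hy𝔪
  rw [h𝔯.eq_of_le h𝔪.ne_top hle] at h3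
  exact absurd hy𝔪 h3

end Abstract

end QuatOrder

/-! ### Totally real fields: totally positive generators and signs of units. -/

namespace QuatOrder

open NumberField

variable {K : Type*} [Field K] [NumberField K]

section Real

variable [IsTotallyReal K]

/-- The real embedding of an infinite place of a totally real field. -/
def realEmb (w : InfinitePlace K) : K →+* ℝ :=
  InfinitePlace.embedding_of_isReal (IsTotallyReal.isReal w)

theorem norm_realEmb (w : InfinitePlace K) (x : K) : |realEmb w x| = w x :=
  InfinitePlace.norm_embedding_of_isReal (IsTotallyReal.isReal w) x

theorem exists_realEmb_eq (σ : K →+* ℝ) : ∃ w : InfinitePlace K, realEmb w = σ := by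
  set φ : K →+* ℂ := Complex.ofRealHom.comp σ
  have hφ : ComplexEmbedding.IsReal φ := IsTotallyReal.complexEmbedding_isReal φ
  refine ⟨InfinitePlace.mk φ, RingHom.ext fun x => ?_⟩
  apply Complex.ofReal_injective
  rw [realEmb, InfinitePlace.embedding_of_isReal_apply,
    InfinitePlace.embedding_mk_eq_of_isReal hφ]
  rfl

theorem totallyPositive_iff {α : K} :
    TotallyPositive α ↔ ∀ w : InfinitePlace K, 0 < realEmb w α := by
  refine ⟨fun h w => h _, fun h σ => ?_⟩
  obtain ⟨w, rfl⟩ := exists_realEmb_eq σ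
  exact h w

theorem TotallyPositive.ne_zero {α : K} (h : TotallyPositive α) : α ≠ 0 := by
  rintro rfl
  obtain ⟨w⟩ : Nonempty (InfinitePlace K) := inferInstance
  have := h (realEmb w)
  rw [map_zero] at this
  exact lt_irrefl _ this

/-- Weak approximation: an element of K within distance 1 of ±1 at each place has the prescribed
signs. -/
theorem exists_sign (ε : InfinitePlace K → ℤˣ) :
    ∃ x : 𝓞 K, ∀ w, 0 < ((ε w : ℤ) : ℝ) * realEmb w (algebraMap (𝓞 K) K x) := by
  have hd := InfinitePlace.denseRange_algebraMap_pi K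
  let p : (w : InfinitePlace K) → WithAbs w.1 := fun w => WithAbs.toAbs w.1 ((ε w : ℤ) : K)
  obtain ⟨x, hx⟩ := hd.exists_dist_lt p one_pos
  have hx' : ∀ w : InfinitePlace K, 0 < ((ε w : ℤ) : ℝ) * realEmb w x := by
    intro w
    have h1 : dist (p w) (algebraMap K ((v : InfinitePlace K) → WithAbs v.1) x w) < 1 := lt_of_le_of_lt (dist_le_pi_dist _ _ w) hx
    rw [dist_eq_norm] at h1
    have h2 : |realEmb w (((ε w : ℤ) : K) - x)| < 1 := by
      rw [norm_realEmb]; exact h1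
    rw [map_sub, map_intCast] at h2
    rcases Int.units_eq_one_or (ε w) with h | h <;> rw [h] at h2 ⊢ <;> rw [abs_lt] at h2 <;>
      push_cast at h2 ⊢ <;> linarith
  obtain ⟨r, s, hs, rfl⟩ := IsFractionRing.div_surjective (A := 𝓞 K) x
  -- The product rs = (r/s)s² is integral and has the signs of r/s.
  refine ⟨r * s, fun w => ?_⟩
  have hs0 : realEmb w (algebraMap (𝓞 K) K s) ≠ 0 := by
    rw [Ne, map_eq_zero]
    simpa using nonZeroDivisors.ne_zero hs
  have h3 := mul_pos (hx' w) (pow_pos (abs_pos.mpr hs0) 2)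
  rw [sq_abs, map_div₀] at h3
  rw [map_mul, map_mul]
  calc _ < _ := h3
    _ = _ := by field_simp

/-- Every non-zero ideal has a totally positive generator. -/
def HasPositiveGenerators (K : Type*) [Field K] [NumberField K] : Prop :=
  ∀ I : Ideal (𝓞 K), I ≠ ⊥ → ∃ x : 𝓞 K, TotallyPositive (algebraMap (𝓞 K) K x) ∧
    I = Ideal.span {x}

theorem exists_generator_of_coprime {𝔫 : Ideal (𝓞 K)}
    (h : ∀ 𝔯 : Ideal (𝓞 K), Prime 𝔯 → ¬ 𝔯 ∣ 𝔫 → ∃ x : 𝓞 K,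
      TotallyPositive (algebraMap (𝓞 K) K x) ∧ 𝔯 = Ideal.span {x}) :
    ∀ 𝔠 : Ideal (𝓞 K), 𝔠 ≠ 0 → 𝔫 ⊔ 𝔠 = ⊤ → ∃ x : 𝓞 K,
      TotallyPositive (algebraMap (𝓞 K) K x) ∧ 𝔠 = Ideal.span {x} := by
  intro 𝔠
  induction 𝔠 using UniqueFactorizationMonoid.induction_on_prime with
  | h₁ => exact fun h => absurd rfl h
  | h₂ x hx =>
    rintro - -
    refine ⟨1, fun σ => by simp, ?_⟩
    rw [Ideal.isUnit_iff.mp hx, Ideal.span_singleton_one]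
  | h₃ 𝔞 𝔯 h𝔞 h𝔯 ih =>
    intro h0 hsup
    have hle1 : 𝔯 * 𝔞 ≤ 𝔞 := Ideal.mul_le_right
    have hle2 : 𝔯 * 𝔞 ≤ 𝔯 := Ideal.mul_le_left
    obtain ⟨x, hx, rfl⟩ := ih h𝔞 (top_le_iff.mp (hsup ▸ sup_le_sup_left hle1 𝔫))
    have hnd : ¬ 𝔯 ∣ 𝔫 := fun hd => by
      have : 𝔯 = ⊤ := top_le_iff.mp (hsup ▸ sup_le (Ideal.dvd_iff_le.mp hd) hle2)
      exact h𝔯.not_isUnit (Ideal.isUnit_iff.mpr this)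
    obtain ⟨y, hy, rfl⟩ := h 𝔯 h𝔯 hnd
    refine ⟨y * x, fun σ => ?_, Ideal.span_singleton_mul_span_singleton y x⟩
    rw [map_mul, map_mul]; exact mul_pos (hy σ) (hx σ)

theorem exists_totallyPositive_add (t₀ : 𝓞 K) {m : ℕ} (hm : 0 < m) :
    ∃ k : ℕ, TotallyPositive (algebraMap (𝓞 K) K (t₀ + k * m)) := by
  obtain ⟨B, hB⟩ := (Set.finite_range
    fun w : InfinitePlace K => -realEmb w (algebraMap (𝓞 K) K t₀)).bddAbove
  obtain ⟨k, hk⟩ := exists_nat_gt B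
  refine ⟨k, totallyPositive_iff.mpr fun w => ?_⟩
  rw [map_add, map_add, map_mul, map_mul, map_natCast, map_natCast, map_natCast, map_natCast]
  have h1 : (1 : ℝ) ≤ m := by exact_mod_cast hm
  have h2 : (k : ℝ) ≤ k * m := le_mul_of_one_le_right (Nat.cast_nonneg _) h1
  have h3 := hB ⟨w, rfl⟩
  simp only at h3
  linarith

/-- A generator of J modulo I may be shifted by multiples of the integer N(I) ∈ I, and large shifts
are totally positive. -/
theorem exists_totallyPositive_sup_span_eq {I J : Ideal (𝓞 K)} (hIJ : I ≤ J) (hI : I ≠ 0) :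
    ∃ t : 𝓞 K, TotallyPositive (algebraMap (𝓞 K) K t) ∧ I ⊔ Ideal.span {t} = J := by
  obtain ⟨t₀, ht₀⟩ := IsDedekindDomain.exists_sup_span_eq hIJ hI
  have hm0 : 0 < Ideal.absNorm I := Nat.pos_of_ne_zero fun h0 => hI (Ideal.absNorm_eq_zero_iff.mp h0)
  obtain ⟨k, hk⟩ := exists_totallyPositive_add t₀ hm0
  have hkm : (k : 𝓞 K) * (Ideal.absNorm I : 𝓞 K) ∈ I :=
    Ideal.mul_mem_left _ _ (Ideal.absNorm_mem I)
  refine ⟨_, hk, Eq.trans ?_ ht₀⟩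
  generalize (k : 𝓞 K) * (Ideal.absNorm I : 𝓞 K) = e at hkm
  refine le_antisymm (sup_le le_sup_left ?_) (sup_le le_sup_left ?_)
  · rw [Ideal.span_singleton_le_iff_mem]
    exact add_mem (Ideal.mem_sup_right (Ideal.mem_span_singleton_self _))
      (Ideal.mem_sup_left hkm)
  · rw [Ideal.span_singleton_le_iff_mem]
    have h1 : t₀ + e - e ∈ I ⊔ Ideal.span {t₀ + e} :=
      sub_mem (Ideal.mem_sup_right (Ideal.mem_span_singleton_self _)) (Ideal.mem_sup_left hkm)
    rwa [add_sub_cancel_right] at h1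

/-- A totally positive t that generates I modulo 𝔫I satisfies (t) = I𝔠 with 𝔠 prime to 𝔫. Then 𝔠 =
(s) with s totally positive, and t/s generates I. -/
theorem hasPositiveGenerators_of_primes {𝔫 : Ideal (𝓞 K)} (h𝔫 : 𝔫 ≠ 0)
    (h : ∀ 𝔯 : Ideal (𝓞 K), Prime 𝔯 → ¬ 𝔯 ∣ 𝔫 → ∃ x : 𝓞 K,
      TotallyPositive (algebraMap (𝓞 K) K x) ∧ 𝔯 = Ideal.span {x}) :
    HasPositiveGenerators K := by
  intro I hI
  obtain ⟨t, htpos, hsup⟩ := exists_totallyPositive_sup_span_eq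
    (Ideal.mul_le_right : 𝔫 * I ≤ I) (mul_ne_zero h𝔫 hI)
  have ht0 : t ≠ 0 := fun h0 => htpos.ne_zero (by rw [h0, map_zero])
  obtain ⟨𝔠, h𝔠⟩ : I ∣ Ideal.span {t} := Ideal.dvd_iff_le.mpr (hsup.le.trans' le_sup_right)
  have h𝔠0 : 𝔠 ≠ 0 := by
    rintro rfl
    rw [mul_zero] at h𝔠
    exact ht0 (by simpa using h𝔠)
  have hcop' : 𝔫 ⊔ 𝔠 = ⊤ := by
    have : I * (𝔫 ⊔ 𝔠) = I * ⊤ := by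
      rw [Ideal.mul_sup, ← h𝔠, mul_comm I, hsup, Ideal.mul_top]
    exact mul_left_cancel₀ hI this
  obtain ⟨s, hs, rfl⟩ := exists_generator_of_coprime h 𝔠 h𝔠0 hcop'
  have hs0 : s ≠ 0 := fun h0 => hs.ne_zero (by rw [h0, map_zero])
  obtain ⟨u, hu⟩ : ∃ u, t = s * u := by
    have : t ∈ I * Ideal.span {s} := by rw [← h𝔠]; exact Ideal.mem_span_singleton_self t
    obtain ⟨u, hu⟩ := Ideal.mem_span_singleton'.mp (Ideal.mul_le_right this)
    exact ⟨u, by rw [← hu, mul_comm]⟩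
  refine ⟨u, fun σ => ?_, ?_⟩
  · have h1 := htpos σ
    rw [hu, map_mul, map_mul] at h1
    exact (mul_pos_iff_of_pos_left (hs σ)).mp h1
  · have h1 : I * Ideal.span {s} = Ideal.span {u} * Ideal.span {s} := by
      rw [← h𝔠, Ideal.span_singleton_mul_span_singleton, hu, mul_comm]
    exact mul_right_cancel₀ (by simpa using hs0) h1

/-- The signs of a unit. -/
def unitSigns : (𝓞 K)ˣ →* (InfinitePlace K → ℤˣ) where
  toFun u w := if 0 < realEmb w (algebraMap (𝓞 K) K u) then 1 else -1
  map_one' := by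
    funext w; simp
  map_mul' u v := by
    funext w
    have hne : ∀ u : (𝓞 K)ˣ, realEmb w (algebraMap (𝓞 K) K u) ≠ 0 := fun u => by simp
    simp only [Pi.mul_apply, Units.val_mul, map_mul]
    rcases (hne u).lt_or_gt with h1 | h1 <;> rcases (hne v).lt_or_gt with h2 | h2
    · simp [h1.not_gt, h2.not_gt, mul_pos_of_neg_of_neg h1 h2]
    · simp [h1.not_gt, h2, (mul_neg_of_neg_of_pos h1 h2).not_gt]
    · simp [h1, h2.not_gt, (mul_neg_of_pos_of_neg h1 h2).not_gt]
    · simp [h1, h2, mul_pos h1 h2]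

/-- If x has the wanted signs and y is a totally positive generator of (x), the unit x/y has them
too. -/
theorem unitSigns_surjective (hK : HasPositiveGenerators K) :
    Function.Surjective (unitSigns (K := K)) := by
  intro ε
  obtain ⟨x, hx⟩ := exists_sign ε
  have hx0 : x ≠ 0 := by
    rintro rfl
    obtain ⟨w⟩ : Nonempty (InfinitePlace K) := inferInstance
    have := hx w
    simp at this
  obtain ⟨y, hy, hxy⟩ := hK (Ideal.span {x}) (by simpa using hx0)
  obtain ⟨u, hu⟩ := (Ideal.span_singleton_eq_span_singleton.mp hxy).symm
  refine ⟨u, funext fun w => ?_⟩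
  have h1 := hx w
  rw [← hu, map_mul, map_mul] at h1
  have h2 := hy (realEmb w)
  have h3 : 0 < ((ε w : ℤ) : ℝ) * realEmb w (algebraMap (𝓞 K) K u) := by
    rw [mul_left_comm] at h1
    exact (mul_pos_iff_of_pos_left h2).mp h1
  change (if _ then _ else _) = _
  rcases Int.units_eq_one_or (ε w) with h | h <;> rw [h] at h3 ⊢
  · rw [if_pos (by simpa using h3)]
  · rw [if_neg]
    intro h4
    push_cast at h3
    linarith

theorem torsion_eq {ζ : (𝓞 K)ˣ} (h : ζ ∈ Units.torsion K) : ζ = 1 ∨ ζ = -1 := by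
  obtain ⟨w⟩ : Nonempty (InfinitePlace K) := inferInstance
  have h1 := (Units.mem_torsion K).mp h w
  rw [← norm_realEmb, abs_eq zero_le_one] at h1
  refine h1.imp (fun h => ?_) (fun h => ?_)
  · rw [← map_one (realEmb w)] at h
    exact Units.coe_injective K (by simpa using (realEmb w).injective h)
  · rw [← map_one (realEmb w), ← map_neg] at h
    exact Units.coe_injective K (by simpa using (realEmb w).injective h)

/-- By Dirichlet there are at most 2^(r+1) square classes of units, where r + 1 is the number of
real places. All 2^(r+1) sign patterns occur, so the signs determine the square class. -/
theorem exists_eq_sq_of_totallyPositive (hK : HasPositiveGenerators K) (u : (𝓞 K)ˣ)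
    (hu : TotallyPositive (algebraMap (𝓞 K) K u)) : ∃ v : (𝓞 K)ˣ, u = v ^ 2 := by
  classical
  -- The products of -1 and the fundamental units with exponents 0 or 1 represent all units modulo
  -- squares, since the torsion is ±1.
  let g : Bool × (Fin (Units.rank K) → Bool) → (𝓞 K)ˣ := fun p =>
    (if p.1 then -1 else 1) * ∏ i, if p.2 i then Units.fundSystem K i else 1
  have hg : ∀ u : (𝓞 K)ˣ, ∃ p v, u = g p * v ^ 2 := by
    intro u
    obtain ⟨⟨ζ, e⟩, he, -⟩ := Units.exist_unique_eq_mul_prod K u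
    simp only at he
    refine ⟨⟨decide ((ζ : (𝓞 K)ˣ) = -1), fun i => decide (e i % 2 = 1)⟩,
      ∏ i, Units.fundSystem K i ^ (e i / 2), ?_⟩
    rw [he, mul_assoc, ← Finset.prod_pow, ← Finset.prod_mul_distrib]
    congr 1
    · rcases torsion_eq ζ.2 with h | h <;> rw [h]
      · have : (1 : (𝓞 K)ˣ) ≠ -1 := by
          intro h
          have := congrArg (fun x : (𝓞 K)ˣ => (x : 𝓞 K)) h
          simp only [Units.val_one, Units.val_neg] at this
          have h2 : (2 : 𝓞 K) = 0 := by linear_combination this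
          exact two_ne_zero h2
        simp [this]
      · simp
    · refine Finset.prod_congr rfl fun i _ => ?_
      rw [← zpow_natCast, ← zpow_mul]
      rcases Int.emod_two_eq_zero_or_one (e i) with h | h
      · simp only [h]
        rw [if_neg (by simp), one_mul]
        congr 1; omega
      · simp only [h]
        rw [if_pos (by simp), ← zpow_one_add]
        congr 1; omega
  have hsq : ∀ v : (𝓞 K)ˣ, unitSigns (v ^ 2) = 1 := by
    intro v
    rw [map_pow]
    funext w
    exact Int.units_sq _
  have hsurj : Function.Surjective fun p => unitSigns (g p) := by
    intro ε
    obtain ⟨u, rfl⟩ := unitSigns_surjective hK ε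
    obtain ⟨p, v, rfl⟩ := hg u
    exact ⟨p, by simp only [map_mul, hsq, mul_one]⟩
  have hcard : Fintype.card (Bool × (Fin (Units.rank K) → Bool)) =
      Fintype.card (InfinitePlace K → ℤˣ) := by
    have h1 : Units.rank K + 1 = Fintype.card (InfinitePlace K) :=
      Nat.sub_add_cancel Fintype.card_pos
    simp only [Fintype.card_prod, Fintype.card_bool, Fintype.card_fun, Fintype.card_fin,
      Fintype.card_units_int, ← h1]
    ring
  have hinj := ((Fintype.bijective_iff_surjective_and_card _).mpr ⟨hsurj, hcard⟩).1
  obtain ⟨p, v, hpv⟩ := hg u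
  have h1 : unitSigns u = 1 := by
    funext w
    change (if _ then _ else _) = _
    rw [if_pos (hu _)]; rfl
  have h2 : p = ⟨false, fun _ => false⟩ := by
    apply hinj
    have h3 : g ⟨false, fun _ => false⟩ = 1 := by simp [g]
    simp only [h3, map_one]
    rw [hpv, map_mul, hsq, mul_one] at h1
    exact h1
  refine ⟨v, ?_⟩
  rw [hpv, h2]
  simp [g]

end Real

end QuatOrder

/-! ### From principal ideals away from the conductor to all ideals of prime norm. -/

namespace QuatOrder

open HasReducedNorm

section Abstract

variable {O : Type*} (H : Type*) [CommRing O] [Ring H] [Algebra O H] [HasReducedNorm O H]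

variable (O) in
/-- An element that pairs into `ϖ` with `H` and has norm divisible by `ϖ²` is in `ϖ H`. -/
def NormSaturated : Prop := ∀ ϖ : O, ϖ ≠ 0 → ∀ w : H,
  (∀ z : H, ϖ ∣ (rtr (z * w) : O)) → ϖ ^ 2 ∣ (rn w : O) → ∃ v : H, w = ϖ • v

/-- Left ideals containing an ideal prime to `𝔫` are principal. -/
def PrincipalAwayFrom (𝔫 : Ideal O) : Prop := ∀ (J : Ideal H) (𝔠 : Ideal O), 𝔠 ≠ ⊥ → 𝔠 ⊔ 𝔫 = ⊤ →
  (∀ c ∈ 𝔠, algebraMap O H c ∈ J) → ∃ y, J = Ideal.span {y}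

variable (O) in
/-- Left ideals of prime norm are principal. -/
def PrincipalAtPrimes : Prop := ∀ (ϖ : O) (_ : Prime ϖ) (J : Ideal H),
  algebraMap O H ϖ ∈ J → (∀ x ∈ J, ϖ ∣ (rn x : O)) → (∃ x ∈ J, ∀ v, x ≠ ϖ • v) →
  ∃ y, J = Ideal.span {y} ∧ Associated (rn y : O) ϖ

variable {H}

theorem dvd_rtr_mul_conj {ϖ : O} {J : Ideal H} (hJ : ∀ x ∈ J, ϖ ∣ (rn x : O)) {x y : H}
    (hx : x ∈ J) (hy : y ∈ J) : ϖ ∣ (rtr (x * conj O y) : O) := by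
  have h := rn_add (O := O) x y
  have h1 : (rtr (x * conj O y) : O) = rn (x + y) - rn x - rn y := by rw [h]; ring
  rw [h1]
  exact dvd_sub (dvd_sub (hJ _ (add_mem hx hy)) (hJ _ hx)) (hJ _ hy)

variable [IsDomain O] [Module.IsTorsionFree O H]

/-- If ϖ² divided all norms from J, polarising x ∈ J against ϖz̄ ∈ J would give ϖ ∣ tr(zx) for all
z, and saturation would put x in ϖH. -/
theorem exists_not_sq_dvd_rn (hsat : NormSaturated O H) {ϖ : O} (hϖ : ϖ ≠ 0) {J : Ideal H}
    (hϖJ : algebraMap O H ϖ ∈ J) (hne : ∃ x ∈ J, ∀ v, x ≠ ϖ • v) :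
    ∃ x ∈ J, ¬ ϖ ^ 2 ∣ rn x := by
  by_contra! hcon
  obtain ⟨x, hx, hxv⟩ := hne
  have htr : ∀ z : H, ϖ ∣ (rtr (z * x) : O) := fun z => by
    have hz : ϖ • conj O z ∈ J := by
      rw [Algebra.smul_def, Algebra.commutes]; exact J.mul_mem_left _ hϖJ
    have h1 := dvd_rtr_mul_conj hcon hx hz
    rw [conj_smul, conj_conj, mul_smul_comm, rtr_smul, sq] at h1
    rw [rtr_mul_comm]
    exact (mul_dvd_mul_iff_left hϖ).mp h1
  obtain ⟨v, hv⟩ := hsat ϖ hϖ x htr (hcon x hx)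
  exact hxv v hv

theorem exists_rn_coprime [IsPrincipalIdealRing O] {ϖ m : O} (hϖ : Prime ϖ) (hm : ¬ ϖ ∣ m)
    {J : Ideal H} (hϖJ : algebraMap O H ϖ ∈ J) {x₀ : H} (hx₀ : x₀ ∈ J)
    (hx : ¬ ϖ ^ 2 ∣ rn x₀) : ∃ x ∈ J, ¬ ϖ ^ 2 ∣ rn x ∧ IsCoprime (rn x) m := by
  have hcop : IsCoprime (ϖ ^ 2) m :=
    IsCoprime.pow_left ((Irreducible.coprime_iff_not_dvd hϖ.irreducible).mpr hm)
  obtain ⟨u, v, huv⟩ := hcop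
  -- Chinese remainders: x is x₀ modulo ϖ² and 1 modulo m, hence so is its norm, n(x₀) modulo ϖ² and
  -- 1 modulo m.
  set x := (v * m) • x₀ + algebraMap O H (u * ϖ ^ 2) with hxdef
  have hrn : rn x = (v * m) ^ 2 * rn x₀ + (u * ϖ ^ 2) ^ 2 + (v * m) * (u * ϖ ^ 2) * rtr x₀ := by
    rw [hxdef, rn_add, rn_smul, rn_algebraMap, conj_algebraMap, ← Algebra.commutes,
      ← Algebra.smul_def, smul_smul, rtr_smul]
    ring
  refine ⟨x, ?_, ?_, ?_⟩
  · refine add_mem ?_ ?_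
    · rw [Algebra.smul_def]; exact J.mul_mem_left _ hx₀
    · rw [show u * ϖ ^ 2 = (u * ϖ) * ϖ by ring, map_mul]; exact J.mul_mem_left _ hϖJ
  · intro hd
    apply hx
    have hvm : v * m = 1 - u * ϖ ^ 2 := by rw [← huv]; ring
    have : rn x₀ = rn x - ϖ ^ 2 * ((-2 * u + u ^ 2 * ϖ ^ 2) * rn x₀ + u ^ 2 * ϖ ^ 2
        + (v * m) * u * rtr x₀) := by
      rw [hrn, hvm]; ring
    rw [this]
    exact dvd_sub hd (dvd_mul_right _ _)
  · refine ⟨1, 2 * v - v ^ 2 * m - v ^ 2 * m * rn x₀ - v * (u * ϖ ^ 2) * rtr x₀, ?_⟩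
    have huϖ : u * ϖ ^ 2 = 1 - v * m := by rw [← huv]; ring
    rw [hrn, huϖ]; ring

/-- Choose x ∈ J with n(x) = ϖβ and β prime to 𝔫. Then L = Jx̄/ϖ is a left ideal of H containing β,
so L = Hy is principal. Multiplication by x/β carries L back to J. -/
theorem PrincipalAwayFrom.principalAtPrimes [IsPrincipalIdealRing O]
    {𝔫 : Ideal O} (h𝔫 : 𝔫 ≠ ⊥) (hP : PrincipalAwayFrom H 𝔫) (hsat : NormSaturated O H) :
    PrincipalAtPrimes O H := by
  intro ϖ hϖ J hϖJ hJ hne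
  obtain ⟨n, rfl⟩ := (IsPrincipalIdealRing.principal 𝔫).principal
  have hn : n ≠ 0 := by
    rintro rfl; simp at h𝔫
  obtain ⟨m, hnm, hm⟩ := (FiniteMultiplicity.of_prime_left hϖ hn).exists_eq_pow_mul_and_not_dvd
  set k := multiplicity ϖ n
  clear_value k
  subst hnm
  obtain ⟨x₀, hx₀, hx₀'⟩ := exists_not_sq_dvd_rn hsat hϖ.ne_zero hϖJ hne
  obtain ⟨x, hx, hxϖ, hxm⟩ := exists_rn_coprime hϖ hm hϖJ hx₀ hx₀'
  obtain ⟨β, hβ⟩ := hJ x hx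
  have hβϖ : ¬ ϖ ∣ β := fun h => hxϖ (by rw [hβ, sq]; exact mul_dvd_mul_left _ h)
  have hcop : IsCoprime β (ϖ ^ k * m) := by
    refine IsCoprime.mul_right ?_ ?_
    · exact ((Irreducible.coprime_iff_not_dvd hϖ.irreducible).mpr hβϖ).symm.pow_right
    · rw [hβ] at hxm; exact hxm.of_mul_left_right
  have hβ0 : β ≠ 0 := by
    rintro rfl; exact hβϖ (dvd_zero _)
  -- The division by ϖ stays in H by saturation: tr(zjx̄) is a polar value of the norm on J, and the
  -- norm of jx̄ is divisible by ϖ².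
  have hdiv : ∀ j ∈ J, ∃ l : H, j * conj O x = ϖ • l := fun j hj => by
    refine hsat ϖ hϖ.ne_zero _ (fun z => ?_) ?_
    · rw [← mul_assoc]
      exact dvd_rtr_mul_conj hJ (J.mul_mem_left z hj) hx
    · rw [rn_mul, rn_conj, sq]; exact mul_dvd_mul (hJ j hj) (hJ x hx)
  let L : Ideal H :=
    { carrier := {l | ∃ j ∈ J, j * conj O x = ϖ • l}
      add_mem' := by
        rintro l l' ⟨j, hj, h⟩ ⟨j', hj', h'⟩
        exact ⟨j + j', add_mem hj hj', by rw [add_mul, h, h', smul_add]⟩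
      zero_mem' := ⟨0, zero_mem _, by simp⟩
      smul_mem' := by
        rintro c l ⟨j, hj, h⟩
        exact ⟨c * j, J.mul_mem_left _ hj, by rw [mul_assoc, h, smul_eq_mul, mul_smul_comm]⟩ }
  obtain ⟨y, hy⟩ := hP L (Ideal.span {β}) (by simpa using hβ0)
    (by
      rw [← Ideal.isCoprime_iff_sup_eq]
      exact (Ideal.isCoprime_span_singleton_iff _ _).mpr hcop)
    (fun c hc => by
      obtain ⟨d, rfl⟩ := Ideal.mem_span_singleton'.mp hc
      rw [map_mul]
      refine L.mul_mem_left _ ⟨x, hx, ?_⟩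
      rw [mul_conj, hβ, map_mul, Algebra.smul_def])
  have hxx : ∀ j l : H, j * conj O x = ϖ • l → β • j = l * x := by
    intro j l h
    apply smul_right_injective H hϖ.ne_zero
    simp only
    rw [smul_smul, ← hβ, ← smul_mul_assoc, ← h, mul_assoc, conj_mul_self, ← Algebra.commutes,
      Algebra.smul_def]
  obtain ⟨g, hg, hgy⟩ : y ∈ L := by rw [hy]; exact Ideal.mem_span_singleton_self y
  have hJg : J = Ideal.span {g} := by
    refine le_antisymm (fun j hj => ?_) (by rwa [Ideal.span_singleton_le_iff_mem])
    obtain ⟨l, hl⟩ := hdiv j hj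
    have hlL : l ∈ L := ⟨j, hj, hl⟩
    rw [hy] at hlL
    obtain ⟨h, rfl⟩ := Ideal.mem_span_singleton'.mp hlL
    rw [Ideal.mem_span_singleton']
    refine ⟨h, smul_right_injective H hβ0 ?_⟩
    simp only
    rw [hxx _ _ hl, ← mul_smul_comm, hxx _ _ hgy, mul_assoc]
  refine ⟨g, hJg, ?_⟩
  have hmax : (Ideal.span {ϖ}).IsMaximal :=
    PrincipalIdealRing.isMaximal_of_irreducible hϖ.irreducible
  rw [← Ideal.span_singleton_eq_span_singleton]
  refine span_rn_eq hmax (by simpa using hϖ.ne_zero) (fun r hr => ?_) ?_ ?_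
  · obtain ⟨d, rfl⟩ := Ideal.mem_span_singleton'.mp hr
    rw [← hJg, map_mul]; exact J.mul_mem_left _ hϖJ
  · rw [Ideal.mem_span_singleton]; exact hJ g hg
  · intro hgϖ
    obtain ⟨z, hz, hzv⟩ := hne
    rw [hJg] at hz
    obtain ⟨h, rfl⟩ := Ideal.mem_span_singleton'.mp hz
    obtain ⟨v, hv⟩ := extend_span_singleton.mp ((extend H _).mul_mem_left h hgϖ)
    exact hzv v hv

end Abstract

section Concrete

variable {K : Type*} [Field K] [NumberField K] {a b : K}

/-- The quotient w/ϖ has integral norm and pairs integrally with H, so maximality contains it. -/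
theorem IsMaximalOrder.normSaturated {H : Subalgebra (𝓞 K) ℍ[K,a,b]} (hH : IsMaximalOrder H) :
    letI := IsOrder.hasReducedNorm hH.1
    NormSaturated (𝓞 K) H := by
  intro ϖ hϖ w htr hrn
  have hϖK : algebraMap (𝓞 K) K ϖ ≠ 0 := by simpa using hϖ
  have hmem : (algebraMap (𝓞 K) K ϖ)⁻¹ • w.1 ∈ H := by
    refine hH.mem_of_integral (fun z hz => ?_) ?_
    · obtain ⟨t, ht⟩ := htr ⟨z, hz⟩
      refine ⟨t, ?_⟩
      have h1 := IsOrder.trd_eq hH.1 (⟨z, hz⟩ * w)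
      rw [ht, map_mul] at h1
      have h2 : trd (z * (algebraMap (𝓞 K) K ϖ)⁻¹ • w.1) =
          (algebraMap (𝓞 K) K ϖ)⁻¹ * trd (z * w.1) := by
        rw [mul_smul_comm]; exact rtr_smul (O := K) (H := ℍ[K,a,b]) _ _
      rw [h2]
      change trd (z * w.1) = _ at h1
      rw [h1, inv_mul_cancel_left₀ hϖK]
    · obtain ⟨t, ht⟩ := hrn
      refine ⟨t, ?_⟩
      have h1 := IsOrder.nrd_eq hH.1 w
      rw [ht, map_mul, map_pow] at h1
      have h2 : nrd ((algebraMap (𝓞 K) K ϖ)⁻¹ • w.1) =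
          (algebraMap (𝓞 K) K ϖ)⁻¹ ^ 2 * nrd w.1 := rn_smul (O := K) (H := ℍ[K,a,b]) _ _
      rw [h2, h1, inv_pow, inv_mul_cancel_left₀ (pow_ne_zero 2 hϖK)]
  refine ⟨⟨_, hmem⟩, Subtype.ext ?_⟩
  change w.1 = ϖ • ((algebraMap (𝓞 K) K ϖ)⁻¹ • w.1)
  rw [← algebraMap_smul K ϖ, smul_smul, mul_inv_cancel₀ hϖK, one_smul]

/-- Conjugation exchanges left ideals with the right ideals to which the class number refers. -/
theorem principalAwayFrom {G H : Subalgebra (𝓞 K) ℍ[K,a,b]}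
    (hH : IsMaximalOrder H) (hG : IsOrder G) (hGH : G ≤ H) (hcls : classNumber G = 1)
    {𝔫 : Ideal (𝓞 K)} (h𝔫0 : 𝔫 ≠ ⊥) (h𝔫 : ∀ r ∈ 𝔫, ∀ x ∈ H, r • x ∈ G) :
    PrincipalAwayFrom H 𝔫 := by
  intro J 𝔠 h𝔠0 hcop h𝔠
  let _ := IsOrder.hasReducedNorm hH.1
  let L : Submodule (𝓞 K) ℍ[K,a,b] :=
    { carrier := {x | ∃ j ∈ J, x = star j.1}
      add_mem' := by
        rintro _ _ ⟨j, hj, rfl⟩ ⟨j', hj', rfl⟩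
        exact ⟨j + j', add_mem hj hj', (star_add _ _).symm⟩
      zero_mem' := ⟨0, zero_mem _, (star_zero _).symm⟩
      smul_mem' := by
        rintro c _ ⟨j, hj, rfl⟩
        refine ⟨c • j, ?_, ?_⟩
        · rw [Algebra.smul_def]; exact J.mul_mem_left _ hj
        · exact congrArg Subtype.val (conj_smul c j).symm }
  obtain ⟨y, ⟨j, hj, rfl⟩, hy⟩ := exists_eq_mul_of_coprime hH hG hGH hcls h𝔫0 h𝔫 h𝔠0 hcop
    (L := L)
    (by
      rintro _ ⟨j, hj, rfl⟩
      exact IsOrder.star_mem hH.1 j.2)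
    (by
      rintro _ ⟨j, hj, rfl⟩ h hh
      refine ⟨⟨star h, IsOrder.star_mem hH.1 hh⟩ * j, J.mul_mem_left _ hj, ?_⟩
      change star j.1 * h = star (star h * j.1)
      rw [star_mul, star_star])
    (fun c hc => ⟨_, h𝔠 c hc, congrArg Subtype.val (conj_algebraMap (H := H) c).symm⟩)
  refine ⟨j, le_antisymm (fun z hz => ?_) (by rwa [Ideal.span_singleton_le_iff_mem])⟩
  obtain ⟨h, hh, hzh⟩ := hy (star z.1) ⟨z, hz, rfl⟩
  rw [Ideal.mem_span_singleton']
  refine ⟨⟨star h, IsOrder.star_mem hH.1 hh⟩, Subtype.ext ?_⟩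
  change star h * j.1 = z.1
  rw [← star_star z.1, hzh, star_mul, star_star]

theorem dvd_discrd_iff {H : Subalgebra (𝓞 K) ℍ[K,a,b]} (hH : IsOrder H) {𝔇 : Ideal (𝓞 K)}
    (h𝔇 : discrd (Subalgebra.toSubmodule H) = IsLocalization.coeSubmodule K 𝔇)
    (𝔯 : Ideal (𝓞 K)) :
    letI := IsOrder.hasReducedNorm hH
    𝔯 ∣ 𝔇 ↔ ∀ x y z : H, rtr ((x * y - y * x) * conj (𝓞 K) z) ∈ 𝔯 := by
  let _ := hH.hasReducedNorm
  rw [Ideal.dvd_iff_le, ← IsFractionRing.coeSubmodule_le_coeSubmodule (K := K), ← h𝔇,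
    discrd, Submodule.span_le]
  constructor
  · intro h x y z
    obtain ⟨t, ht, hte⟩ := (IsLocalization.mem_coeSubmodule _ _).mp
      (h ⟨x.1, x.2, y.1, y.2, z.1, z.2, rfl⟩)
    have h1 := IsOrder.trd_eq hH ((x * y - y * x) * conj (𝓞 K) z)
    have h2 := FaithfulSMul.algebraMap_injective (𝓞 K) K (hte.trans h1)
    rwa [← h2]
  · rintro h _ ⟨x, hx, y, hy, z, hz, rfl⟩
    exact (IsLocalization.mem_coeSubmodule _ _).mpr ⟨_, h ⟨x, hx⟩ ⟨y, hy⟩ ⟨z, hz⟩,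
      (IsOrder.trd_eq hH _).symm⟩

end Concrete

end QuatOrder

/-! ### Triviality of the narrow class group. -/

namespace QuatOrder

open HasReducedNorm

theorem finite_quotient_extend {O H : Type*} [CommRing O] [Ring H] [Algebra O H]
    [Module.Finite O H] (𝔯 : Ideal O) [Finite (O ⧸ 𝔯)] : Finite (H ⧸ extend H 𝔯) := by
  have : Finite (H ⧸ (𝔯 • (⊤ : Submodule O H) : Submodule O H)) :=
    Module.finite_of_finite (O ⧸ 𝔯)
  refine Finite.of_surjective (α := H ⧸ (𝔯 • (⊤ : Submodule O H) : Submodule O H))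
    (Quotient.map' id fun x y h => ?_) fun c => ?_
  · rw [Submodule.quotientRel_def] at h ⊢
    exact h
  · obtain ⟨x, rfl⟩ := Ideal.Quotient.mk_surjective c
    exact ⟨Submodule.Quotient.mk x, rfl⟩

section

variable {K : Type*} [Field K] [NumberField K] {H : Type*} [Ring H] [Algebra (𝓞 K) H]
  [HasReducedNorm (𝓞 K) H]

/-- If left ideals of norm prime to `𝔫` are principal, so are the prime ideals of the centre, with
totally positive generators. -/
theorem PrincipalAwayFrom.hasPositiveGenerators [NumberField.IsTotallyReal K]
    [Module.Finite (𝓞 K) H] [Module.IsTorsionFree (𝓞 K) H] {𝔫 𝔇 : Ideal (𝓞 K)}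
    (h𝔫 : 𝔫 ≠ ⊥) (hP : PrincipalAwayFrom H 𝔫)
    (hpos : ∀ x : H, x ≠ 0 → TotallyPositive (algebraMap (𝓞 K) K (rn x))) (h𝔇0 : 𝔇 ≠ ⊥)
    (h𝔇 : ∀ 𝔯 : Ideal (𝓞 K), (∀ x y z : H, rtr ((x * y - y * x) * conj (𝓞 K) z) ∈ 𝔯) → 𝔯 ∣ 𝔇) :
    HasPositiveGenerators K := by
  refine hasPositiveGenerators_of_primes (mul_ne_zero h𝔫 h𝔇0) fun 𝔯 h𝔯 hndvd => ?_
  have h𝔯p : 𝔯.IsPrime := Ideal.isPrime_of_prime h𝔯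
  have h𝔯m : 𝔯.IsMaximal := h𝔯p.isMaximal h𝔯.ne_zero
  have h1 : ¬ 𝔯 ∣ 𝔫 := fun h => hndvd (h.mul_right _)
  have h2 : ¬ 𝔯 ∣ 𝔇 := fun h => hndvd (h.mul_left _)
  have hfin : Finite (𝓞 K ⧸ 𝔯) := Ideal.finiteQuotientOfFreeOfNeBot 𝔯 h𝔯.ne_zero
  have hfin' : Finite (H ⧸ extend H 𝔯) := finite_quotient_extend 𝔯
  -- Were H/𝔯H commutative, 𝔯 would divide every value of the discriminant form, hence 𝔇.
  obtain ⟨x, hx, hrx⟩ := exists_rn_mem_of_not_comm (H := H) h𝔯p (by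
    by_contra! hcon
    exact h2 (h𝔇 𝔯 fun x y z => rtr_mul_mem (hcon x y) _))
  set J := Ideal.span {x} ⊔ extend H 𝔯 with hJ
  have h𝔯J : ∀ r ∈ 𝔯, algebraMap (𝓞 K) H r ∈ J := fun r hr =>
    Ideal.mem_sup_right (algebraMap_mem_extend hr)
  obtain ⟨y, hy⟩ := hP J 𝔯 h𝔯.ne_zero
    (h𝔯m.out.2 _ (lt_of_le_of_ne le_sup_left fun h =>
      h1 (Ideal.dvd_iff_le.mpr (le_sup_right.trans_eq h.symm)))) h𝔯J
  have hyJ : y ∈ J := by rw [hy]; exact Ideal.mem_span_singleton_self y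
  have hy𝔯 : y ∉ extend H 𝔯 := fun h => by
    have hxJ : x ∈ J := Ideal.mem_sup_left (Ideal.mem_span_singleton_self x)
    rw [hy] at hxJ
    obtain ⟨c, rfl⟩ := Ideal.mem_span_singleton'.mp hxJ
    exact hx ((extend H 𝔯).mul_mem_left c h)
  refine ⟨rn y, hpos y ?_, (span_rn_eq h𝔯m h𝔯.ne_zero (fun r hr => ?_) ?_ hy𝔯).symm⟩
  · rintro rfl; exact hy𝔯 (zero_mem _)
  · rw [← hy]; exact h𝔯J r hr
  · exact rn_mem_of_mem_sup hrx hyJ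

end

end QuatOrder

/-! ### Reduction modulo a prime; primes dividing the discriminant. -/

namespace QuatOrder

open HasReducedNorm

section Local

variable {O H : Type*} [CommRing O] [Ring H] [Algebra O H]

theorem mem_extend_span_iff_repr {κ : Type*} [Fintype κ] (B : Module.Basis κ O H) (ϖ : O) (x : H) :
    x ∈ extend H (Ideal.span {ϖ}) ↔ ∀ i, ϖ ∣ B.repr x i := by
  rw [extend_span_singleton]
  constructor
  · rintro ⟨y, rfl⟩ i
    simp
  · intro h
    choose c hc using h
    refine ⟨∑ i, c i • B i, ?_⟩
    rw [Finset.smul_sum, ← B.sum_repr x]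
    exact Finset.sum_congr rfl fun i _ => by rw [hc, smul_smul]

theorem natCard_quotient_extend {κ : Type*} [Fintype κ] (B : Module.Basis κ O H) (ϖ : O) :
    Nat.card (H ⧸ extend H (Ideal.span {ϖ})) =
      Nat.card (O ⧸ Ideal.span {ϖ}) ^ Fintype.card κ := by
  let f : H →+ (κ → O ⧸ Ideal.span {ϖ}) :=
    { toFun := fun x i => Ideal.Quotient.mk _ (B.repr x i)
      map_zero' := by ext; simp
      map_add' := fun x y => by ext; simp }
  have hf : Function.Surjective f := by
    intro c
    choose d hd using fun i => Ideal.Quotient.mk_surjective (c i)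
    refine ⟨B.equivFun.symm d, funext fun i => ?_⟩
    change Ideal.Quotient.mk _ (B.equivFun (B.equivFun.symm d) i) = _
    rw [LinearEquiv.apply_symm_apply, hd]
  have hker : f.ker = (extend H (Ideal.span {ϖ})).toAddSubgroup := by
    ext x
    rw [AddMonoidHom.mem_ker, Submodule.mem_toAddSubgroup, mem_extend_span_iff_repr B]
    rw [funext_iff]
    exact forall_congr' fun i => by
      change Ideal.Quotient.mk _ _ = 0 ↔ _
      rw [Ideal.Quotient.eq_zero_iff_mem, Ideal.mem_span_singleton]
  rw [← Nat.card_eq_fintype_card, ← Nat.card_fun, ← Nat.card_congr (QuotientAddGroup.quotientKerEquivOfSurjective f hf).toEquiv,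
    hker]
  rfl

variable [HasReducedNorm O H] [IsDomain O] [IsPrincipalIdealRing O] [Module.IsTorsionFree O H]

theorem finite_quotient_of_basis (B : Module.Basis (Fin 4) O H) (ϖ : O)
    [Finite (O ⧸ Ideal.span {ϖ})] : Finite (H ⧸ extend H (Ideal.span {ϖ})) := by
  have := Module.Finite.of_basis B
  exact finite_quotient_extend _

theorem one_lt_natCard_quotient {ϖ : O} (hϖ : Prime ϖ) [Finite (O ⧸ Ideal.span {ϖ})] :
    1 < Nat.card (O ⧸ Ideal.span {ϖ}) := by
  have : Nontrivial (O ⧸ Ideal.span {ϖ}) := Ideal.Quotient.nontrivial_iff.mpr (by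
    rw [Ne, Ideal.span_singleton_eq_top]; exact hϖ.not_isUnit)
  exact Finite.one_lt_card

/-- The reduced norm has non-trivial zeros modulo every prime. -/
theorem exists_dvd_rn (B : Module.Basis (Fin 4) O H) {ϖ : O} (hϖ : Prime ϖ)
    [Finite (O ⧸ Ideal.span {ϖ})] : ∃ x : H, (∀ v, x ≠ ϖ • v) ∧ ϖ ∣ (rn x : O) := by
  by_contra! hcon
  have hcon' : ∀ x : H, ϖ ∣ (rn x : O) → x ∈ extend H (Ideal.span {ϖ}) := by
    intro x hx
    by_contra hx'
    exact hcon x (fun v hv => hx' (extend_span_singleton.mpr ⟨v, hv⟩)) hx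
  have hprime : (Ideal.span {ϖ}).IsPrime := (Ideal.span_singleton_prime hϖ.ne_zero).mpr hϖ
  have hfin := finite_quotient_of_basis B ϖ
  set E := extend H (Ideal.span {ϖ}) with hE
  -- Without non-trivial zeros H/ϖH is a finite domain, hence commutative; so trace and norm
  -- determine a class up to conjugation.
  have hcomm : ∀ x y : H, x * y - y * x ∈ E := by
    by_contra! hne
    obtain ⟨x, hx, hrx⟩ := exists_rn_mem_of_not_comm hprime hne
    exact hx (hcon' x (Ideal.mem_span_singleton.mp hrx))
  have hzd : ∀ x y : H, x * y ∈ E → x ∈ E ∨ y ∈ E := by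
    intro x y hxy
    have h := rn_mem hxy
    rw [rn_mul, Ideal.mem_span_singleton] at h
    exact (hϖ.dvd_or_dvd h).imp (hcon' x) (hcon' y)
  set F := O ⧸ Ideal.span {ϖ} with hF
  let out : H ⧸ E → H := fun c => (Ideal.Quotient.mk_surjective c).choose
  have hout : ∀ c, Ideal.Quotient.mk E (out c) = c :=
    fun c => (Ideal.Quotient.mk_surjective c).choose_spec
  let f : H ⧸ E → F × F := fun c =>
    (Ideal.Quotient.mk _ (rtr (out c)), Ideal.Quotient.mk _ (rn (out c)))
  have hsum : ∀ c d, f c = f d → c = d ∨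
      out c + out d - algebraMap O H (rtr (out d) : O) ∈ E := by
    intro c d hcd
    have h1 : (rtr (out c) : O) - rtr (out d) ∈ Ideal.span {ϖ} :=
      Ideal.Quotient.eq.mp (congrArg Prod.fst hcd)
    have h2 : (rn (out c) : O) - rn (out d) ∈ Ideal.span {ϖ} :=
      Ideal.Quotient.eq.mp (congrArg Prod.snd hcd)
    -- The second factor is c minus the conjugate of d.
    have h3 : (out c - out d) * (out c + out d - algebraMap O H (rtr (out d) : O)) ∈ E := by
      have : (out c - out d) * (out c + out d - algebraMap O H (rtr (out d) : O)) =
          (out c * out d - out d * out c) + ((rtr (out c) - rtr (out d) : O)) • out c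
            - algebraMap O H (rn (out c) - rn (out d) : O) := by
        have hc := mul_self_eq (O := O) (out c)
        have hd := mul_self_eq (O := O) (out d)
        rw [mul_sub, sub_mul, mul_add, mul_add, hc, hd, ← Algebra.commutes,
          ← Algebra.smul_def, map_sub, sub_smul, smul_sub]
        abel
      rw [this]
      exact sub_mem (add_mem (hcomm _ _) (smul_mem_extend h1 _)) (algebraMap_mem_extend h2)
    refine (hzd _ _ h3).imp_left fun h => ?_
    rw [← hout c, ← hout d]
    exact Ideal.Quotient.eq.mpr h
  -- At most two classes share a trace and a norm, so N⁴ ≤ 2N², impossible for N ≥ 2.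
  have hle : Nat.card (H ⧸ E) ≤ 2 * Nat.card (F × F) := by
    classical
    have := Fintype.ofFinite (H ⧸ E)
    have := Fintype.ofFinite F
    rw [Nat.card_eq_fintype_card, Nat.card_eq_fintype_card]
    refine (Finset.card_le_mul_card_image_of_maps_to (f := f) (s := Finset.univ)
      (t := Finset.univ) (fun _ _ => Finset.mem_univ _) 2 fun b _ => ?_)
    by_contra! hlt
    obtain ⟨c, d, e, hc, hd, he, hcd, hce, hde⟩ := Finset.two_lt_card_iff.mp hlt
    simp only [Finset.mem_filter, Finset.mem_univ, true_and] at hc hd he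
    have h1 := (hsum c d (hc.trans hd.symm)).resolve_left hcd
    have h2 := (hsum e d (he.trans hd.symm)).resolve_left (Ne.symm hde)
    apply hce
    rw [← hout c, ← hout e]
    refine Ideal.Quotient.eq.mpr ?_
    have h3 := sub_mem h1 h2
    rwa [sub_sub_sub_cancel_right, add_sub_add_right_eq_sub] at h3
  rw [natCard_quotient_extend B, Nat.card_prod, Fintype.card_fin] at hle
  have h1 := one_lt_natCard_quotient hϖ
  have h2 : 4 ≤ Nat.card F * Nat.card F := Nat.mul_le_mul h1 h1
  have h3 : Nat.card F ^ 4 = (Nat.card F * Nat.card F) * (Nat.card F * Nat.card F) := by ring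
  rw [h3] at hle
  nlinarith

/-- An element of norm divisible by `ϖ` generates modulo `ϖ` a left ideal of norm `ϖ`. -/
theorem exists_sup_eq_span (hP : PrincipalAtPrimes O H) {ϖ : O} (hϖ : Prime ϖ) {x : H}
    (hx : ∀ v, x ≠ ϖ • v) (hrx : ϖ ∣ (rn x : O)) :
    ∃ y, Ideal.span {x} ⊔ extend H (Ideal.span {ϖ}) = Ideal.span {y} ∧
      Associated (rn y : O) ϖ := by
  refine hP ϖ hϖ _ ?_ (fun z hz => ?_) ⟨x, ?_, hx⟩
  · exact Ideal.mem_sup_right (algebraMap_mem_extend (Ideal.mem_span_singleton_self ϖ))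
  · exact Ideal.mem_span_singleton.mp
      (rn_mem_of_mem_sup (Ideal.mem_span_singleton.mpr hrx) hz)
  · exact Ideal.mem_sup_left (Ideal.mem_span_singleton_self x)

theorem exists_associated_rn (hP : PrincipalAtPrimes O H) (B : Module.Basis (Fin 4) O H) {ϖ : O}
    (hϖ : Prime ϖ) [Finite (O ⧸ Ideal.span {ϖ})] : ∃ y : H, Associated (rn y : O) ϖ := by
  obtain ⟨x, hx, hrx⟩ := exists_dvd_rn B hϖ
  obtain ⟨y, -, hy⟩ := exists_sup_eq_span hP hϖ hx hrx
  exact ⟨y, hy⟩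

section Ramified

variable {ϖ : O} (hram : ∀ x y z : H, ϖ ∣ (rtr ((x * y - y * x) * conj O z) : O))
include hram

/-- Since eaē = [e, aē] + n(e)a, it pairs into ϖ with H: the commutator by ramification, the rest by
ϖ ∣ n(e). Its norm n(e)²n(a) is divisible by ϖ², so saturation applies. -/
theorem mul_mul_conj_mem (hsat : NormSaturated O H) (hϖ : Prime ϖ) {e : H}
    (he : ϖ ^ 2 ∣ (rn e : O)) (a : H) : e * a * conj O e ∈ extend H (Ideal.span {ϖ}) := by
  rw [extend_span_singleton]
  refine hsat ϖ hϖ.ne_zero _ (fun z => ?_) ?_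
  · have h : e * a * conj O e = (e * (a * conj O e) - a * conj O e * e) + (rn e : O) • a := by
      rw [mul_assoc a, conj_mul_self, ← Algebra.commutes, Algebra.smul_def, mul_assoc]; abel
    rw [h, mul_add, rtr_add, mul_smul_comm, rtr_smul]
    refine dvd_add ?_ (((dvd_pow_self ϖ two_ne_zero).trans he).mul_right _)
    have h2 := hram e (a * conj O e) (conj O z)
    rwa [conj_conj, rtr_mul_comm] at h2
  · rw [rn_mul, rn_mul, mul_assoc]
    exact he.mul_right _

/-- At a prime dividing the discriminant of a maximal order the elements of norm divisible by `ϖ`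
are closed under addition. -/
theorem dvd_rtr_of_ramified (hsat : NormSaturated O H) (B : Module.Basis (Fin 4) O H)
    (hϖ : Prime ϖ) [Finite (O ⧸ Ideal.span {ϖ})] {x y : H} (hx : ϖ ∣ (rn x : O))
    (hy : ϖ ∣ (rn y : O)) : ϖ ∣ (rtr (x * conj O y) : O) := by
  by_contra hcon
  obtain ⟨s, c, hs⟩ := (Irreducible.coprime_iff_not_dvd hϖ.irreducible).mpr hcon
  -- Scaling xȳ by the inverse of its trace gives trace 1 modulo ϖ and norm 0 modulo ϖ²: an
  -- idempotent e modulo ϖ with complement ē.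
  obtain ⟨e, hedef⟩ : ∃ e, e = c • (x * conj O y) := ⟨_, rfl⟩
  have htr : (rtr e : O) = 1 - s * ϖ := by rw [hedef, rtr_smul, ← hs]; ring
  have hrn : ϖ ^ 2 ∣ (rn e : O) := by
    rw [hedef, rn_smul, rn_mul, rn_conj, sq ϖ]
    exact (mul_dvd_mul hx hy).mul_left _
  have hfin := finite_quotient_of_basis B ϖ
  set E := extend H (Ideal.span {ϖ}) with hE
  have hmemϖ : ∀ r : O, ϖ ∣ r → ∀ z : H, r • z ∈ E := fun r hr z =>
    smul_mem_extend (Ideal.mem_span_singleton.mpr hr) z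
  have hpeirce : ∀ e : H, ϖ ^ 2 ∣ (rn e : O) → ∀ a, e * a * e - (rtr (a * e) : O) • e ∈ E := by
    intro e he a
    rw [mul_mul_self (O := O), sub_sub_cancel_left]
    exact neg_mem (hmemϖ _ ((dvd_pow_self ϖ two_ne_zero).trans he) _)
  have hrn' : ϖ ^ 2 ∣ (rn (conj O e) : O) := by rwa [rn_conj]
  -- Peirce decomposition: the parts eaē and ēae vanish modulo ϖ, and eae, ēaē are multiples of e
  -- and ē. Two elements would span H/ϖH, giving N⁴ ≤ N².
  have hspan : ∀ a : H, a - ((rtr (a * e) : O) • e + (rtr (a * conj O e) : O) • conj O e) ∈ E := by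
    intro a
    have h1 : (e + conj O e) * a * (e + conj O e) = a + ϖ • ((-2 * s + s ^ 2 * ϖ) • a) := by
      rw [add_conj, htr, ← Algebra.smul_def, ← Algebra.commutes, ← Algebra.smul_def]
      module
    have h2 := mul_mul_conj_mem hram hsat hϖ hrn a
    have h3 := mul_mul_conj_mem hram hsat hϖ hrn' a
    rw [conj_conj] at h3
    have h4 := hpeirce e hrn a
    have h5 := hpeirce _ hrn' a
    have h6 := hmemϖ ϖ dvd_rfl ((-2 * s + s ^ 2 * ϖ) • a)
    have h7 := sub_mem (add_mem (add_mem (add_mem h2 h3) h4) h5) h6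
    convert h7 using 1
    rw [eq_sub_iff_add_eq, sub_add_eq_add_sub, ← h1]
    noncomm_ring
  set F := O ⧸ Ideal.span {ϖ} with hF
  let out : F → O := fun c => (Ideal.Quotient.mk_surjective c).choose
  have hout : ∀ c, Ideal.Quotient.mk _ (out c) = c :=
    fun c => (Ideal.Quotient.mk_surjective c).choose_spec
  have hsub : ∀ r : O, ∀ z : H, r • z - out (Ideal.Quotient.mk _ r) • z ∈ E := by
    intro r z
    rw [← sub_smul]
    refine smul_mem_extend (Ideal.Quotient.eq.mp ?_) z
    rw [hout]
  have hsurj : Function.Surjective fun p : F × F =>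
      Ideal.Quotient.mk E (out p.1 • e + out p.2 • conj O e) := by
    intro q
    obtain ⟨a, rfl⟩ := Ideal.Quotient.mk_surjective q
    refine ⟨(Ideal.Quotient.mk _ (rtr (a * e)), Ideal.Quotient.mk _ (rtr (a * conj O e))),
      (Ideal.Quotient.eq.mpr ?_).symm⟩
    have h := add_mem (hspan a) (add_mem (hsub (rtr (a * e)) e)
      (hsub (rtr (a * conj O e)) (conj O e)))
    convert h using 1
    abel
  have hle := Nat.card_le_card_of_surjective _ hsurj
  rw [natCard_quotient_extend B, Nat.card_prod, Fintype.card_fin] at hle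
  have h1 := one_lt_natCard_quotient hϖ
  have h2 : 4 ≤ Nat.card F * Nat.card F := Nat.mul_le_mul h1 h1
  have h3 : Nat.card F ^ 4 = (Nat.card F * Nat.card F) * (Nat.card F * Nat.card F) := by ring
  rw [h3] at hle
  nlinarith

/-- Saturation gives xȳ = ϖv, so x is a unit times vy. In particular, at such a prime all left
ideals of norm ϖ coincide. -/
theorem mem_span_iff_of_ramified (hsat : NormSaturated O H) (B : Module.Basis (Fin 4) O H)
    (hϖ : Prime ϖ) [Finite (O ⧸ Ideal.span {ϖ})] {y : H} (hy : Associated (rn y : O) ϖ) (x : H) :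
    x ∈ Ideal.span {y} ↔ ϖ ∣ (rn x : O) := by
  constructor
  · intro hx
    obtain ⟨c, rfl⟩ := Ideal.mem_span_singleton'.mp hx
    rw [rn_mul]; exact hy.dvd'.mul_left _
  · intro hx
    obtain ⟨v, hv⟩ := hsat ϖ hϖ.ne_zero (x * conj O y) (fun z => by
        rw [← mul_assoc]
        refine dvd_rtr_of_ramified hram hsat B hϖ ?_ hy.dvd'
        rw [rn_mul]; exact hx.mul_left _)
      (by rw [rn_mul, rn_conj, sq]; exact mul_dvd_mul hx hy.dvd')
    obtain ⟨u, hu⟩ := hy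
    rw [Ideal.mem_span_singleton']
    refine ⟨(u : O) • v, smul_right_injective H (r := (rn y : O)) ?_ ?_⟩
    · intro h0
      rw [h0, zero_mul] at hu
      exact hϖ.ne_zero hu.symm
    · simp only
      rw [← smul_mul_assoc, smul_smul, hu, ← hv, mul_assoc, conj_mul_self, ← Algebra.commutes,
        Algebra.smul_def]

end Ramified

end Local

end QuatOrder

/-! ### The discriminant form and the action of H on H/Hy at unramified primes. -/

namespace QuatOrder

open HasReducedNorm

section Local

variable {O H : Type*} [CommRing O] [Ring H] [Algebra O H] [HasReducedNorm O H]

/-- The trilinear form whose values generate the discriminant. -/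
def discForm (O : Type*) {H : Type*} [CommRing O] [Ring H] [Algebra O H] [HasReducedNorm O H]
    (x y z : H) : O := rtr ((x * y - y * x) * conj O z)

theorem discForm_swap (x y z : H) : discForm O x y z = - discForm O y x z := by
  rw [discForm, discForm, ← rtr_neg, ← neg_mul, neg_sub]

theorem discForm_add (x y z w : H) :
    discForm O x y (z + w) = discForm O x y z + discForm O x y w := by
  simp only [discForm, conj_add, mul_add, rtr_add]

theorem discForm_smul (x y z : H) (r : O) : discForm O x y (r • z) = r * discForm O x y z := by
  simp only [discForm, conj_smul, mul_smul_comm, rtr_smul]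

theorem discForm_algebraMap (x y : H) (r : O) : discForm O x y (algebraMap O H r) = 0 := by
  rw [discForm, conj_algebraMap, ← Algebra.commutes, ← Algebra.smul_def, rtr_smul, rtr_sub,
    rtr_mul_comm, sub_self, mul_zero]

/-- Both terms are n(x)tr(y). Together with the antisymmetry this makes the form alternating, with
the scalars in its radical. -/
theorem discForm_self (x y : H) : discForm O x y x = 0 := by
  have h : (rtr (x * y * conj O x) : O) = rtr (y * x * conj O x) := by
    rw [rtr_mul_comm, ← mul_assoc, conj_mul_self, mul_assoc, mul_conj, Algebra.commutes]
  rw [discForm, sub_mul, rtr_sub, h, sub_self]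

theorem discForm_self_right (x y : H) : discForm O x y y = 0 := by
  rw [discForm_swap, discForm_self, neg_zero]

theorem discForm_add_left (x y z w : H) :
    discForm O (x + y) z w = discForm O x z w + discForm O y z w := by
  simp only [discForm, ← rtr_add]
  congr 1
  noncomm_ring

theorem discForm_rotate (x y z : H) : discForm O x y z = discForm O y z x := by
  have h1 := discForm_self (O := O) (x + z) y
  rw [discForm_add, discForm_add_left, discForm_add_left, discForm_self, discForm_self, zero_add,
    add_zero] at h1
  rw [discForm_swap y z x]
  linear_combination h1

theorem discForm_mem_of_mem_extend {𝔞 : Ideal O} (x y : H) {z : H} (hz : z ∈ extend H 𝔞) :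
    discForm O x y z ∈ 𝔞 := by
  rw [discForm, rtr_mul_comm]
  exact rtr_mul_mem (conj_mem_extend hz) _

variable [IsDomain O] [IsPrincipalIdealRing O] [Module.IsTorsionFree O H]

/-- The radical of the discriminant form modulo an unramified prime consists of the scalars. -/
theorem exists_scalar_of_discForm (B : Module.Basis (Fin 4) O H) {ϖ : O} (hϖ : Prime ϖ)
    [Finite (O ⧸ Ideal.span {ϖ})] {x₀ y₀ z₀ : H} (h₀ : ¬ ϖ ∣ discForm O x₀ y₀ z₀) {x : H}
    (hx : ∀ a b, ϖ ∣ discForm O a b x) :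
    ∃ r : O, x - algebraMap O H r ∈ extend H (Ideal.span {ϖ}) := by
  have hfin := finite_quotient_of_basis B ϖ
  set E := extend H (Ideal.span {ϖ}) with hE
  set F := O ⧸ Ideal.span {ϖ} with hF
  -- The elements 1, x₀, y₀, z₀ form a basis modulo ϖ: the form reads off the last three
  -- coordinates, and injectivity suffices because both sides have N⁴ elements.
  let g : (Fin 4 → O) → H := fun c =>
    algebraMap O H (c 0) + c 1 • x₀ + c 2 • y₀ + c 3 • z₀
  have hT : ∀ c a b, discForm O a b (g c) = c 1 * discForm O a b x₀ + c 2 * discForm O a b y₀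
      + c 3 * discForm O a b z₀ := by
    intro c a b
    simp only [g, discForm_add, discForm_smul, discForm_algebraMap, zero_add]
  have hkey : ∀ c, (∀ a b, ϖ ∣ discForm O a b (g c)) → ϖ ∣ c 1 ∧ ϖ ∣ c 2 ∧ ϖ ∣ c 3 := by
    intro c hc
    refine ⟨?_, ?_, ?_⟩
    · have h := hc y₀ z₀
      rw [hT, discForm_self, discForm_self_right, ← discForm_rotate x₀ y₀ z₀,
        mul_zero, mul_zero, add_zero, add_zero] at h
      exact (hϖ.dvd_or_dvd h).resolve_right h₀
    · have h := hc z₀ x₀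
      rw [hT, discForm_self, discForm_self_right, discForm_rotate z₀ x₀ y₀,
        mul_zero, mul_zero, add_zero, zero_add] at h
      exact (hϖ.dvd_or_dvd h).resolve_right h₀
    · have h := hc x₀ y₀
      rw [hT, discForm_self, discForm_self_right,
        mul_zero, mul_zero, zero_add, zero_add] at h
      exact (hϖ.dvd_or_dvd h).resolve_right h₀
  have hker : ∀ c, g c ∈ E → ∀ i, ϖ ∣ c i := by
    intro c hc
    obtain ⟨h1, h2, h3⟩ := hkey c fun a b =>
      Ideal.mem_span_singleton.mp (discForm_mem_of_mem_extend a b hc)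
    have h0 : algebraMap O H (c 0) ∈ E := by
      have hm : ∀ r : O, ϖ ∣ r → ∀ z : H, r • z ∈ E := fun r hr z =>
        smul_mem_extend (Ideal.mem_span_singleton.mpr hr) z
      have := sub_mem (sub_mem (sub_mem hc (hm _ h3 z₀)) (hm _ h2 y₀)) (hm _ h1 x₀)
      simpa [g] using this
    rw [algebraMap_mem_extend_iff ((Ideal.span_singleton_prime hϖ.ne_zero).mpr hϖ),
      Ideal.mem_span_singleton] at h0
    intro i
    fin_cases i
    exacts [h0, h1, h2, h3]
  let out : F → O := fun c => (Ideal.Quotient.mk_surjective c).choose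
  have hout : ∀ c, Ideal.Quotient.mk _ (out c) = c :=
    fun c => (Ideal.Quotient.mk_surjective c).choose_spec
  have hinj : Function.Injective fun c : Fin 4 → F => Ideal.Quotient.mk E (g (out ∘ c)) := by
    intro c d hcd
    have h1 : g (out ∘ c) - g (out ∘ d) ∈ E := Ideal.Quotient.eq.mp hcd
    have h2 : g (out ∘ c) - g (out ∘ d) = g (out ∘ c - out ∘ d) := by
      simp only [g, Pi.sub_apply, map_sub, sub_smul]; abel
    rw [h2] at h1
    funext i
    rw [← hout (c i), ← hout (d i)]
    exact Ideal.Quotient.eq.mpr (Ideal.mem_span_singleton.mpr (hker _ h1 i))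
  have hcard : Nat.card (Fin 4 → F) = Nat.card (H ⧸ E) := by
    rw [natCard_quotient_extend B, Nat.card_fun, Nat.card_eq_fintype_card (α := Fin 4)]
  obtain ⟨c, hc⟩ := ((Nat.bijective_iff_injective_and_card _).mpr ⟨hinj, hcard⟩).2
    (Ideal.Quotient.mk E x)
  have hgx : x - g (out ∘ c) ∈ E := Ideal.Quotient.eq.mp hc.symm
  obtain ⟨h1, h2, h3⟩ := hkey (out ∘ c) fun a b => by
    have h := Ideal.mem_span_singleton.mp (discForm_mem_of_mem_extend a b hgx)
    have h' : discForm O a b (g (out ∘ c)) =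
        discForm O a b x - discForm O a b (x - g (out ∘ c)) := by
      rw [eq_sub_iff_add_eq, ← discForm_add, add_sub_cancel]
    rw [h']
    exact dvd_sub (hx a b) h
  have hm : ∀ r : O, ϖ ∣ r → ∀ z : H, r • z ∈ E := fun r hr z =>
    smul_mem_extend (Ideal.mem_span_singleton.mpr hr) z
  refine ⟨(out ∘ c) 0, ?_⟩
  have := add_mem (add_mem (add_mem hgx (hm _ h3 z₀)) (hm _ h2 y₀)) (hm _ h1 x₀)
  convert this using 1
  simp only [g]
  abel

theorem algebraMap_mem_span_of_associated {ϖ : O} {y : H} (hy : Associated (rn y : O) ϖ) :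
    algebraMap O H ϖ ∈ Ideal.span {y} := by
  obtain ⟨u, hu⟩ := hy
  rw [Ideal.mem_span_singleton', ← hu]
  refine ⟨(u : O) • conj O y, ?_⟩
  rw [smul_mul_assoc, conj_mul_self, Algebra.smul_def, ← map_mul, mul_comm]

theorem extend_le_span_of_associated {ϖ : O} {y : H} (hy : Associated (rn y : O) ϖ) :
    extend H (Ideal.span {ϖ}) ≤ Ideal.span {y} := by
  intro x hx
  obtain ⟨v, rfl⟩ := extend_span_singleton.mp hx
  rw [Algebra.smul_def, Algebra.commutes]
  exact Ideal.mul_mem_left _ _ (algebraMap_mem_span_of_associated hy)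

theorem dvd_rn_of_mem_span {ϖ : O} {y : H} (hy : Associated (rn y : O) ϖ) {x : H}
    (hx : x ∈ Ideal.span {y}) : ϖ ∣ (rn x : O) := by
  obtain ⟨c, rfl⟩ := Ideal.mem_span_singleton'.mp hx
  rw [rn_mul]; exact hy.dvd'.mul_left _

/-- `H` acts faithfully modulo `ϖ` on `H / H y`. -/
theorem mem_extend_of_mul_mem_span (B : Module.Basis (Fin 4) O H) {ϖ : O} (hϖ : Prime ϖ)
    [Finite (O ⧸ Ideal.span {ϖ})] {x₀ y₀ z₀ : H} (h₀ : ¬ ϖ ∣ discForm O x₀ y₀ z₀) {y : H}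
    (hy : Associated (rn y : O) ϖ) {x : H} (hx : ∀ h, x * h ∈ Ideal.span {y}) :
    x ∈ extend H (Ideal.span {ϖ}) := by
  have hscalar : ∀ r : O, algebraMap O H r ∈ Ideal.span {y} → ϖ ∣ r := by
    intro r hr
    have h := dvd_rn_of_mem_span hy hr
    rw [rn_algebraMap] at h
    exact hϖ.dvd_of_dvd_pow h
  -- The form at (a, b, x) is the trace of w = (bx - xb)ā. As xH ⊆ Hy, both w and w̄ = -a(bx - xb)
  -- lie in Hy, and a scalar in Hy is divisible by ϖ.
  obtain ⟨r, hr⟩ := exists_scalar_of_discForm B hϖ h₀ (x := x) fun a b => by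
    rw [discForm_rotate, discForm]
    apply hscalar
    rw [← add_conj, HasReducedNorm.conj_mul, conj_conj, conj_sub,
      HasReducedNorm.conj_mul, HasReducedNorm.conj_mul]
    have hcomm : conj O x * conj O b - conj O b * conj O x = -(b * x - x * b) := by
      rw [conj_eq (O := O) x, conj_eq (O := O) b, sub_mul, sub_mul, mul_sub, mul_sub, mul_sub,
        mul_sub, Algebra.commutes (rtr x : O) b, Algebra.commutes (rtr b : O) x,
        Algebra.commutes (rtr b : O) (algebraMap O H (rtr x))]
      abel
    rw [hcomm]
    refine add_mem ?_ (Ideal.mul_mem_left _ _ (neg_mem ?_))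
    · rw [sub_mul, mul_assoc, mul_assoc]
      exact sub_mem (Ideal.mul_mem_left _ _ (hx _)) (hx _)
    · have h1 := hx 1
      rw [mul_one] at h1
      exact sub_mem (Ideal.mul_mem_left _ _ h1) (hx _)
  have hrJ : algebraMap O H r ∈ Ideal.span {y} := by
    have h1 := hx 1
    rw [mul_one] at h1
    have := sub_mem h1 (extend_le_span_of_associated hy hr)
    rwa [sub_sub_cancel] at this
  have := add_mem hr (algebraMap_mem_extend (H := H)
    (Ideal.mem_span_singleton.mpr (hscalar r hrJ)))
  rwa [sub_add_cancel] at this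

/-- Right multiplication by y maps H onto Hy and pulls ϖH back to Hȳ, so [Hy : ϖH] = [H : Hȳ]. -/
theorem natCard_mul_natCard_eq {ϖ : O} (hϖ : ϖ ≠ 0) {y : H} (hy : Associated (rn y : O) ϖ) :
    Nat.card (H ⧸ Ideal.span {conj O y}) * Nat.card (H ⧸ Ideal.span {y}) =
      Nat.card (H ⧸ extend H (Ideal.span {ϖ})) ∧
    (extend H (Ideal.span {ϖ})).toAddSubgroup.relIndex (Ideal.span {y}).toAddSubgroup =
      Nat.card (H ⧸ Ideal.span {conj O y}) := by
  set E := extend H (Ideal.span {ϖ}) with hE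
  have hy0 : (rn y : O) ≠ 0 := fun h => hϖ (by
    rw [h] at hy; exact (associated_zero_iff_eq_zero _).mp hy.symm)
  have hrange : (Ideal.span {y}).toAddSubgroup = (⊤ : AddSubgroup H).map (AddMonoidHom.mulRight y) := by
    ext x
    rw [Submodule.mem_toAddSubgroup, Ideal.mem_span_singleton', AddSubgroup.mem_map]
    simp
  have hcomap : E.toAddSubgroup.comap (AddMonoidHom.mulRight y) =
      (Ideal.span {conj O y}).toAddSubgroup := by
    ext x
    rw [AddSubgroup.mem_comap, Submodule.mem_toAddSubgroup, Submodule.mem_toAddSubgroup,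
      Ideal.mem_span_singleton', hE, AddMonoidHom.mulRight_apply, extend_span_singleton]
    obtain ⟨u, hu⟩ := hy
    constructor
    · rintro ⟨v, hv⟩
      refine ⟨(u : O) • v, smul_right_injective H hy0 ?_⟩
      simp only
      rw [← smul_mul_assoc, smul_smul, hu, ← hv, mul_assoc, mul_conj, ← Algebra.commutes,
        Algebra.smul_def]
    · rintro ⟨c, rfl⟩
      refine ⟨(↑u⁻¹ : O) • c, ?_⟩
      rw [mul_assoc, conj_mul_self, ← Algebra.commutes, ← Algebra.smul_def, smul_smul, ← hu,
        mul_assoc, Units.mul_inv, mul_one]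
  have hrel : E.toAddSubgroup.relIndex (Ideal.span {y}).toAddSubgroup =
      Nat.card (H ⧸ Ideal.span {conj O y}) := by
    rw [hrange, ← AddSubgroup.relIndex_comap, hcomap, AddSubgroup.relIndex_top_right]
    rfl
  refine ⟨?_, hrel⟩
  rw [← hrel]
  exact AddSubgroup.relIndex_mul_index (extend_le_span_of_associated hy)

/-- The action of `H` on `H / H y` embeds `H / ϖ H` in a matrix ring over `O / ϖ`. -/
theorem exists_ringHom_matrix (B : Module.Basis (Fin 4) O H) {ϖ : O} (hϖ : Prime ϖ)
    [Finite (O ⧸ Ideal.span {ϖ})] {x₀ y₀ z₀ : H} (h₀ : ¬ ϖ ∣ discForm O x₀ y₀ z₀) {y : H}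
    (hy : Associated (rn y : O) ϖ) :
    ∃ (d : ℕ) (ρ : H →+* Matrix (Fin d) (Fin d) (O ⧸ Ideal.span {ϖ})),
      Nat.card (H ⧸ Ideal.span {y}) = Nat.card (O ⧸ Ideal.span {ϖ}) ^ d ∧
      ∀ x, ρ x = 0 ↔ x ∈ extend H (Ideal.span {ϖ}) := by
  have hmax : (Ideal.span {ϖ}).IsMaximal :=
    PrincipalIdealRing.isMaximal_of_irreducible hϖ.irreducible
  let _ : Field (O ⧸ Ideal.span {ϖ}) := Ideal.Quotient.field _
  have htors : Module.IsTorsionBySet O (H ⧸ Ideal.span {y}) (Ideal.span {ϖ} : Ideal O) := by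
    rintro v ⟨r, hr⟩
    obtain ⟨x, rfl⟩ := Submodule.Quotient.mk_surjective _ v
    change r • Submodule.Quotient.mk x = _
    rw [← Submodule.Quotient.mk_smul, Submodule.Quotient.mk_eq_zero]
    exact extend_le_span_of_associated hy (smul_mem_extend hr x)
  let _ : Module (O ⧸ Ideal.span {ϖ}) (H ⧸ Ideal.span {y}) := htors.module
  have hsm : ∀ (r : O) (v : H ⧸ Ideal.span {y}),
      (Ideal.Quotient.mk (Ideal.span {ϖ}) r) • v = r • v := fun r v => rfl
  have : SMulCommClass H (O ⧸ Ideal.span {ϖ}) (H ⧸ Ideal.span {y}) := ⟨by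
    intro h c v
    obtain ⟨r, rfl⟩ := Ideal.Quotient.mk_surjective c
    rw [hsm, hsm, smul_comm]⟩
  have hfinE := finite_quotient_of_basis B ϖ
  have : Finite (H ⧸ Ideal.span {y}) :=
    Finite.of_surjective _ (Submodule.factor_surjective (extend_le_span_of_associated hy))
  have : Module.Finite (O ⧸ Ideal.span {ϖ}) (H ⧸ Ideal.span {y}) := Module.Finite.of_finite
  let b := Module.finBasis (O ⧸ Ideal.span {ϖ}) (H ⧸ Ideal.span {y})
  refine ⟨_, (LinearMap.toMatrixAlgEquiv b).toRingEquiv.toRingHom.comp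
    (Module.toModuleEnd (O ⧸ Ideal.span {ϖ}) (H ⧸ Ideal.span {y})),
    Module.natCard_eq_pow_finrank, fun x => ?_⟩
  have h1 : ((LinearMap.toMatrixAlgEquiv b).toRingEquiv.toRingHom.comp
      (Module.toModuleEnd (O ⧸ Ideal.span {ϖ}) (H ⧸ Ideal.span {y}))) x = 0 ↔
      Module.toModuleEnd (O ⧸ Ideal.span {ϖ}) (H ⧸ Ideal.span {y}) x = 0 :=
    map_eq_zero_iff (LinearMap.toMatrixAlgEquiv b) (LinearMap.toMatrixAlgEquiv b).injective
  rw [h1, LinearMap.ext_iff]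
  constructor
  · intro hx
    refine mem_extend_of_mul_mem_span B hϖ h₀ hy fun h => ?_
    have h2 := hx (Submodule.Quotient.mk h : H ⧸ Ideal.span {y})
    change x • (Submodule.Quotient.mk h : H ⧸ Ideal.span {y}) = 0 at h2
    rwa [← Submodule.Quotient.mk_smul, Submodule.Quotient.mk_eq_zero] at h2
  · intro hx v
    obtain ⟨h, rfl⟩ := Submodule.Quotient.mk_surjective _ v
    change x • (Submodule.Quotient.mk h : H ⧸ Ideal.span {y}) = 0
    rw [← Submodule.Quotient.mk_smul, Submodule.Quotient.mk_eq_zero]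
    exact extend_le_span_of_associated hy ((extend H _).mul_mem_right h hx)

end Local

end QuatOrder

/-! ### Singular matrices and the N + 1 left ideals of norm ϖ. -/

namespace QuatOrder

open HasReducedNorm

section MatrixCount

/-- The number of non-zero singular `2 × 2` matrices over a finite field. -/
theorem ncard_singular (F : Type*) [Field F] [Finite F] :
    {m : Matrix (Fin 2) (Fin 2) F | m ≠ 0 ∧ ¬ IsUnit m}.ncard =
      (Nat.card F ^ 2 - 1) * (Nat.card F + 1) := by
  classical
  have := Fintype.ofFinite F
  set M := Matrix (Fin 2) (Fin 2) F
  have hM : Nat.card M = Nat.card F ^ 4 := by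
    change Nat.card (Fin 2 → Fin 2 → F) = _
    rw [Nat.card_fun, Nat.card_fun, Nat.card_eq_fintype_card (α := Fin 2), Fintype.card_fin]
    ring
  have hU : {m : M | IsUnit m}.ncard = (Nat.card F ^ 2 - 1) * (Nat.card F ^ 2 - Nat.card F) := by
    have h := Matrix.card_GL_field (𝔽 := F) 2
    rw [Fin.prod_univ_two] at h
    simp only [Fin.val_zero, Fin.val_one, pow_zero, pow_one, ← Nat.card_eq_fintype_card] at h
    rw [← h]
    have : {m : M | IsUnit m} = (fun u : Mˣ => (u : M)) '' Set.univ := by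
      ext m; simp [IsUnit]
    rw [this, Set.ncard_image_of_injective _ Units.val_injective, Set.ncard_univ]
  have hcompl : {m : M | IsUnit m}.ncard + {m : M | IsUnit m}ᶜ.ncard = Nat.card M :=
    Set.ncard_add_ncard_compl _
  have hA : {m : M | m ≠ 0 ∧ ¬ IsUnit m} = {m : M | IsUnit m}ᶜ \ {0} := by
    ext m; simp [and_comm]
  have h0 : (0 : M) ∈ {m : M | IsUnit m}ᶜ := by simp
  rw [hA, Set.ncard_sdiff_singleton_of_mem h0]
  have hq : 1 < Nat.card F := Finite.one_lt_card
  obtain ⟨n, hn⟩ : ∃ n, Nat.card F = n + 1 := ⟨Nat.card F - 1, by omega⟩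
  rw [hU, hM, hn] at hcompl
  rw [hn]
  have h1 : (n + 1) ^ 2 - 1 = n ^ 2 + 2 * n := by
    rw [show (n + 1) ^ 2 = n ^ 2 + 2 * n + 1 by ring, Nat.add_sub_cancel]
  have h2 : (n + 1) ^ 2 - (n + 1) = n ^ 2 + n := by
    rw [show (n + 1) ^ 2 = n ^ 2 + n + (n + 1) by ring, Nat.add_sub_cancel]
  rw [h1, h2] at hcompl
  rw [h1]
  have h3 : {m : M | IsUnit m}ᶜ.ncard = (n ^ 2 + 2 * n) * (n + 1 + 1) + 1 := by
    have : (n + 1) ^ 4 = (n ^ 2 + 2 * n) * (n ^ 2 + n) + ((n ^ 2 + 2 * n) * (n + 1 + 1) + 1) := by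
      ring
    omega
  rw [h3, Nat.add_sub_cancel]

theorem ncard_singular_of_isField {F : Type*} [CommRing F] [Finite F] (hF : IsField F) :
    {m : Matrix (Fin 2) (Fin 2) F | m ≠ 0 ∧ ¬ IsUnit m}.ncard =
      (Nat.card F ^ 2 - 1) * (Nat.card F + 1) :=
  let _ := hF.toField
  ncard_singular F

end MatrixCount

section Local

variable {O H : Type*} [CommRing O] [Ring H] [Algebra O H] [HasReducedNorm O H]

/-- The principal left ideals of norm `ϖ`. -/
def idealsOfNorm (H : Type*) [Ring H] [Algebra O H] [HasReducedNorm O H] (ϖ : O) : Set (Ideal H) :=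
  {J | ∃ y, Associated (rn y : O) ϖ ∧ J = Ideal.span {y}}

theorem isUnit_of_isUnit_rn {h : H} (hu : IsUnit (rn h : O)) : ∃ h', h' * h = 1 := by
  obtain ⟨u, hu⟩ := hu
  refine ⟨(↑u⁻¹ : O) • conj O h, ?_⟩
  rw [smul_mul_assoc, conj_mul_self, ← hu, Algebra.smul_def, ← map_mul, Units.inv_mul, map_one]

variable [IsDomain O]

theorem span_eq_of_le {ϖ : O} (hϖ : ϖ ≠ 0) {y y' : H} (hy : Associated (rn y : O) ϖ)
    (hy' : Associated (rn y' : O) ϖ) (hle : Ideal.span {y'} ≤ Ideal.span {y}) :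
    Ideal.span {y'} = Ideal.span {y} := by
  refine le_antisymm hle ?_
  rw [Ideal.span_singleton_le_iff_mem]
  obtain ⟨h, rfl⟩ := Ideal.mem_span_singleton'.mp (hle (Ideal.mem_span_singleton_self y'))
  have h0 : (rn y : O) ≠ 0 := fun h => hϖ (by
    rw [h] at hy; exact (associated_zero_iff_eq_zero _).mp hy.symm)
  rw [rn_mul] at hy'
  obtain ⟨u, hu⟩ := hy'.trans hy.symm
  have h1 : (rn h : O) * u = 1 := by
    apply mul_left_cancel₀ h0
    rw [mul_one]; linear_combination hu
  obtain ⟨h', hh'⟩ := isUnit_of_isUnit_rn (IsUnit.of_mul_eq_one _ h1)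
  exact Ideal.mem_span_singleton'.mpr ⟨h', by rw [← mul_assoc, hh', one_mul]⟩

variable [IsPrincipalIdealRing O] [Module.IsTorsionFree O H]

/-- An element outside ϖH lies in at most one left ideal of norm ϖ: the one it generates together
with ϖH has norm ϖ already, and inclusions between such ideals are equalities. -/
theorem sup_eq_of_mem (hP : PrincipalAtPrimes O H) {ϖ : O} (hϖ : Prime ϖ) {J : Ideal H}
    (hJ : J ∈ idealsOfNorm H ϖ) {x : H} (hx : x ∉ extend H (Ideal.span {ϖ})) (hxJ : x ∈ J) :
    Ideal.span {x} ⊔ extend H (Ideal.span {ϖ}) = J := by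
  obtain ⟨y, hy, rfl⟩ := hJ
  obtain ⟨y', hsup, hy'⟩ := exists_sup_eq_span hP hϖ
    (fun v hv => hx (extend_span_singleton.mpr ⟨v, hv⟩)) (dvd_rn_of_mem_span hy hxJ)
  rw [hsup]
  refine span_eq_of_le hϖ.ne_zero hy hy' ?_
  rw [← hsup]
  exact sup_le (by rwa [Ideal.span_singleton_le_iff_mem]) (extend_le_span_of_associated hy)

theorem sup_mem_idealsOfNorm (hP : PrincipalAtPrimes O H) {ϖ : O} (hϖ : Prime ϖ) {x : H}
    (hx : x ∉ extend H (Ideal.span {ϖ})) (hrx : ϖ ∣ (rn x : O)) :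
    Ideal.span {x} ⊔ extend H (Ideal.span {ϖ}) ∈ idealsOfNorm H ϖ := by
  obtain ⟨y', hsup, hy'⟩ := exists_sup_eq_span hP hϖ
    (fun v hv => hx (extend_span_singleton.mpr ⟨v, hv⟩)) hrx
  exact ⟨y', hy', hsup⟩

section Unramified

variable (B : Module.Basis (Fin 4) O H) {ϖ : O} (hϖ : Prime ϖ) [Finite (O ⧸ Ideal.span {ϖ})]
  {x₀ y₀ z₀ : H} (h₀ : ¬ ϖ ∣ discForm O x₀ y₀ z₀)
include B hϖ h₀

/-- H/ϖH embeds in the d × d matrices, so N⁴ ≤ N^(d²). -/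
theorem two_le_of_unramified {y : H} (hy : Associated (rn y : O) ϖ) :
    ∃ (d : ℕ) (ρ : H →+* Matrix (Fin d) (Fin d) (O ⧸ Ideal.span {ϖ})), 2 ≤ d ∧
      Nat.card (H ⧸ Ideal.span {y}) = Nat.card (O ⧸ Ideal.span {ϖ}) ^ d ∧
      ∀ x, ρ x = 0 ↔ x ∈ extend H (Ideal.span {ϖ}) := by
  obtain ⟨d, ρ, hd, hρ⟩ := exists_ringHom_matrix B hϖ h₀ hy
  refine ⟨d, ρ, ?_, hd, hρ⟩
  have hinj : Function.Injective
      (Ideal.Quotient.lift (extend H (Ideal.span {ϖ})) ρ fun x hx => (hρ x).mpr hx) := by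
    rw [injective_iff_map_eq_zero]
    intro c hc
    obtain ⟨x, rfl⟩ := Ideal.Quotient.mk_surjective c
    rw [Ideal.Quotient.lift_mk, hρ] at hc
    exact Ideal.Quotient.eq_zero_iff_mem.mpr hc
  have : Finite (Matrix (Fin d) (Fin d) (O ⧸ Ideal.span {ϖ})) :=
    inferInstanceAs (Finite (Fin d → Fin d → _))
  have hle := Nat.card_le_card_of_injective _ hinj
  have hM : Nat.card (Matrix (Fin d) (Fin d) (O ⧸ Ideal.span {ϖ})) =
      Nat.card (O ⧸ Ideal.span {ϖ}) ^ (d * d) := by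
    change Nat.card (Fin d → Fin d → _) = _
    rw [Nat.card_fun, Nat.card_fun, Nat.card_eq_fintype_card (α := Fin d), Fintype.card_fin,
      ← pow_mul]
  rw [natCard_quotient_extend B, hM, Fintype.card_fin] at hle
  have h4 := (Nat.pow_le_pow_iff_right (one_lt_natCard_quotient hϖ)).mp hle
  nlinarith

/-- The dimensions d, d' of H/Hy and H/Hȳ are at least 2 and add up to 4, so d = 2; the embedding
into 2 × 2 matrices is onto by cardinality. -/
theorem exists_surjective_matrix {y : H} (hy : Associated (rn y : O) ϖ) :
    Nat.card (H ⧸ Ideal.span {y}) = Nat.card (O ⧸ Ideal.span {ϖ}) ^ 2 ∧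
    ∃ ρ : H →+* Matrix (Fin 2) (Fin 2) (O ⧸ Ideal.span {ϖ}), Function.Surjective ρ ∧
      ∀ x, ρ x = 0 ↔ x ∈ extend H (Ideal.span {ϖ}) := by
  obtain ⟨d, ρ, hd, hcd, hρ⟩ := two_le_of_unramified B hϖ h₀ hy
  obtain ⟨d', -, hd', hcd', -⟩ := two_le_of_unramified B hϖ h₀ (y := conj O y) (by rwa [rn_conj])
  have h1 := (natCard_mul_natCard_eq hϖ.ne_zero hy).1
  rw [hcd, hcd', natCard_quotient_extend B, ← pow_add, Fintype.card_fin] at h1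
  have h2 := Nat.pow_right_injective (one_lt_natCard_quotient hϖ) h1
  obtain rfl : d = 2 := by omega
  refine ⟨hcd, ρ, ?_, hρ⟩
  have : Finite (Matrix (Fin 2) (Fin 2) (O ⧸ Ideal.span {ϖ})) :=
    inferInstanceAs (Finite (Fin 2 → Fin 2 → _))
  have hinj : Function.Injective
      (Ideal.Quotient.lift (extend H (Ideal.span {ϖ})) ρ fun x hx => (hρ x).mpr hx) := by
    rw [injective_iff_map_eq_zero]
    intro c hc
    obtain ⟨x, rfl⟩ := Ideal.Quotient.mk_surjective c
    rw [Ideal.Quotient.lift_mk, hρ] at hc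
    exact Ideal.Quotient.eq_zero_iff_mem.mpr hc
  have hM : Nat.card (H ⧸ extend H (Ideal.span {ϖ})) =
      Nat.card (Matrix (Fin 2) (Fin 2) (O ⧸ Ideal.span {ϖ})) := by
    change _ = Nat.card (Fin 2 → Fin 2 → _)
    rw [natCard_quotient_extend B, Nat.card_fun, Nat.card_fun,
      Nat.card_eq_fintype_card (α := Fin 2), Fintype.card_fin, Fintype.card_fin, ← pow_mul]
  intro m
  obtain ⟨c, hc⟩ := ((Nat.bijective_iff_injective_and_card _).mpr ⟨hinj, hM⟩).2 m
  obtain ⟨x, rfl⟩ := Ideal.Quotient.mk_surjective c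
  exact ⟨x, hc⟩

omit B h₀ in
theorem isUnit_map_iff {M : Type*} [Ring M] {ρ : H →+* M} (hsurj : Function.Surjective ρ)
    (hρ : ∀ x, ρ x = 0 ↔ x ∈ extend H (Ideal.span {ϖ})) (x : H) :
    IsUnit (ρ x) ↔ ¬ ϖ ∣ (rn x : O) := by
  constructor
  · rintro ⟨u, hu⟩ hd
    obtain ⟨x', hx'⟩ := hsurj (↑u⁻¹)
    have h1 : x * x' - 1 ∈ extend H (Ideal.span {ϖ}) := by
      rw [← hρ, map_sub, map_mul, hx', ← hu, Units.mul_inv, map_one, sub_self]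
    have h2 : (rn (x * x') : O) = rn (x * x' - 1) + 1 + rtr (x * x' - 1) := by
      have := rn_add (O := O) (x * x' - 1) 1
      rwa [sub_add_cancel, rn_one, conj_one, mul_one] at this
    have h3 := Ideal.mem_span_singleton.mp (rn_mem h1)
    have h4 := Ideal.mem_span_singleton.mp (rtr_mul_mem h1 1)
    rw [mul_one] at h4
    rw [rn_mul] at h2
    apply hϖ.not_dvd_one
    have h5 : (1 : O) = rn x * rn x' - rn (x * x' - 1) - rtr (x * x' - 1) := by
      rw [h2]; ring
    rw [h5]
    exact dvd_sub (dvd_sub (hd.mul_right _) h3) h4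
  · intro hd
    obtain ⟨s, c, hs⟩ := (Irreducible.coprime_iff_not_dvd hϖ.irreducible).mpr hd
    have h1 : ρ (algebraMap O H (c * rn x)) = 1 := by
      rw [← map_one ρ, ← sub_eq_zero, ← map_sub, hρ, ← map_one (algebraMap O H), ← map_sub]
      refine algebraMap_mem_extend (Ideal.mem_span_singleton.mpr ⟨-s, ?_⟩)
      linear_combination hs
    refine ⟨⟨ρ x, ρ (c • conj O x), ?_, ?_⟩, rfl⟩
    · rw [← map_mul, mul_smul_comm, mul_conj, Algebra.smul_def, ← map_mul, h1]
    · rw [← map_mul, smul_mul_assoc, conj_mul_self, Algebra.smul_def, ← map_mul, h1]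

/-- Each non-zero singular matrix generates one ideal of norm ϖ, and each such ideal contains N² - 1
of them modulo ϖH. There are (N² - 1)(N + 1) matrices to distribute. -/
theorem ncard_idealsOfNorm (hP : PrincipalAtPrimes O H) :
    (idealsOfNorm H ϖ).Finite ∧
      (idealsOfNorm H ϖ).ncard = Nat.card (O ⧸ Ideal.span {ϖ}) + 1 := by
  classical
  have hmax : (Ideal.span {ϖ}).IsMaximal :=
    PrincipalIdealRing.isMaximal_of_irreducible hϖ.irreducible
  have hN := one_lt_natCard_quotient (O := O) hϖ
  obtain ⟨y, hy⟩ := exists_associated_rn hP B hϖ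
  obtain ⟨-, ρ, hsurj, hρ⟩ := exists_surjective_matrix B hϖ h₀ hy
  set F := O ⧸ Ideal.span {ϖ}
  set E := extend H (Ideal.span {ϖ}) with hE
  have : Finite (Matrix (Fin 2) (Fin 2) F) := inferInstanceAs (Finite (Fin 2 → Fin 2 → _))
  set A := {m : Matrix (Fin 2) (Fin 2) F | m ≠ 0 ∧ ¬ IsUnit m} with hA
  have hAfin : A.Finite := Set.toFinite _
  have hAcard : A.ncard = (Nat.card F ^ 2 - 1) * (Nat.card F + 1) :=
    ncard_singular_of_isField ((Ideal.Quotient.maximal_ideal_iff_isField_quotient _).mp hmax)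
  choose out hout using hsurj
  let g : Matrix (Fin 2) (Fin 2) F → Ideal H := fun m => Ideal.span {out m} ⊔ E
  have houtE : ∀ m ∈ A, out m ∉ E ∧ ϖ ∣ (rn (out m) : O) := by
    intro m hm
    constructor
    · rw [hE, ← hρ, hout]; exact hm.1
    · by_contra hd
      rw [← isUnit_map_iff hϖ (fun m => ⟨out m, hout m⟩) hρ, hout] at hd
      exact hm.2 hd
  have hgY : ∀ m ∈ A, g m ∈ idealsOfNorm H ϖ := fun m hm =>
    sup_mem_idealsOfNorm hP hϖ (houtE m hm).1 (houtE m hm).2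
  have hEJ : ∀ J ∈ idealsOfNorm H ϖ, E ≤ J := by
    rintro _ ⟨y, hy, rfl⟩
    exact extend_le_span_of_associated hy
  have hfiber : ∀ J ∈ idealsOfNorm H ϖ, {m ∈ A | g m = J} = ρ '' J \ {0} := by
    intro J hJ
    ext m
    constructor
    · rintro ⟨hm, rfl⟩
      exact ⟨⟨out m, Ideal.mem_sup_left (Ideal.mem_span_singleton_self _), hout m⟩, hm.1⟩
    · rintro ⟨⟨x, hx, rfl⟩, hx0⟩
      have hxE : x ∉ E := fun h => hx0 ((hρ x).mpr h)
      have hrx : ϖ ∣ (rn x : O) := by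
        obtain ⟨y, hy, rfl⟩ := hJ
        exact dvd_rn_of_mem_span hy hx
      have hmA : ρ x ∈ A := by
        refine ⟨hx0, ?_⟩
        rw [isUnit_map_iff hϖ (fun m => ⟨out m, hout m⟩) hρ, not_not]
        exact hrx
      refine ⟨hmA, sup_eq_of_mem hP hϖ hJ (houtE _ hmA).1 ?_⟩
      have h1 : out (ρ x) - x ∈ E := by rw [hE, ← hρ, map_sub, hout, sub_self]
      have := add_mem (hEJ J hJ h1) hx
      rwa [sub_add_cancel] at this
  -- The image of J = Hy has [Hy : ϖH] = [H : Hȳ] = N² elements, one of them zero.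
  have hfibcard : ∀ J ∈ idealsOfNorm H ϖ, {m ∈ A | g m = J}.ncard = Nat.card F ^ 2 - 1 := by
    intro J hJ
    rw [hfiber J hJ, Set.ncard_sdiff_singleton_of_mem
      (show (0 : Matrix (Fin 2) (Fin 2) F) ∈ ρ '' (J : Set H) from ⟨0, zero_mem _, map_zero ρ⟩)]
    congr 1
    obtain ⟨y, hy, rfl⟩ := hJ
    rw [← (exists_surjective_matrix B hϖ h₀ (y := conj O y) (by rwa [rn_conj])).1,
      ← (natCard_mul_natCard_eq hϖ.ne_zero hy).2]
    let f : (Ideal.span {y}).toAddSubgroup →+ Matrix (Fin 2) (Fin 2) F :=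
      ρ.toAddMonoidHom.comp (Ideal.span {y}).toAddSubgroup.subtype
    have hker : f.ker = E.toAddSubgroup.addSubgroupOf (Ideal.span {y}).toAddSubgroup := by
      ext x
      exact hρ x
    rw [AddSubgroup.relIndex, ← hE, ← hker, AddSubgroup.index_ker, ← Nat.card_coe_set_eq]
    congr 1
    have : (ρ '' (Ideal.span {y} : Ideal H) : Set _) = (f.range : Set _) := by
      ext m
      constructor
      · rintro ⟨x, hx, rfl⟩
        exact ⟨⟨x, hx⟩, rfl⟩
      · rintro ⟨⟨x, hx⟩, rfl⟩
        exact ⟨x, hx, rfl⟩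
    rw [this]
    rfl
  have hpos : 0 < Nat.card F ^ 2 - 1 := by
    have : 1 < Nat.card F ^ 2 := Nat.one_lt_pow two_ne_zero hN
    omega
  have hYimg : idealsOfNorm H ϖ = g '' A := by
    ext J
    constructor
    · intro hJ
      have h1 := hfibcard J hJ
      obtain ⟨m, hm⟩ := Set.nonempty_of_ncard_ne_zero (by rw [h1]; exact hpos.ne')
      exact ⟨m, hm.1, hm.2⟩
    · rintro ⟨m, hm, rfl⟩
      exact hgY m hm
  have hYfin : (idealsOfNorm H ϖ).Finite := by rw [hYimg]; exact hAfin.image g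
  refine ⟨hYfin, ?_⟩
  have hsum : A.ncard = (idealsOfNorm H ϖ).ncard * (Nat.card F ^ 2 - 1) := by
    rw [Set.ncard_eq_toFinset_card _ hAfin, Set.ncard_eq_toFinset_card _ hYfin]
    rw [Finset.card_eq_sum_card_fiberwise (f := g) (t := hYfin.toFinset) (by
      intro m hm
      rw [Finset.mem_coe, Set.Finite.mem_toFinset] at hm ⊢
      exact hgY m hm)]
    rw [Finset.sum_const_nat]
    intro J hJ
    rw [Set.Finite.mem_toFinset] at hJ
    rw [← hfibcard J hJ, ← Set.ncard_coe_finset]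
    congr 1
    ext m
    simp
  rw [hAcard, mul_comm] at hsum
  exact (Nat.eq_of_mul_eq_mul_right hpos hsum).symm

end Unramified

end Local

end QuatOrder

/-! ### Recursions for the number of elements of given norm. -/

namespace QuatOrder

open HasReducedNorm

section Counting

variable {O : Type*} (H : Type*) [CommRing O] [Ring H] [Algebra O H] [HasReducedNorm O H]

/-- The elements of norm `α`. -/
def elementsOfNorm (α : O) : Set H := {x | rn x = α}

variable {H}

variable [IsDomain O] [Module.IsTorsionFree O H]

theorem mul_right_injective_of_rn {y : H} (hy : (rn y : O) ≠ 0) :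
    Function.Injective fun z : H => z * y := by
  intro z z' h
  apply smul_right_injective H hy
  simp only at h ⊢
  rw [Algebra.smul_def, Algebra.smul_def, Algebra.commutes, Algebra.commutes, ← mul_conj (O := O) y,
    ← mul_assoc, h, mul_assoc]

theorem ncard_mem_span {ϖ : O} (hϖ : ϖ ≠ 0) {y : H} (hy : (rn y : O) = ϖ) (α : O) :
    (elementsOfNorm H (ϖ * α) ∩ (Ideal.span {y} : Ideal H)).ncard =
      (elementsOfNorm H α).ncard := by
  have h : elementsOfNorm H (ϖ * α) ∩ (Ideal.span {y} : Ideal H) =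
      (fun z : H => z * y) '' elementsOfNorm H α := by
    ext x
    constructor
    · rintro ⟨hx, hxy⟩
      obtain ⟨z, rfl⟩ := Ideal.mem_span_singleton'.mp hxy
      refine ⟨z, ?_, rfl⟩
      change rn (z * y) = ϖ * α at hx
      rw [rn_mul, hy, mul_comm] at hx
      exact mul_left_cancel₀ hϖ hx
    · rintro ⟨z, hz, rfl⟩
      change rn z = α at hz
      refine ⟨?_, Ideal.mul_mem_left _ _ (Ideal.mem_span_singleton_self y)⟩
      change rn (z * y) = ϖ * α
      rw [rn_mul, hz, hy, mul_comm]
  rw [h, Set.ncard_image_of_injective _ (mul_right_injective_of_rn (hy ▸ hϖ))]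

theorem ncard_mem_extend {ϖ : O} (hϖ : ϖ ≠ 0) (α : O) :
    (elementsOfNorm H (ϖ * (ϖ * α)) ∩ (extend H (Ideal.span {ϖ}) : Ideal H)).ncard =
      (elementsOfNorm H α).ncard := by
  have h : elementsOfNorm H (ϖ * (ϖ * α)) ∩ (extend H (Ideal.span {ϖ}) : Ideal H) =
      (fun z : H => ϖ • z) '' elementsOfNorm H α := by
    ext x
    constructor
    · rintro ⟨hx, hxy⟩
      obtain ⟨z, rfl⟩ := extend_span_singleton.mp hxy
      refine ⟨z, ?_, rfl⟩
      change rn (ϖ • z) = _ at hx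
      rw [rn_smul, sq, mul_assoc] at hx
      exact mul_left_cancel₀ hϖ (mul_left_cancel₀ hϖ hx)
    · rintro ⟨z, hz, rfl⟩
      change rn z = α at hz
      refine ⟨?_, smul_mem_extend (Ideal.mem_span_singleton_self ϖ) z⟩
      change rn (ϖ • z) = _
      rw [rn_smul, hz, sq, mul_assoc]
  rw [h, Set.ncard_image_of_injective _ (smul_right_injective H hϖ)]

theorem elementsOfNorm_inter_extend {ϖ : O} (hϖ : ϖ ≠ 0) {α : O} (hα : ¬ ϖ ∣ α) :
    elementsOfNorm H (ϖ * α) ∩ (extend H (Ideal.span {ϖ}) : Ideal H) = ∅ := by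
  ext x
  refine ⟨?_, fun h => h.elim⟩
  rintro ⟨hx, hxy⟩
  obtain ⟨z, rfl⟩ := extend_span_singleton.mp hxy
  change rn (ϖ • z) = _ at hx
  rw [rn_smul, sq, mul_assoc] at hx
  exact hα ⟨_, (mul_left_cancel₀ hϖ hx).symm⟩

theorem ncard_mul_unit_sq (u : Oˣ) (α : O) :
    (elementsOfNorm H ((u : O) ^ 2 * α)).ncard = (elementsOfNorm H α).ncard := by
  have h : elementsOfNorm H ((u : O) ^ 2 * α) = (fun z : H => (u : O) • z) '' elementsOfNorm H α := by
    ext x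
    constructor
    · intro hx
      change rn x = _ at hx
      refine ⟨(↑u⁻¹ : O) • x, ?_, ?_⟩
      · change rn _ = _
        rw [rn_smul, hx, ← mul_assoc, ← mul_pow, Units.inv_mul, one_pow, one_mul]
      · simp only
        rw [smul_smul, Units.mul_inv, one_smul]
    · rintro ⟨z, hz, rfl⟩
      change rn z = α at hz
      change rn _ = _
      rw [rn_smul, hz]
  rw [h, Set.ncard_image_of_injective _ (smul_right_injective H u.ne_zero)]

variable [IsPrincipalIdealRing O]

/-- All elements of norm ϖα lie in the single ideal Hy, and z ↦ zy matches them with the elements of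
norm α. -/
theorem ncard_mul_of_ramified (hsat : NormSaturated O H) (B : Module.Basis (Fin 4) O H) {ϖ : O}
    (hϖ : Prime ϖ) [Finite (O ⧸ Ideal.span {ϖ})] (hram : ∀ x y z : H, ϖ ∣ discForm O x y z)
    {y : H} (hy : (rn y : O) = ϖ) (α : O) :
    (elementsOfNorm H (ϖ * α)).ncard = (elementsOfNorm H α).ncard := by
  rw [← ncard_mem_span hϖ.ne_zero hy α]
  congr 1
  refine (Set.inter_eq_left.mpr fun x hx => ?_).symm
  change rn x = _ at hx
  rw [SetLike.mem_coe, mem_span_iff_of_ramified hram hsat B hϖ (hy ▸ Associated.refl _), hx]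
  exact dvd_mul_right _ _

/-- The Hecke recursion at an unramified prime. -/
theorem ncard_mul_of_unramified (hP : PrincipalAtPrimes O H) (B : Module.Basis (Fin 4) O H)
    {ϖ : O} (hϖ : Prime ϖ) [Finite (O ⧸ Ideal.span {ϖ})] {x₀ y₀ z₀ : H}
    (h₀ : ¬ ϖ ∣ discForm O x₀ y₀ z₀)
    (hgen : ∀ J ∈ idealsOfNorm H ϖ, ∃ y : H, (rn y : O) = ϖ ∧ J = Ideal.span {y}) (α : O)
    (hfin : (elementsOfNorm H (ϖ * α)).Finite) :
    (Nat.card (O ⧸ Ideal.span {ϖ}) + 1) * (elementsOfNorm H α).ncard =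
      (elementsOfNorm H (ϖ * α)).ncard + Nat.card (O ⧸ Ideal.span {ϖ}) *
        (elementsOfNorm H (ϖ * α) ∩ (extend H (Ideal.span {ϖ}) : Ideal H)).ncard := by
  classical
  obtain ⟨hYfin, hY⟩ := ncard_idealsOfNorm B hϖ h₀ hP
  set E := extend H (Ideal.span {ϖ}) with hE
  set N := Nat.card (O ⧸ Ideal.span {ϖ}) with hN
  -- Pairs x ∈ J are counted twice. Each of the N + 1 ideals contributes the count at α; each x lies
  -- in one ideal, or in all N + 1 if x ∈ ϖH.
  have hdc := Finset.sum_card_bipartiteAbove_eq_sum_card_bipartiteBelow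
    (s := hYfin.toFinset) (t := hfin.toFinset) (fun (J : Ideal H) x => x ∈ J)
  have hl : ∀ J ∈ hYfin.toFinset,
      (Finset.bipartiteAbove (fun (J : Ideal H) x => x ∈ J) hfin.toFinset J).card =
        (elementsOfNorm H α).ncard := by
    intro J hJ
    rw [Set.Finite.mem_toFinset] at hJ
    obtain ⟨y, hy, rfl⟩ := hgen J hJ
    rw [← ncard_mem_span hϖ.ne_zero hy α, ← Set.ncard_coe_finset]
    congr 1
    ext x
    simp [Finset.bipartiteAbove]
  have hr : ∀ x ∈ hfin.toFinset,
      (Finset.bipartiteBelow (fun (J : Ideal H) x => x ∈ J) hYfin.toFinset x).card =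
        1 + if x ∈ E then N else 0 := by
    intro x hx
    rw [Set.Finite.mem_toFinset] at hx
    have hrx : ϖ ∣ (rn x : O) := ⟨α, hx⟩
    split_ifs with hxE
    · rw [add_comm, hN, ← hY, Set.ncard_eq_toFinset_card _ hYfin]
      congr 1
      refine Finset.filter_true_of_mem fun J hJ => ?_
      rw [Set.Finite.mem_toFinset] at hJ
      obtain ⟨y, hy, rfl⟩ := hJ
      exact extend_le_span_of_associated hy hxE
    · rw [add_zero, Finset.card_eq_one]
      refine ⟨Ideal.span {x} ⊔ E, ?_⟩
      ext J
      rw [Finset.mem_bipartiteBelow, Set.Finite.mem_toFinset, Finset.mem_singleton]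
      constructor
      · rintro ⟨hJ, hxJ⟩
        exact (sup_eq_of_mem hP hϖ hJ hxE hxJ).symm
      · rintro rfl
        exact ⟨sup_mem_idealsOfNorm hP hϖ hxE hrx,
          Ideal.mem_sup_left (Ideal.mem_span_singleton_self x)⟩
  rw [Finset.sum_congr rfl hl, Finset.sum_congr rfl hr, Finset.sum_const, smul_eq_mul,
    ← Set.ncard_eq_toFinset_card _ hYfin, hY, Finset.sum_add_distrib, Finset.sum_const,
    smul_eq_mul, mul_one, ← Finset.sum_filter, Finset.sum_const, smul_eq_mul,
    ← Set.ncard_eq_toFinset_card _ hfin] at hdc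
  rw [hdc, mul_comm N, ← Set.ncard_coe_finset]
  congr 3
  ext x
  simp

end Counting

end QuatOrder

/-! ### Divisor sums and Eichler's formula. -/

namespace QuatOrder

open HasReducedNorm

section DivisorSum

variable {K : Type*} [Field K] [NumberField K]

/-- The sum of the norms of the ideals that divide `A` and satisfy `Q`. -/
def idealDivisorSum (A : Ideal (𝓞 K)) (Q : Ideal (𝓞 K) → Prop) : ℕ :=
  ∑ᶠ I ∈ {I | I ∣ A ∧ Q I}, Ideal.absNorm I

theorem finite_dvd {A : Ideal (𝓞 K)} (hA : A ≠ 0) (Q : Ideal (𝓞 K) → Prop) :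
    {I | I ∣ A ∧ Q I}.Finite := by
  have : Fintype {I : Ideal (𝓞 K) // I ∣ A} := UniqueFactorizationMonoid.fintypeSubtypeDvd _ hA
  exact (Set.finite_coe_iff.mp (Finite.of_fintype {I : Ideal (𝓞 K) // I ∣ A})).subset
    fun I hI => hI.1

theorem divisorSum_eq (hpid : IsPrincipalIdealRing (𝓞 K)) (α : 𝓞 K) (Q : Ideal (𝓞 K) → Prop) :
    divisorSum α Q = idealDivisorSum (Ideal.span {α}) Q := by
  have : divisors α Q = {I | I ∣ Ideal.span {α} ∧ Q I} := by
    ext I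
    exact ⟨fun h => h.2, fun h => ⟨hpid.principal I, h⟩⟩
  rw [divisorSum, this, idealDivisorSum]

theorem idealDivisorSum_congr {A : Ideal (𝓞 K)} {Q Q' : Ideal (𝓞 K) → Prop}
    (h : ∀ I, I ∣ A → (Q I ↔ Q' I)) : idealDivisorSum A Q = idealDivisorSum A Q' := by
  have : {I | I ∣ A ∧ Q I} = {I | I ∣ A ∧ Q' I} := by
    ext I
    exact and_congr_right fun hI => h I hI
  rw [idealDivisorSum, this, idealDivisorSum]

/-- Divisors of 𝔯A are split by divisibility by 𝔯; those divisible are 𝔯I with I ∣ A. -/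
theorem idealDivisorSum_mul {A 𝔯 : Ideal (𝓞 K)} (hA : A ≠ 0) (h𝔯 : 𝔯 ≠ 0)
    (Q : Ideal (𝓞 K) → Prop) :
    idealDivisorSum (𝔯 * A) Q = idealDivisorSum (𝔯 * A) (fun I => Q I ∧ ¬ 𝔯 ∣ I) +
      Ideal.absNorm 𝔯 * idealDivisorSum A (fun I => Q (𝔯 * I)) := by
  have h : {I | I ∣ 𝔯 * A ∧ Q I} = {I | I ∣ 𝔯 * A ∧ Q I ∧ ¬ 𝔯 ∣ I} ∪
      (fun I => 𝔯 * I) '' {I | I ∣ A ∧ Q (𝔯 * I)} := by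
    ext I
    constructor
    · rintro ⟨hI, hQ⟩
      by_cases hd : 𝔯 ∣ I
      · obtain ⟨I', rfl⟩ := hd
        exact Or.inr ⟨I', ⟨(mul_dvd_mul_iff_left h𝔯).mp hI, hQ⟩, rfl⟩
      · exact Or.inl ⟨hI, hQ, hd⟩
    · rintro (⟨hI, hQ, -⟩ | ⟨I', ⟨hI, hQ⟩, rfl⟩)
      · exact ⟨hI, hQ⟩
      · exact ⟨mul_dvd_mul_left _ hI, hQ⟩
  have hdisj : Disjoint {I | I ∣ 𝔯 * A ∧ Q I ∧ ¬ 𝔯 ∣ I}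
      ((fun I => 𝔯 * I) '' {I | I ∣ A ∧ Q (𝔯 * I)}) := by
    rw [Set.disjoint_left]
    rintro _ ⟨-, -, hI⟩ ⟨I', -, rfl⟩
    exact hI (dvd_mul_right _ _)
  rw [idealDivisorSum, h, finsum_mem_union hdisj (finite_dvd (mul_ne_zero h𝔯 hA) _)
    ((finite_dvd hA _).image _), finsum_mem_image (fun I _ J _ h => mul_left_cancel₀ h𝔯 h)]
  congr 1
  refine (finsum_mem_congr rfl fun I _ => map_mul _ _ _).trans ?_
  exact (AddMonoidHom.map_finsum_mem _ (AddMonoidHom.mulLeft _) (finite_dvd hA _)).symm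

theorem idealDivisorSum_of_not_dvd {A 𝔯 : Ideal (𝓞 K)} (hA : ¬ 𝔯 ∣ A) (Q : Ideal (𝓞 K) → Prop) :
    idealDivisorSum A Q = idealDivisorSum A (fun I => Q I ∧ ¬ 𝔯 ∣ I) :=
  idealDivisorSum_congr fun _ hI => ⟨fun h => ⟨h, fun hd => hA (hd.trans hI)⟩, fun h => h.1⟩

theorem idealDivisorSum_mul_prime {A 𝔯 : Ideal (𝓞 K)} (h𝔯 : Prime 𝔯)
    (Q : Ideal (𝓞 K) → Prop) :
    idealDivisorSum (𝔯 * A) (fun I => Q I ∧ ¬ 𝔯 ∣ I) =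
      idealDivisorSum A (fun I => Q I ∧ ¬ 𝔯 ∣ I) := by
  have h : {I | I ∣ 𝔯 * A ∧ Q I ∧ ¬ 𝔯 ∣ I} = {I | I ∣ A ∧ Q I ∧ ¬ 𝔯 ∣ I} := by
    ext I
    refine and_congr_left fun hI => ⟨fun h => ?_, fun h => h.mul_left _⟩
    obtain ⟨C, hC⟩ := h
    obtain ⟨C', rfl⟩ := (h𝔯.dvd_or_dvd ⟨A, hC.symm⟩).resolve_left hI.2
    exact ⟨C', mul_left_cancel₀ h𝔯.ne_zero (by rw [hC, mul_left_comm])⟩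
  rw [idealDivisorSum, h, idealDivisorSum]

/-- No prime divisor of `𝔇` divides `I`. -/
def PrimeTo (𝔇 I : Ideal (𝓞 K)) : Prop := ∀ 𝔰 : Ideal (𝓞 K), Prime 𝔰 → 𝔰 ∣ 𝔇 → ¬ 𝔰 ∣ I

theorem primeTo_mul_iff {𝔇 𝔯 : Ideal (𝓞 K)} (h𝔯 : Prime 𝔯) (h : ¬ 𝔯 ∣ 𝔇) (I : Ideal (𝓞 K)) :
    PrimeTo 𝔇 (𝔯 * I) ↔ PrimeTo 𝔇 I := by
  refine forall₃_congr fun 𝔰 h𝔰 hd => not_congr ⟨fun h1 => ?_, fun h1 => h1.mul_left _⟩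
  refine (h𝔰.dvd_or_dvd h1).resolve_left fun h2 => h ?_
  exact ((h𝔰.dvd_prime_iff_associated h𝔯).mp h2).symm.dvd.trans hd

theorem idealDivisorSum_ramified {𝔇 A 𝔯 : Ideal (𝓞 K)} (h𝔯 : Prime 𝔯) (h : 𝔯 ∣ 𝔇) :
    idealDivisorSum (𝔯 * A) (PrimeTo 𝔇) = idealDivisorSum A (PrimeTo 𝔇) := by
  have hc : ∀ B : Ideal (𝓞 K), idealDivisorSum B (PrimeTo 𝔇) =
      idealDivisorSum B (fun I => PrimeTo 𝔇 I ∧ ¬ 𝔯 ∣ I) := fun B =>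
    idealDivisorSum_congr fun I _ => ⟨fun h1 => ⟨h1, h1 𝔯 h𝔯 h⟩, fun h1 => h1.1⟩
  rw [hc, idealDivisorSum_mul_prime h𝔯, ← hc]

theorem idealDivisorSum_unramified {𝔇 A 𝔯 : Ideal (𝓞 K)} (hA : A ≠ 0) (h𝔯 : Prime 𝔯)
    (h : ¬ 𝔯 ∣ 𝔇) :
    idealDivisorSum (𝔯 * A) (PrimeTo 𝔇) =
      idealDivisorSum A (fun I => PrimeTo 𝔇 I ∧ ¬ 𝔯 ∣ I) +
      Ideal.absNorm 𝔯 * idealDivisorSum A (PrimeTo 𝔇) := by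
  rw [idealDivisorSum_mul hA h𝔯.ne_zero, idealDivisorSum_mul_prime h𝔯,
    idealDivisorSum_congr fun I _ => primeTo_mul_iff h𝔯 h I]

theorem idealDivisorSum_top {𝔇 : Ideal (𝓞 K)} : idealDivisorSum ⊤ (PrimeTo 𝔇) = 1 := by
  have h : {I | I ∣ (⊤ : Ideal (𝓞 K)) ∧ PrimeTo 𝔇 I} = {⊤} := by
    ext I
    constructor
    · rintro ⟨hI, -⟩
      exact top_le_iff.mp (Ideal.dvd_iff_le.mp hI)
    · rintro rfl
      refine ⟨dvd_rfl, fun 𝔰 h𝔰 _ h1 => h𝔰.not_isUnit ?_⟩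
      rw [Ideal.isUnit_iff]
      exact top_le_iff.mp (Ideal.dvd_iff_le.mp h1)
  rw [idealDivisorSum, h, finsum_mem_singleton, Ideal.absNorm_top]

theorem HasPositiveGenerators.isPrincipalIdealRing (hK : HasPositiveGenerators K) :
    IsPrincipalIdealRing (𝓞 K) := by
  refine ⟨fun I => ?_⟩
  by_cases hI : I = ⊥
  · rw [hI]; exact bot_isPrincipal
  · obtain ⟨x, -, hx⟩ := hK I hI
    exact ⟨x, hx⟩

end DivisorSum

section Eichler

variable {K : Type*} [Field K] [NumberField K] [NumberField.IsTotallyReal K]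
  {H : Type*} [Ring H] [Algebra (𝓞 K) H] [HasReducedNorm (𝓞 K) H]

theorem TotallyPositive.of_mul {x y : 𝓞 K} (hx : TotallyPositive (algebraMap (𝓞 K) K x))
    (hxy : TotallyPositive (algebraMap (𝓞 K) K (x * y))) :
    TotallyPositive (algebraMap (𝓞 K) K y) := by
  intro σ
  have h := hxy σ
  rw [map_mul, map_mul] at h
  exact (mul_pos_iff_of_pos_left (hx σ)).mp h

/-- The norm of a generator differs from ϖ by a totally positive unit, which is a square v²;
rescaling the generator by v removes it. -/
theorem exists_rn_eq_of_mem (hK : HasPositiveGenerators K)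
    (hpos : ∀ x : H, x ≠ 0 → TotallyPositive (algebraMap (𝓞 K) K (rn x))) {ϖ : 𝓞 K}
    (hϖ : TotallyPositive (algebraMap (𝓞 K) K ϖ)) {J : Ideal H} (hJ : J ∈ idealsOfNorm H ϖ) :
    ∃ y : H, (rn y : 𝓞 K) = ϖ ∧ J = Ideal.span {y} := by
  obtain ⟨y, ⟨u, hu⟩, rfl⟩ := hJ
  have hy0 : y ≠ 0 := by
    rintro rfl
    rw [rn_zero, zero_mul] at hu
    exact hϖ.ne_zero (by rw [← hu, map_zero])
  obtain ⟨v, rfl⟩ := exists_eq_sq_of_totallyPositive hK u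
    (TotallyPositive.of_mul (hpos y hy0) (by rwa [hu]))
  refine ⟨(v : 𝓞 K) • y, ?_, ?_⟩
  · rw [rn_smul, ← hu, Units.val_pow_eq_pow_val, mul_comm]
  · refine le_antisymm ?_ ?_
    · rw [Ideal.span_singleton_le_iff_mem, Ideal.mem_span_singleton']
      refine ⟨algebraMap _ H (↑v⁻¹ : 𝓞 K), ?_⟩
      rw [← Algebra.smul_def, smul_smul, Units.inv_mul, one_smul]
    · rw [Ideal.span_singleton_le_iff_mem, Algebra.smul_def]
      exact Ideal.mul_mem_left _ _ (Ideal.mem_span_singleton_self y)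

/-- Eichler's formula for the number of elements of a given norm. -/
theorem ncard_elementsOfNorm [Module.IsTorsionFree (𝓞 K) H] (hK : HasPositiveGenerators K)
    (hpos : ∀ x : H, x ≠ 0 → TotallyPositive (algebraMap (𝓞 K) K (rn x)))
    (hsat : NormSaturated (𝓞 K) H) (hP : PrincipalAtPrimes (𝓞 K) H)
    (B : Module.Basis (Fin 4) (𝓞 K) H) (hfin : ∀ α : 𝓞 K, (elementsOfNorm H α).Finite)
    {𝔇 : Ideal (𝓞 K)} (h𝔇 : ∀ 𝔯 : Ideal (𝓞 K), 𝔯 ∣ 𝔇 ↔ ∀ x y z : H, discForm (𝓞 K) x y z ∈ 𝔯)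
    (α : 𝓞 K) (hα : TotallyPositive (algebraMap (𝓞 K) K α)) :
    (elementsOfNorm H α).ncard =
      (elementsOfNorm H (1 : 𝓞 K)).ncard * idealDivisorSum (Ideal.span {α}) (PrimeTo 𝔇) := by
  have hpid := hK.isPrincipalIdealRing
  have hne : ∀ {x : 𝓞 K}, TotallyPositive (algebraMap (𝓞 K) K x) → x ≠ 0 := fun h h0 =>
    h.ne_zero (by rw [h0, map_zero])
  induction hn : Ideal.absNorm (Ideal.span {α}) using Nat.strong_induction_on generalizing α with
  | _ n ih =>
  by_cases hu : IsUnit α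
  · obtain ⟨u, rfl⟩ := hu
    obtain ⟨v, rfl⟩ := exists_eq_sq_of_totallyPositive hK u hα
    rw [Ideal.span_singleton_eq_top.mpr (Units.isUnit _), idealDivisorSum_top, mul_one,
      Units.val_pow_eq_pow_val, ← ncard_mul_unit_sq v 1, mul_one]
  obtain ⟨𝔯, h𝔯m, h𝔯α⟩ := Ideal.exists_le_maximal (Ideal.span {α})
    (by rwa [Ne, Ideal.span_singleton_eq_top])
  have h𝔯0 : 𝔯 ≠ ⊥ := by
    rintro rfl
    exact hne hα (by simpa using h𝔯α)
  have h𝔯 : Prime 𝔯 := Ideal.prime_of_isPrime h𝔯0 h𝔯m.isPrime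
  obtain ⟨ϖ, hϖpos, rfl⟩ := hK 𝔯 h𝔯0
  have hϖ0 := hne hϖpos
  have hϖ : Prime ϖ := (Ideal.span_singleton_prime hϖ0).mp h𝔯m.isPrime
  obtain ⟨β, rfl⟩ : ϖ ∣ α := by
    rwa [Ideal.span_singleton_le_iff_mem, Ideal.mem_span_singleton] at h𝔯α
  have hβpos := TotallyPositive.of_mul hϖpos hα
  have hspan : ∀ γ : 𝓞 K, Ideal.span {ϖ * γ} = Ideal.span {ϖ} * Ideal.span {γ} := fun γ =>
    (Ideal.span_singleton_mul_span_singleton ϖ γ).symm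
  have hfinq : Finite (𝓞 K ⧸ Ideal.span {ϖ}) := Ideal.finiteQuotientOfFreeOfNeBot _ h𝔯0
  have hN : Ideal.absNorm (Ideal.span {ϖ}) = Nat.card (𝓞 K ⧸ Ideal.span {ϖ}) := rfl
  have hlt : ∀ γ : 𝓞 K, γ ≠ 0 → Ideal.absNorm (Ideal.span {γ}) <
      Ideal.absNorm (Ideal.span {ϖ * γ}) := by
    intro γ hγ
    rw [hspan, map_mul, hN]
    refine lt_mul_of_one_lt_left (Nat.pos_of_ne_zero ?_) (one_lt_natCard_quotient hϖ)
    rw [Ne, Ideal.absNorm_eq_zero_iff]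
    simpa using hγ
  have ihβ := ih _ (hn ▸ hlt β (hne hβpos)) β hβpos rfl
  by_cases hd : Ideal.span {ϖ} ∣ 𝔇
  · have hram : ∀ x y z : H, ϖ ∣ discForm (𝓞 K) x y z := fun x y z =>
      Ideal.mem_span_singleton.mp ((h𝔇 _).mp hd x y z)
    obtain ⟨y, hy⟩ := exists_associated_rn hP B hϖ
    obtain ⟨y, hy, -⟩ := exists_rn_eq_of_mem hK hpos hϖpos ⟨y, hy, rfl⟩
    rw [ncard_mul_of_ramified hsat B hϖ hram hy, hspan, idealDivisorSum_ramified h𝔯 hd, ihβ]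
  · have hex : ∃ x y z : H, ¬ ϖ ∣ discForm (𝓞 K) x y z := by
      by_contra! hcon
      exact hd ((h𝔇 _).mpr fun x y z => Ideal.mem_span_singleton.mpr (hcon x y z))
    obtain ⟨x₀, y₀, z₀, h₀⟩ := hex
    have hrec := ncard_mul_of_unramified hP B hϖ h₀
      (fun J hJ => exists_rn_eq_of_mem hK hpos hϖpos hJ) β (hfin _)
    have hS := idealDivisorSum_unramified (𝔇 := 𝔇) (A := Ideal.span {β})
      (by simpa using hne hβpos) h𝔯 hd
    rw [hspan, hS, hN]
    by_cases hβ : ϖ ∣ β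
    · obtain ⟨γ, rfl⟩ := hβ
      have hγpos := TotallyPositive.of_mul hϖpos hβpos
      have ihγ := ih _ (hn ▸ (hlt γ (hne hγpos)).trans (hlt _ (hne hβpos))) γ hγpos rfl
      rw [ncard_mem_extend hϖ0] at hrec
      have hS' := idealDivisorSum_unramified (𝔇 := 𝔇) (A := Ideal.span {γ})
        (by simpa using hne hγpos) h𝔯 hd
      rw [hspan] at ihβ ⊢
      rw [idealDivisorSum_mul_prime h𝔯]
      rw [hS', hN] at ihβ
      rw [hS', hN]
      rw [ihβ, ihγ] at hrec
      -- The recursion subtracts N · r(γ); in ℕ this term is carried to the other side.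
      apply Nat.add_right_cancel (m := Nat.card (𝓞 K ⧸ Ideal.span {ϖ}) *
        ((elementsOfNorm H (1 : 𝓞 K)).ncard * idealDivisorSum (Ideal.span {γ}) (PrimeTo 𝔇)))
      rw [← hrec]
      ring
    · rw [elementsOfNorm_inter_extend hϖ0 hβ, Set.ncard_empty, mul_zero, add_zero, ihβ] at hrec
      rw [← hrec, ← idealDivisorSum_of_not_dvd]
      · ring
      · rwa [Ideal.dvd_span_singleton, Ideal.mem_span_singleton]

end Eichler

end QuatOrder

/-! ### Finiteness of the set of elements of given norm. -/

namespace QuatOrder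

open HasReducedNorm NumberField

section Finite

variable {K : Type*} [Field K] [NumberField K] [NumberField.IsTotallyReal K]
  {H : Type*} [Ring H] [Algebra (𝓞 K) H] [HasReducedNorm (𝓞 K) H]

/-- The Cauchy-Schwarz inequality for the trace form. -/
theorem rtr_mul_conj_sq_le (hpos : ∀ x : H, x ≠ 0 → TotallyPositive (algebraMap (𝓞 K) K (rn x)))
    (x e : H) (σ : K →+* ℝ) :
    σ (algebraMap (𝓞 K) K (rtr (x * conj (𝓞 K) e))) ^ 2 ≤
      4 * σ (algebraMap (𝓞 K) K (rn e)) * σ (algebraMap (𝓞 K) K (rn x)) := by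
  by_cases he : e = 0
  · subst he
    simp [conj_zero, rtr_zero, rn_zero]
  set t : 𝓞 K := rtr (x * conj (𝓞 K) e) with ht
  -- This is 2n(e) times the component of x orthogonal to e; its norm is non-negative.
  have h1 : (rn ((2 * rn e : 𝓞 K) • x + (-t) • e) : 𝓞 K) = rn e * (4 * rn e * rn x - t ^ 2) := by
    rw [rn_add, rn_smul, rn_smul, conj_smul, smul_mul_smul_comm, rtr_smul, ← ht]
    ring
  have h2 : 0 ≤ σ (algebraMap (𝓞 K) K (rn ((2 * rn e : 𝓞 K) • x + (-t) • e))) := by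
    by_cases h0 : (2 * rn e : 𝓞 K) • x + (-t) • e = 0
    · rw [h0, rn_zero, map_zero, map_zero]
    · exact (hpos _ h0 σ).le
  have h3 := hpos e he σ
  rw [h1, map_mul, map_mul] at h2
  have h4 := nonneg_of_mul_nonneg_right h2 h3
  simp only [map_sub, map_mul, map_pow, map_ofNat] at h4
  linarith

/-- Cauchy-Schwarz bounds the traces of x against a basis at every place, so they are algebraic
integers from a finite set. Definiteness makes the trace form non-degenerate, so they determine x.
-/
theorem finite_elementsOfNorm (hpos : ∀ x : H, x ≠ 0 → TotallyPositive (algebraMap (𝓞 K) K (rn x)))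
    {κ : Type*} [Finite κ] (B : Module.Basis κ (𝓞 K) H) (α : 𝓞 K) : (elementsOfNorm H α).Finite := by
  have hC : ∀ i, ∃ C : ℝ, ∀ w : InfinitePlace K,
      4 * realEmb w (algebraMap (𝓞 K) K (rn (B i))) * realEmb w (algebraMap (𝓞 K) K α) ≤ C := by
    intro i
    obtain ⟨C, hC⟩ := Set.Finite.bddAbove (Set.finite_range fun w : InfinitePlace K =>
      4 * realEmb w (algebraMap (𝓞 K) K (rn (B i))) * realEmb w (algebraMap (𝓞 K) K α))
    exact ⟨C, fun w => hC ⟨w, rfl⟩⟩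
  choose C hC using hC
  let F : H → κ → K := fun x i => algebraMap (𝓞 K) K (rtr (x * conj (𝓞 K) (B i)))
  have hF : Function.Injective F := by
    intro x x' h
    have h1 : ∀ y : H, (rtr ((x - x') * conj (𝓞 K) y) : 𝓞 K) = 0 := by
      intro y
      induction B.mem_span y using Submodule.span_induction with
      | zero => rw [conj_zero, mul_zero, rtr_zero]
      | add y z _ _ hy hz => rw [conj_add, mul_add, rtr_add, hy, hz, add_zero]
      | smul r y _ hy => rw [conj_smul, mul_smul_comm, rtr_smul, hy, mul_zero]
      | mem y hy =>
        obtain ⟨i, rfl⟩ := hy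
        have := FaithfulSMul.algebraMap_injective (𝓞 K) K (congrFun h i)
        rw [sub_mul, rtr_sub, this, sub_self]
    by_contra hne
    have h2 := h1 (x - x')
    rw [mul_conj, rtr_algebraMap] at h2
    have h3 := hpos _ (sub_ne_zero.mpr hne)
    refine h3.ne_zero ?_
    rw [(mul_eq_zero.mp h2).resolve_left two_ne_zero, map_zero]
  refine Set.Finite.of_finite_image (f := F) ?_ hF.injOn
  -- Only t² ≤ C is known; it implies |t| ≤ C + 1.
  refine (Set.Finite.pi' fun i => Embeddings.finite_of_norm_le K ℂ (C i + 1)).subset ?_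
  rintro _ ⟨x, hx, rfl⟩ i
  refine ⟨RingOfIntegers.isIntegral_coe _, fun φ => ?_⟩
  rw [← InfinitePlace.apply, ← norm_realEmb]
  have h1 := rtr_mul_conj_sq_le hpos x (B i) (realEmb (InfinitePlace.mk φ))
  rw [show (rn x : 𝓞 K) = α from hx] at h1
  have h2 := h1.trans (hC i _)
  rw [← sq_abs] at h2
  nlinarith [sq_nonneg (|realEmb (InfinitePlace.mk φ)
    (algebraMap (𝓞 K) K (rtr (x * conj (𝓞 K) (B i))))| - 1)]

end Finite

end QuatOrder

/-! ### Functionals modulo a prime whose kernel is a subring. -/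

namespace QuatOrder

open HasReducedNorm

section Level

variable {O H : Type*} [CommRing O] [Ring H] [Algebra O H] {ϖ : O}

/-- A linear functional modulo `ϖ` whose kernel is a proper subring. -/
structure IsLevel (l : H →ₗ[O] O ⧸ Ideal.span {ϖ}) : Prop where
  exists_eq_one : ∃ h, l h = 1
  apply_one : l 1 = 0
  apply_mul : ∀ x y, l x = 0 → l y = 0 → l (x * y) = 0

/-- The largest left ideal in the kernel of `l`. -/
def kerIdeal (l : H →ₗ[O] O ⧸ Ideal.span {ϖ}) : Ideal H where
  carrier := {x | ∀ h, l (h * x) = 0}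
  zero_mem' h := by rw [mul_zero, map_zero]
  add_mem' {x y} hx hy h := by rw [mul_add, map_add, hx, hy, add_zero]
  smul_mem' g x hx h := by rw [smul_eq_mul, ← mul_assoc, hx]

variable {l : H →ₗ[O] O ⧸ Ideal.span {ϖ}}

theorem map_eq_zero_of_mem_kerIdeal {x : H} (hx : x ∈ kerIdeal l) : l x = 0 := by
  rw [← one_mul x]; exact hx 1

theorem map_smul_self (x : H) : l (ϖ • x) = 0 := by
  rw [map_smul, Algebra.smul_def, Ideal.Quotient.algebraMap_eq, Ideal.Quotient.mk_singleton_self,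
    zero_mul]

theorem algebraMap_mem_kerIdeal : algebraMap O H ϖ ∈ kerIdeal l := fun h => by
  rw [← Algebra.commutes, ← Algebra.smul_def, map_smul_self]

theorem map_smul_of_dvd_sub_one {e : O} (he : ϖ ∣ e - 1) (x : H) : l (e • x) = l x := by
  obtain ⟨c, hc⟩ := he
  rw [eq_add_of_sub_eq hc, add_smul, one_smul, mul_smul, map_add, map_smul_self, zero_add]

theorem map_smul_of_dvd {e : O} (he : ϖ ∣ e) (x : H) : l (e • x) = 0 := by
  obtain ⟨c, rfl⟩ := he
  rw [mul_smul, map_smul_self]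

theorem exists_dvd_sub_one {p q : O} (hcop : IsCoprime p q) : ∃ e : O, p ∣ e - 1 ∧ q ∣ e := by
  obtain ⟨r, s, h⟩ := hcop
  exact ⟨s * q, ⟨-r, by linear_combination h⟩, dvd_mul_left _ _⟩

namespace IsLevel

variable (hl : IsLevel l)

include hl

/-- The kernel of `l` acts on the values of `l` through a character. -/
theorem map_mul_eq {h₁ : H} (h₁l : l h₁ = 1) {x : H} (hx : l x = 0) (h : H) :
    l (h * x) = l (h₁ * x) * l h := by
  obtain ⟨c, hc⟩ := Ideal.Quotient.mk_surjective (l h)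
  have h1 : l (h - c • h₁) = 0 := by
    rw [map_sub, map_smul, h₁l, Algebra.smul_def, Ideal.Quotient.algebraMap_eq, mul_one, hc,
      sub_self]
  have h2 := hl.apply_mul _ _ h1 hx
  rw [sub_mul, map_sub, smul_mul_assoc, map_smul, Algebra.smul_def, Ideal.Quotient.algebraMap_eq,
    hc, sub_eq_zero] at h2
  rw [h2, mul_comm]

/-- Since H = Oh₁ + ker l and ker l is closed under multiplication, it suffices to test
multiplication by 1 and h₁. -/
theorem mem_kerIdeal_iff {h₁ : H} (h₁l : l h₁ = 1) {x : H} :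
    x ∈ kerIdeal l ↔ l x = 0 ∧ l (h₁ * x) = 0 := by
  refine ⟨fun h => ⟨map_eq_zero_of_mem_kerIdeal h, h h₁⟩, fun h h' => ?_⟩
  rw [hl.map_mul_eq h₁l h.1, h.2, zero_mul]

theorem one_notMem (hϖ : Prime ϖ) : (1 : H) ∉ kerIdeal l := by
  intro h
  obtain ⟨h₁, h₁l⟩ := hl.exists_eq_one
  have := h h₁
  rw [mul_one, h₁l] at this
  have : Nontrivial (O ⧸ Ideal.span {ϖ}) := Ideal.Quotient.nontrivial_iff.mpr
    fun h => hϖ.not_isUnit (Ideal.span_singleton_eq_top.mp h)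
  exact one_ne_zero ‹(1 : O ⧸ Ideal.span {ϖ}) = 0›

/-- The character by which x acts on the values of l is l(h₁x), which is non-zero exactly when x ∉
`kerIdeal l`. -/
theorem map_mul_eq_zero_iff (hϖ : Prime ϖ) {x : H} (hx : l x = 0) (hxJ : x ∉ kerIdeal l) (h : H) :
    l (h * x) = 0 ↔ l h = 0 := by
  have : (Ideal.span {ϖ}).IsPrime := (Ideal.span_singleton_prime hϖ.ne_zero).mpr hϖ
  obtain ⟨h₁, h₁l⟩ := hl.exists_eq_one
  rw [hl.map_mul_eq h₁l hx, mul_eq_zero]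
  exact or_iff_right fun h0 => hxJ ((hl.mem_kerIdeal_iff h₁l).mpr ⟨hx, h0⟩)

/-- The map x ↦ (l x, l(h₁x)) identifies the quotient by `kerIdeal l` with a plane over O/ϖ in which
ker l is a line. -/
theorem quotient_equiv : ∃ E : (H ⧸ kerIdeal l) ≃ (O ⧸ Ideal.span {ϖ}) × (O ⧸ Ideal.span {ϖ}),
    ∀ x, (E (Submodule.Quotient.mk x)).1 = l x := by
  obtain ⟨h₁, h₁l⟩ := hl.exists_eq_one
  let Φ : H →+ (O ⧸ Ideal.span {ϖ}) × (O ⧸ Ideal.span {ϖ}) :=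
    (l.toAddMonoidHom).prod (l.toAddMonoidHom.comp (AddMonoidHom.mulLeft h₁))
  have hΦ : ∀ x y, Φ x = Φ y ↔ x - y ∈ kerIdeal l := by
    intro x y
    rw [hl.mem_kerIdeal_iff h₁l, ← sub_eq_zero, ← map_sub, Prod.ext_iff]
    rfl
  let φ : (H ⧸ kerIdeal l) → (O ⧸ Ideal.span {ϖ}) × (O ⧸ Ideal.span {ϖ}) :=
    Quotient.lift Φ fun x y h => (hΦ x y).mpr ((Submodule.quotientRel_def _).mp h)
  refine ⟨Equiv.ofBijective φ ⟨?_, ?_⟩, fun x => rfl⟩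
  · intro x y
    obtain ⟨x, rfl⟩ := Submodule.Quotient.mk_surjective _ x
    obtain ⟨y, rfl⟩ := Submodule.Quotient.mk_surjective _ y
    intro h
    exact (Submodule.Quotient.eq _).mpr ((hΦ x y).mp h)
  · rintro ⟨c, d⟩
    obtain ⟨c, rfl⟩ := Ideal.Quotient.mk_surjective c
    obtain ⟨d, rfl⟩ := Ideal.Quotient.mk_surjective d
    obtain ⟨e, he⟩ := Ideal.Quotient.mk_surjective (l (h₁ * h₁))
    -- The multiple of h₁ already contributes c · l(h₁²), a class lifted by ce, to the second
    -- coordinate; the multiple of 1 corrects it.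
    refine ⟨Submodule.Quotient.mk (c • h₁ + (d - c * e) • (1 : H)), Prod.ext ?_ ?_⟩
    · change l (c • h₁ + (d - c * e) • (1 : H)) = _
      rw [map_add, map_smul, map_smul, h₁l, hl.apply_one, smul_zero, add_zero, Algebra.smul_def,
        mul_one]
      rfl
    · change l (h₁ * (c • h₁ + (d - c * e) • (1 : H))) = _
      rw [mul_add, mul_smul_comm, mul_smul_comm, mul_one, map_add, map_smul, map_smul, h₁l, ← he,
        Algebra.smul_def, Algebra.smul_def, Ideal.Quotient.algebraMap_eq, mul_one, ← map_mul,
        ← map_add]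
      congr 1
      ring

theorem natCard_quotient :
    Nat.card (H ⧸ kerIdeal l) = Nat.card (O ⧸ Ideal.span {ϖ}) ^ 2 := by
  obtain ⟨E, -⟩ := hl.quotient_equiv
  rw [Nat.card_congr E, Nat.card_prod, sq]

theorem finite_quotient [Finite (O ⧸ Ideal.span {ϖ})] : Finite (H ⧸ kerIdeal l) := by
  obtain ⟨E, -⟩ := hl.quotient_equiv
  exact Finite.of_equiv _ E.symm

end IsLevel

variable [HasReducedNorm O H]

/-- The ideal contains ϖ and x̄x, so a norm prime to ϖ would put 1 in it. -/
theorem IsLevel.dvd_rn (hl : IsLevel l) (hϖ : Prime ϖ) (hm : (Ideal.span {ϖ}).IsMaximal) {x : H}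
    (hx : x ∈ kerIdeal l) : ϖ ∣ (rn x : O) := by
  by_contra hd
  obtain ⟨u, v, huv⟩ : IsCoprime ϖ (rn x) := by
    rw [← Ideal.isCoprime_span_singleton_iff, Ideal.isCoprime_iff_sup_eq]
    exact (hm.out.lt_iff.mp (left_lt_sup.mpr fun h => hd
      (Ideal.mem_span_singleton.mp ((Ideal.span_singleton_le_iff_mem _).mp h))))
  refine hl.one_notMem hϖ ?_
  rw [← map_one (algebraMap O H), ← huv, map_add, map_mul, map_mul, ← conj_mul_self]
  exact add_mem (Ideal.mul_mem_left _ _ algebraMap_mem_kerIdeal)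
    (Ideal.mul_mem_left _ _ (Ideal.mul_mem_left _ _ hx))

/-- The ideal has index N² < N⁴, so is not contained in ϖH, and ideals of norm ϖ are principal. -/
theorem IsLevel.mem_idealsOfNorm [IsDomain O] [IsPrincipalIdealRing O] [Module.IsTorsionFree O H]
    (hl : IsLevel l) (hϖ : Prime ϖ) (hP : PrincipalAtPrimes O H)
    (B : Module.Basis (Fin 4) O H) [Finite (O ⧸ Ideal.span {ϖ})] :
    kerIdeal l ∈ idealsOfNorm H ϖ := by
  have hm : (Ideal.span {ϖ}).IsMaximal :=
    PrincipalIdealRing.isMaximal_of_irreducible hϖ.irreducible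
  obtain ⟨y, hy, hyϖ⟩ := hP ϖ hϖ (kerIdeal l) algebraMap_mem_kerIdeal
    (fun x hx => hl.dvd_rn hϖ hm hx) (by
      by_contra! hcon
      have h1 : kerIdeal l ≤ extend H (Ideal.span {ϖ}) := fun x hx => by
        obtain ⟨v, hv⟩ := hcon x hx
        exact extend_span_singleton.mpr ⟨v, hv⟩
      have := hl.finite_quotient
      have h2 := Nat.card_le_card_of_surjective _ (Submodule.factor_surjective h1)
      rw [hl.natCard_quotient, natCard_quotient_extend B, Fintype.card_fin] at h2
      exact absurd h2 (not_le.mpr (Nat.pow_lt_pow_right (one_lt_natCard_quotient hϖ) (by norm_num))))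
  exact ⟨y, hyϖ, hy⟩

/-- If the number of `u` in a finite set of elements of norm one with `l (u v) = 0` does not depend
on `v` outside `kerIdeal l`, it is determined by the size of the set. -/
theorem IsLevel.ncard_eq_mul [IsDomain O] [IsPrincipalIdealRing O] (hl : IsLevel l) (hϖ : Prime ϖ) [Finite (O ⧸ Ideal.span {ϖ})]
    {T : Set H} (hT : T.Finite) (hT1 : ∀ u ∈ T, (rn u : O) = 1) {m : ℕ}
    (hm : ∀ v ∉ kerIdeal l, {u ∈ T | l (u * v) = 0}.ncard = m) :
    T.ncard = (Nat.card (O ⧸ Ideal.span {ϖ}) + 1) * m := by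
  classical
  have := hl.finite_quotient
  have := Fintype.ofFinite (H ⧸ kerIdeal l)
  have := Fintype.ofFinite (O ⧸ Ideal.span {ϖ})
  obtain ⟨E, hE⟩ := hl.quotient_equiv
  have hmk : ∀ v : H ⧸ kerIdeal l, Submodule.Quotient.mk v.out = v := fun v => Quotient.out_eq v
  set N := Nat.card (O ⧸ Ideal.span {ϖ}) with hN
  set t := hT.toFinset
  let V : Finset (H ⧸ kerIdeal l) := Finset.univ.erase 0
  have hV : V.card = N ^ 2 - 1 := by
    rw [Finset.card_erase_of_mem (Finset.mem_univ _), Finset.card_univ, ← Nat.card_eq_fintype_card,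
      hl.natCard_quotient]
  -- An element u of norm one permutes the plane H/`kerIdeal l`, so the vectors it sends into ker l
  -- form a line.
  have hrow : ∀ u ∈ t, (V.filter fun v => l (u * v.out) = 0).card = N - 1 := by
    intro u hu
    have hu1 : (rn u : O) = 1 := hT1 u (hT.mem_toFinset.mp hu)
    have hcu : ∀ v : H ⧸ kerIdeal l, conj O u • u • v = v := fun v => by
      rw [smul_smul, conj_mul_self, hu1, map_one, one_smul]
    have huc : ∀ v : H ⧸ kerIdeal l, u • conj O u • v = v := fun v => by
      rw [smul_smul, mul_conj, hu1, map_one, one_smul]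
    have hlE : ∀ v : H ⧸ kerIdeal l, l (u * v.out) = (E (u • v)).1 := fun v => by
      rw [← hE, ← smul_eq_mul, Submodule.Quotient.mk_smul, hmk]
    have h0 : (E (u • (0 : H ⧸ kerIdeal l))).1 = 0 := by
      rw [smul_zero, ← Submodule.Quotient.mk_zero, hE, map_zero]
    have hcard : (Finset.univ.filter fun v => (E (u • v)).1 = 0).card = N := by
      rw [hN, Nat.card_eq_fintype_card, ← Finset.card_univ]
      refine Finset.card_nbij' (fun v => (E (u • v)).2) (fun c => conj O u • E.symm (0, c))
        (fun _ _ => Finset.mem_univ _) ?_ ?_ ?_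
      · intro c _
        simp [huc]
      · intro v hv
        have hv0 : (E (u • v)).1 = 0 := by simpa using hv
        change conj O u • E.symm (0, _) = v
        rw [← hv0, Prod.mk.eta, Equiv.symm_apply_apply, hcu]
      · intro c _
        simp [huc]
    have hfe : (V.filter fun v => l (u * v.out) = 0) =
        (Finset.univ.filter fun v => (E (u • v)).1 = 0).erase 0 := by
      ext v
      simp only [V, hlE, Finset.mem_filter, Finset.mem_erase, Finset.mem_univ, and_true, true_and]
    rw [hfe, Finset.card_erase_of_mem (by simpa using h0), hcard]
  have hcol : ∀ v ∈ V, (t.filter fun u => l (u * v.out) = 0).card = m := by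
    intro v hv
    rw [← hm v.out ?_, ← Set.ncard_coe_finset]
    · congr 1
      ext u
      simp [t]
    · intro h
      refine Finset.ne_of_mem_erase hv ?_
      rw [← hmk v]
      exact (Submodule.Quotient.mk_eq_zero _).mpr h
  -- Double counting over T and the non-zero vectors gives (N - 1) · #T = (N² - 1) · m.
  have hsum := Finset.sum_card_bipartiteAbove_eq_sum_card_bipartiteBelow (s := t) (t := V)
    fun u v => l (u * v.out) = 0
  simp only [Finset.bipartiteAbove, Finset.bipartiteBelow] at hsum
  rw [Finset.sum_congr rfl hrow, Finset.sum_congr rfl hcol, Finset.sum_const, Finset.sum_const, hV,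
    smul_eq_mul, smul_eq_mul] at hsum
  have htc : T.ncard = t.card := Set.ncard_eq_toFinset_card T hT
  have hN1 : 1 < N := one_lt_natCard_quotient hϖ
  obtain ⟨k, hk⟩ := Nat.exists_eq_add_of_lt hN1
  rw [htc, hk]
  rw [hk, show (1 + k + 1) ^ 2 - 1 = (1 + k + 1 + 1) * (k + 1) by
    rw [Nat.sub_eq_iff_eq_add (by nlinarith)]; ring, Nat.add_sub_cancel] at hsum
  have : (k + 1) * t.card = (k + 1) * ((1 + k + 1 + 1) * m) := by
    linarith
  exact Nat.eq_of_mul_eq_mul_left (Nat.succ_pos k) this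

end Level

end QuatOrder

/-! ### Counting the elements of norm one that move x into the suborder. -/

namespace QuatOrder

open HasReducedNorm

section Translators

variable {O H : Type*} [CommRing O] [Ring H] [Algebra O H] [HasReducedNorm O H] {p q : O}

theorem conj_mul_cancel_left {u : H} (hu : (rn u : O) = 1) (x : H) : conj O u * (u * x) = x := by
  rw [← mul_assoc, conj_mul_self, hu, map_one, one_mul]

theorem conj_mul_cancel_right {u : H} (hu : (rn u : O) = 1) (x : H) : x * conj O u * u = x := by
  rw [mul_assoc, conj_mul_self, hu, map_one, mul_one]

theorem mul_mem_iff_of_rn_eq_one {u : H} (hu : (rn u : O) = 1) {J : Ideal H} {x : H} :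
    u * x ∈ J ↔ x ∈ J := by
  refine ⟨fun h => ?_, Ideal.mul_mem_left _ _⟩
  rw [← conj_mul_cancel_left hu x]
  exact Ideal.mul_mem_left _ _ h

theorem ncard_mul_right {u₀ : H} (hu₀ : (rn u₀ : O) = 1) (P : H → Prop) :
    {u ∈ elementsOfNorm H (1 : O) | P (u * u₀)}.ncard =
      {u ∈ elementsOfNorm H (1 : O) | P u}.ncard := by
  have h : {u ∈ elementsOfNorm H (1 : O) | P u} =
      (fun u => u * u₀) '' {u ∈ elementsOfNorm H (1 : O) | P (u * u₀)} := by
    ext u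
    constructor
    · rintro ⟨hu, hP⟩
      refine ⟨u * conj O u₀, ⟨?_, ?_⟩, conj_mul_cancel_right hu₀ u⟩
      · change rn _ = _
        rw [rn_mul, rn_conj, hu₀, mul_one, hu]
      · rwa [conj_mul_cancel_right hu₀]
    · rintro ⟨u, ⟨hu, hP⟩, rfl⟩
      refine ⟨?_, hP⟩
      change rn _ = _
      rw [rn_mul, hu₀, mul_one, hu]
  rw [h, Set.ncard_image_of_injective]
  intro u v huv
  have hc : ∀ x, x * u₀ * conj O u₀ = x := fun x => by
    rw [mul_assoc, mul_conj, hu₀, map_one, mul_one]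
  rw [← hc u, show u * u₀ = v * u₀ from huv, hc]

/-- The elements of norm one that move `x` into the common kernel of `l` and `l'`. -/
def translators (l : H →ₗ[O] O ⧸ Ideal.span {p}) (l' : H →ₗ[O] O ⧸ Ideal.span {q}) (x : H) :
    Set H :=
  {u ∈ elementsOfNorm H (1 : O) | l (u * x) = 0 ∧ l' (u * x) = 0}

variable {l : H →ₗ[O] O ⧸ Ideal.span {p}} {l' : H →ₗ[O] O ⧸ Ideal.span {q}}

theorem translators_comm (x : H) : translators l l' x = translators l' l x :=
  Set.ext fun _ => and_congr_right fun _ => and_comm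

theorem ncard_translators_mul {u₀ : H} (hu₀ : (rn u₀ : O) = 1) (x : H) :
    (translators l l' (u₀ * x)).ncard = (translators l l' x).ncard := by
  have := ncard_mul_right hu₀ fun u => l (u * x) = 0 ∧ l' (u * x) = 0
  simp only [mul_assoc] at this
  exact this

variable (hl : IsLevel l) (hl' : IsLevel l') (hp : Prime p) (hq : Prime q)
  (hperc : ∀ x : H, ∃ u : H, (rn u : O) = 1 ∧ l (u * x) = 0 ∧ l' (u * x) = 0)

include hl hl' hp hq hperc

/-- By perceptivity x may be assumed to lie in both kernels; there l(ux) = 0 iff l(u) = 0, and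
likewise for l'. -/
theorem ncard_translators_of_notMem {x : H} (hx : x ∉ kerIdeal l) (hx' : x ∉ kerIdeal l') :
    (translators l l' x).ncard = (translators l l' 1).ncard := by
  obtain ⟨u₀, hu₀, h, h'⟩ := hperc x
  rw [← ncard_translators_mul hu₀]
  congr 1
  ext u
  refine and_congr_right fun _ => ?_
  rw [hl.map_mul_eq_zero_iff hp h (by rwa [mul_mem_iff_of_rn_eq_one hu₀]),
    hl'.map_mul_eq_zero_iff hq h' (by rwa [mul_mem_iff_of_rn_eq_one hu₀]), mul_one]

omit hl hp hq in
theorem ncard_translators_of_mem_left (hq : Prime q) {x : H} (hx : x ∈ kerIdeal l)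
    (hx' : x ∉ kerIdeal l') :
    (translators l l' x).ncard = {u ∈ elementsOfNorm H (1 : O) | l' u = 0}.ncard := by
  obtain ⟨u₀, hu₀, -, h'⟩ := hperc x
  rw [← ncard_translators_mul hu₀]
  congr 1
  ext u
  refine and_congr_right fun _ => ?_
  rw [hl'.map_mul_eq_zero_iff hq h' (by rwa [mul_mem_iff_of_rn_eq_one hu₀])]
  exact and_iff_right (Ideal.mul_mem_left _ _ hx _)

variable [IsDomain O] [IsPrincipalIdealRing O] [Finite (O ⧸ Ideal.span {p})]
  [Finite (O ⧸ Ideal.span {q})] (hcop : IsCoprime p q) (hfin : (elementsOfNorm H (1 : O)).Finite)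

include hcop hfin

/-- For v ∉ `kerIdeal l`, the element congruent to v modulo p and to 1 modulo q avoids both ideals.
Hence the number of u with l'(u) = 0 and l(uv) = 0 is independent of v, and `IsLevel.ncard_eq_mul`
applies. -/
theorem ncard_level_right :
    {u ∈ elementsOfNorm H (1 : O) | l' u = 0}.ncard =
      (Nat.card (O ⧸ Ideal.span {p}) + 1) * (translators l l' 1).ncard := by
  obtain ⟨e, hpe, hqe⟩ := exists_dvd_sub_one hcop
  refine hl.ncard_eq_mul hp (hfin.subset fun u hu => hu.1) (fun u hu => hu.1) fun v hv => ?_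
  have hpe' : p ∣ 1 - e := by rwa [← neg_sub, dvd_neg]
  have hqe' : q ∣ (1 - e) - 1 := by rwa [sub_sub_cancel_left, dvd_neg]
  have h1 : ∀ u, l (u * (e • v + (1 - e) • (1 : H))) = l (u * v) := fun u => by
    rw [mul_add, mul_smul_comm, mul_smul_comm, map_add, map_smul_of_dvd_sub_one hpe,
      map_smul_of_dvd hpe', add_zero]
  have h2 : ∀ u, l' (u * (e • v + (1 - e) • (1 : H))) = l' u := fun u => by
    rw [mul_add, mul_smul_comm, mul_smul_comm, map_add, map_smul_of_dvd_sub_one hqe',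
      map_smul_of_dvd hqe, zero_add, mul_one]
  rw [← ncard_translators_of_notMem hl hl' hp hq hperc (x := e • v + (1 - e) • (1 : H))]
  · congr 1
    ext u
    simp only [translators, h1, h2, Set.mem_ofPred_eq]
    tauto
  · exact fun h => hv fun u => by rw [← h1, h]
  · intro h
    obtain ⟨u, hu⟩ := hl'.exists_eq_one
    have : Nontrivial (O ⧸ Ideal.span {q}) := Ideal.Quotient.nontrivial_iff.mpr
      fun h => hq.not_isUnit (Ideal.span_singleton_eq_top.mp h)
    have h3 := h u
    rw [h2, hu] at h3
    exact one_ne_zero h3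

/-- The same argument with ev, where e is 0 modulo p and 1 modulo q: this lies in `kerIdeal l`, so
only the condition on l' remains. -/
theorem ncard_elementsOfNorm_one :
    (elementsOfNorm H (1 : O)).ncard =
      (Nat.card (O ⧸ Ideal.span {q}) + 1) * {u ∈ elementsOfNorm H (1 : O) | l' u = 0}.ncard := by
  obtain ⟨e, hqe, hpe⟩ := exists_dvd_sub_one hcop.symm
  refine hl'.ncard_eq_mul hq hfin (fun u hu => hu) fun v hv => ?_
  have h2 : ∀ u, l' (u * (e • v)) = l' (u * v) := fun u => by
    rw [mul_smul_comm, map_smul_of_dvd_sub_one hqe]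
  have h1 : ∀ u, l (u * (e • v)) = 0 := fun u => by
    rw [mul_smul_comm, map_smul_of_dvd hpe]
  rw [← ncard_translators_of_mem_left hl' hperc hq (x := e • v) h1
    (fun h => hv fun u => by rw [← h2, h])]
  congr 1
  ext u
  simp only [translators, h1, h2, Set.mem_ofPred_eq, true_and]

-- Each ideal containing x removes one of the two conditions on u, and removing a condition
-- multiplies the count by N + 1.
open Classical in
theorem ncard_translators (x : H) :
    (translators l l' x).ncard = (translators l l' 1).ncard *
      ((1 + if x ∈ kerIdeal l then Nat.card (O ⧸ Ideal.span {p}) else 0) *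
      (1 + if x ∈ kerIdeal l' then Nat.card (O ⧸ Ideal.span {q}) else 0)) := by
  have hperc' : ∀ x : H, ∃ u : H, (rn u : O) = 1 ∧ l' (u * x) = 0 ∧ l (u * x) = 0 := fun x => by
    obtain ⟨u, h, h1, h2⟩ := hperc x
    exact ⟨u, h, h2, h1⟩
  have hr := ncard_level_right hl hl' hp hq hperc hcop hfin
  have hr' := ncard_level_right hl' hl hq hp hperc' hcop.symm hfin
  by_cases hx : x ∈ kerIdeal l <;> by_cases hx' : x ∈ kerIdeal l'
  · have : translators l l' x = elementsOfNorm H (1 : O) :=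
      Set.ext fun u => and_iff_left ⟨hx u, hx' u⟩
    rw [if_pos hx, if_pos hx', this,
      ncard_elementsOfNorm_one hl hl' hp hq hperc hcop hfin, hr]
    ring
  · rw [if_pos hx, if_neg hx', ncard_translators_of_mem_left hl' hperc hq hx hx', hr]
    ring
  · rw [if_neg hx, if_pos hx', translators_comm,
      ncard_translators_of_mem_left hl hperc' hp hx' hx, hr', translators_comm]
    ring
  · rw [if_neg hx, if_neg hx', ncard_translators_of_notMem hl hl' hp hq hperc hx hx']
    ring

-- Pairs (u, x) with ux in both kernels are counted by u: left multiplication by u permutes the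
-- elements of norm α.
omit hl hl' hp hq hperc hcop [IsDomain O] [IsPrincipalIdealRing O] [Finite (O ⧸ Ideal.span {p})]
  [Finite (O ⧸ Ideal.span {q})] in
theorem sum_ncard_translators {α : O} (hα : (elementsOfNorm H α).Finite) :
    ∑ x ∈ hα.toFinset, (translators l l' x).ncard = (elementsOfNorm H (1 : O)).ncard *
      {x ∈ elementsOfNorm H α | l x = 0 ∧ l' x = 0}.ncard := by
  classical
  have hsum := Finset.sum_card_bipartiteAbove_eq_sum_card_bipartiteBelow (s := hα.toFinset)
    (t := hfin.toFinset) fun x u => l (u * x) = 0 ∧ l' (u * x) = 0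
  have h1 : ∀ x, (translators l l' x).ncard =
      (Finset.bipartiteAbove (fun x u => l (u * x) = 0 ∧ l' (u * x) = 0) hfin.toFinset x).card := by
    intro x
    rw [← Set.ncard_coe_finset]
    congr 1
    ext u
    simp [translators, Finset.bipartiteAbove]
  have h2 : ∀ u ∈ hfin.toFinset,
      (Finset.bipartiteBelow (fun x u => l (u * x) = 0 ∧ l' (u * x) = 0) hα.toFinset u).card =
        {x ∈ elementsOfNorm H α | l x = 0 ∧ l' x = 0}.ncard := by
    intro u hu
    have hu1 : (rn u : O) = 1 := hfin.mem_toFinset.mp hu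
    have h3 : {x ∈ elementsOfNorm H α | l x = 0 ∧ l' x = 0} = (fun x => u * x) ''
        (Finset.bipartiteBelow (fun x u => l (u * x) = 0 ∧ l' (u * x) = 0) hα.toFinset u) := by
      have huc : ∀ x, u * (conj O u * x) = x := fun x => by
        rw [← mul_assoc, mul_conj, hu1, map_one, one_mul]
      ext x
      simp only [Finset.bipartiteBelow, Finset.coe_filter, Set.Finite.mem_toFinset, Set.mem_image,
        Set.mem_ofPred_eq]
      constructor
      · rintro ⟨hx, h⟩
        refine ⟨conj O u * x, ⟨?_, by rwa [huc]⟩, huc x⟩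
        change rn _ = _
        rw [rn_mul, rn_conj, hu1, one_mul, hx]
      · rintro ⟨x, ⟨hx, h⟩, rfl⟩
        refine ⟨?_, h⟩
        change rn _ = _
        rw [rn_mul, hu1, one_mul, hx]
    rw [h3, Set.ncard_image_of_injective, Set.ncard_coe_finset]
    intro x y hxy
    rw [← conj_mul_cancel_left hu1 x, show u * x = u * y from hxy, conj_mul_cancel_left hu1]
  simp_rw [h1]
  rw [hsum, Finset.sum_congr rfl h2, Finset.sum_const, smul_eq_mul,
    Set.ncard_eq_toFinset_card _ hfin]

open Classical in
/-- The number of elements of norm `α` in a perceptive suborder, in terms of the big order. -/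
theorem ncard_mul_ncard_level {α : O} (hα : (elementsOfNorm H α).Finite)
    (hram : ∀ x, x ∈ kerIdeal l ↔ p ∣ (rn x : O)) :
    (elementsOfNorm H (1 : O)).ncard * {x ∈ elementsOfNorm H α | l x = 0 ∧ l' x = 0}.ncard =
      (translators l l' 1).ncard * ((1 + if p ∣ α then Nat.card (O ⧸ Ideal.span {p}) else 0) *
        ((elementsOfNorm H α).ncard + Nat.card (O ⧸ Ideal.span {q}) *
          (elementsOfNorm H α ∩ kerIdeal l').ncard)) := by
  rw [← sum_ncard_translators hfin hα, Finset.sum_congr rfl fun x hx => by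
    rw [ncard_translators hl hl' hp hq hperc hcop hfin, if_congr (hram x) rfl rfl,
      show (rn x : O) = α from hα.mem_toFinset.mp hx], ← Finset.mul_sum, ← Finset.mul_sum]
  congr 2
  rw [Finset.sum_add_distrib, Finset.sum_const, smul_eq_mul, mul_one,
    Set.ncard_eq_toFinset_card _ hα, ← Finset.sum_filter, Finset.sum_const, smul_eq_mul, mul_comm]
  congr 2
  rw [← Set.ncard_coe_finset]
  congr 1
  ext x
  simp

end Translators

end QuatOrder

/-! ### From the index 𝔭𝔮 to two functionals cutting out the suborder. -/

namespace QuatOrder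

section Index

variable {K : Type*} [Field K] [NumberField K] {a b : K}

/-- Adapted bases for nested lattices over a principal ideal domain. -/
theorem exists_adapted_basis (hpid : IsPrincipalIdealRing (𝓞 K))
    {L M : Submodule (𝓞 K) ℍ[K,a,b]} (hL : Submodule.IsLattice K L) (hM : Submodule.IsLattice K M)
    (hle : M ≤ L) : ∃ (B : Module.Basis (Fin 4) (𝓞 K) L) (c : Fin 4 → 𝓞 K),
      ∀ x : L, x.1 ∈ M ↔ ∀ i, c i ∣ B.repr x i := by
  have hfr : ∀ L : Submodule (𝓞 K) ℍ[K,a,b], Submodule.IsLattice K L →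
      Module.finrank (𝓞 K) L = 4 := fun L hL => by
    rw [← QuaternionAlgebra.finrank_eq_four a 0 b]
    exact congrArg Cardinal.toNat (Submodule.IsLattice.rank' K L)
  have hfree : Module.Free (𝓞 K) L := Submodule.IsLattice.free K L
  have hfin : Module.Finite (𝓞 K) L := Module.Finite.iff_fg.mpr hL.fg
  let B₀ : Module.Basis (Fin 4) (𝓞 K) L := Module.finBasisOfFinrankEq _ _ (hfr L hL)
  obtain ⟨B, c, B', hB'⟩ := Submodule.exists_smith_normal_form_of_rank_eq
    (N := M.comap L.subtype) B₀ (by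
      rw [(Submodule.comapSubtypeEquivOfLe hle).finrank_eq, hfr L hL, hfr M hM])
  refine ⟨B, c, fun x => ⟨fun hx i => ?_, fun h => ?_⟩⟩
  · have h1 := B'.sum_repr ⟨x, hx⟩
    have h2 : x = ∑ j, (c j * B'.repr ⟨x, hx⟩ j) • B j := by
      have := congrArg Subtype.val h1
      rw [AddSubmonoidClass.coe_finsetSum] at this
      refine this.symm.trans (Finset.sum_congr rfl fun j _ => ?_)
      rw [Submodule.coe_smul, hB', smul_smul, mul_comm]
    rw [h2, map_sum, Finsupp.finsetSum_apply]
    simp [Finsupp.single_apply]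
  · choose d hd using h
    have h2 : x = ∑ j, d j • (B' j : L) := by
      rw [← B.sum_repr x]
      refine Finset.sum_congr rfl fun j _ => ?_
      rw [hB', smul_smul, hd, mul_comm]
    have h3 : x ∈ M.comap L.subtype := by
      rw [h2]
      exact Submodule.sum_mem _ fun j _ => Submodule.smul_mem _ _ (B' j).2
    exact h3

/-- In the adapted basis an f mapping L into M has matrix diag(c) times an integral matrix, and
diag(c) itself attains the generator. -/
theorem latticeIndex_eq {L M : Submodule (𝓞 K) ℍ[K,a,b]} (hL : Submodule.IsLattice K L)
    {B : Module.Basis (Fin 4) (𝓞 K) L} {c : Fin 4 → 𝓞 K} (hle : M ≤ L)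
    (hM : ∀ x : L, x.1 ∈ M ↔ ∀ i, c i ∣ B.repr x i) :
    latticeIndex L M = IsLocalization.coeSubmodule K (Ideal.span {∏ i, c i}) := by
  set B' : Module.Basis (Fin 4) K ℍ[K,a,b] := B.extendOfIsLattice K with hB'
  have hBi : ∀ i, B' i = (B i).1 := fun i => B.extendOfIsLattice_apply K i
  have hrep : ∀ x : L, x.1 = ∑ j, algebraMap (𝓞 K) K (B.repr x j) • B' j := by
    intro x
    have := congrArg Subtype.val (B.sum_repr x)
    rw [AddSubmonoidClass.coe_finsetSum] at this
    rw [← this]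
    refine Finset.sum_congr rfl fun j _ => ?_
    rw [hBi, algebraMap_smul, Submodule.coe_smul]
  have hrepr : ∀ (x : L) i, B'.repr x.1 i = algebraMap (𝓞 K) K (B.repr x i) := by
    intro x i
    rw [hrep x, B'.repr_sum_self]
  rw [IsLocalization.coeSubmodule_span_singleton]
  refine le_antisymm (Submodule.span_le.mpr ?_) ?_
  · rintro _ ⟨f, hf, rfl⟩
    have hmem : ∀ i, f (B' i) ∈ M := fun i => by rw [hBi]; exact hf _ (B i).2
    choose d hd using fun i => (hM ⟨f (B' i), hle (hmem i)⟩).mp (hmem i)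
    have hmat : LinearMap.toMatrix B' B' f = Matrix.diagonal (fun i => algebraMap (𝓞 K) K (c i)) *
        ((Matrix.of fun i j => d j i).map (algebraMap (𝓞 K) K)) := by
      ext i j
      rw [Matrix.diagonal_mul, Matrix.map_apply, Matrix.of_apply, ← map_mul, ← hd,
        LinearMap.toMatrix_apply, ← hrepr]
    rw [← LinearMap.det_toMatrix B', hmat, Matrix.det_mul, Matrix.det_diagonal, ← map_prod,
      ← RingHom.mapMatrix_apply, ← RingHom.map_det]
    refine Submodule.mem_span_singleton.mpr ⟨(Matrix.of fun i j => d j i).det, ?_⟩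
    rw [Algebra.smul_def, mul_comm]
  · rw [Submodule.span_singleton_le_iff_mem]
    refine Submodule.subset_span
      ⟨Matrix.toLin B' B' (Matrix.diagonal fun i => algebraMap (𝓞 K) K (c i)), fun x hx => ?_, ?_⟩
    · have h1 : ∀ i, c i • (B i).1 ∈ M := fun i => by
        refine (hM (c i • B i)).mpr fun j => ?_
        rw [map_smul, Finsupp.smul_apply, Module.Basis.repr_self, Finsupp.single_apply]
        split_ifs with h
        · rw [h]; simp
        · simp
      have h2 := hrep ⟨x, hx⟩
      simp only at h2
      rw [h2, map_sum]
      refine Submodule.sum_mem _ fun j _ => ?_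
      rw [map_smul, Matrix.toLin_self, algebraMap_smul]
      refine Submodule.smul_mem _ _ ?_
      rw [Finset.sum_eq_single j (fun i _ hij => by rw [Matrix.diagonal_apply_ne _ hij, zero_smul])
        (fun h => absurd (Finset.mem_univ _) h), Matrix.diagonal_apply_eq, hBi, algebraMap_smul]
      exact h1 j
    · rw [LinearMap.det_toLin, Matrix.det_diagonal, map_prod]

end Index

section Levels

variable {O H : Type*} [CommRing O] [IsDomain O] [Ring H] [Algebra O H] {p q : O}

/-- One elementary divisor carries p and one carries q, possibly the same; all others are units. -/
theorem exists_coordinates {κ : Type*} [Fintype κ] (hp : Prime p) (hq : Prime q)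
    (hcop : IsCoprime p q) {c : κ → O} (hc : Associated (∏ i, c i) (p * q)) :
    ∃ i j, ∀ x : κ → O, (∀ k, c k ∣ x k) ↔ p ∣ x i ∧ q ∣ x j := by
  classical
  obtain ⟨i, -, hi⟩ := (hp.dvd_finsetProd_iff _).mp ((dvd_mul_right p q).trans hc.symm.dvd)
  obtain ⟨j, -, hj⟩ := (hq.dvd_finsetProd_iff _).mp ((dvd_mul_left q p).trans hc.symm.dvd)
  refine ⟨i, j, fun x => ⟨fun h => ⟨hi.trans (h i), hj.trans (h j)⟩, fun ⟨h1, h2⟩ k => ?_⟩⟩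
  -- With l = i or l = j this gives c k ∣ q for k ≠ i and c k ∣ p for k ≠ j.
  have hpair : ∀ k l, k ≠ l → c k * c l ∣ p * q := fun k l hkl => by
    refine dvd_trans ?_ hc.dvd
    rw [← Finset.mul_prod_erase _ _ (Finset.mem_univ k)]
    exact mul_dvd_mul_left _ (Finset.dvd_prod_of_mem _
      (Finset.mem_erase.mpr ⟨hkl.symm, Finset.mem_univ _⟩))
  have hkq : k ≠ i → c k ∣ q := fun hk => by
    refine (mul_dvd_mul_iff_right hp.ne_zero).mp ?_
    rw [mul_comm q p]
    exact (mul_dvd_mul_left _ hi).trans (hpair k i hk)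
  have hkp : k ≠ j → c k ∣ p := fun hk => by
    refine (mul_dvd_mul_iff_right hq.ne_zero).mp ?_
    exact (mul_dvd_mul_left _ hj).trans (hpair k j hk)
  by_cases hki : k = i <;> by_cases hkj : k = j
  · subst hki
    rw [← hkj] at h2
    refine dvd_trans ?_ (hcop.mul_dvd h1 h2)
    exact (Finset.dvd_prod_of_mem _ (Finset.mem_univ k)).trans hc.dvd
  · rw [← hki] at h1
    exact (hkp hkj).trans h1
  · rw [← hkj] at h2
    exact (hkq hki).trans h2
  · exact (hcop.isUnit_of_dvd' (hkp hkj) (hkq hki)).dvd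

/-- The coordinate functional modulo `p`. -/
def coordMod {κ : Type*} (B : Module.Basis κ O H) (p : O) (i : κ) : H →ₗ[O] O ⧸ Ideal.span {p} :=
  (Ideal.span {p}).mkQ ∘ₗ B.coord i

theorem coordMod_eq_zero_iff {κ : Type*} (B : Module.Basis κ O H) (p : O) (i : κ) (x : H) :
    coordMod B p i x = 0 ↔ p ∣ B.repr x i :=
  (Submodule.Quotient.mk_eq_zero _).trans Ideal.mem_span_singleton

/-- A subring that is the common kernel of functionals modulo coprime elements. -/
theorem isLevel_of_mem_iff (hcop : IsCoprime p q) (G : Subalgebra O H)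
    {l : H →ₗ[O] O ⧸ Ideal.span {p}} {l' : H →ₗ[O] O ⧸ Ideal.span {q}}
    (hG : ∀ x, x ∈ G ↔ l x = 0 ∧ l' x = 0) (hl : ∃ h, l h = 1) : IsLevel l := by
  obtain ⟨e, hpe, hqe⟩ := exists_dvd_sub_one hcop
  have h1 : ∀ x, l x = 0 → e • x ∈ G := fun x hx =>
    (hG _).mpr ⟨by rw [map_smul, hx, smul_zero], map_smul_of_dvd hqe x⟩
  refine ⟨hl, ((hG 1).mp (one_mem G)).1, fun x y hx hy => ?_⟩
  have h2 := ((hG _).mp (mul_mem (h1 x hx) (h1 y hy))).1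
  rwa [smul_mul_assoc, mul_smul_comm, map_smul_of_dvd_sub_one hpe,
    map_smul_of_dvd_sub_one hpe] at h2

theorem exists_levels {κ : Type*} [Fintype κ] (hp : Prime p) (hq : Prime q)
    (hcop : IsCoprime p q) (B : Module.Basis κ O H) {c : κ → O}
    (hc : Associated (∏ i, c i) (p * q)) (G : Subalgebra O H)
    (hG : ∀ x, x ∈ G ↔ ∀ i, c i ∣ B.repr x i) :
    ∃ (l : H →ₗ[O] O ⧸ Ideal.span {p}) (l' : H →ₗ[O] O ⧸ Ideal.span {q}),
      IsLevel l ∧ IsLevel l' ∧ ∀ x, x ∈ G ↔ l x = 0 ∧ l' x = 0 := by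
  obtain ⟨i, j, hij⟩ := exists_coordinates hp hq hcop hc
  have hmem : ∀ x, x ∈ G ↔ coordMod B p i x = 0 ∧ coordMod B q j x = 0 := fun x => by
    rw [hG, coordMod_eq_zero_iff, coordMod_eq_zero_iff, hij]
  have hone : ∀ (r : O) k, coordMod B r k (B k) = 1 := fun r k => by
    rw [coordMod, LinearMap.comp_apply, Module.Basis.coord_apply, Module.Basis.repr_self,
      Finsupp.single_eq_same]
    rfl
  exact ⟨_, _, isLevel_of_mem_iff hcop G hmem ⟨_, hone p i⟩,
    isLevel_of_mem_iff hcop.symm G (fun x => (hmem x).trans and_comm) ⟨_, hone q j⟩, hmem⟩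

end Levels

end QuatOrder

/-! ### Sieved divisor sums and the count in the suborder. -/

namespace QuatOrder

open HasReducedNorm

section SievedSums

variable {K : Type*} [Field K] [NumberField K]

/-- `𝔭²` does not divide `I`, and no other prime divisor of `𝔇` divides `I`. -/
def AlmostPrimeTo (𝔇 𝔭 I : Ideal (𝓞 K)) : Prop :=
  ¬ 𝔭 ^ 2 ∣ I ∧ ∀ 𝔯 : Ideal (𝓞 K), Prime 𝔯 → 𝔯 ∣ 𝔇 → 𝔯 ≠ 𝔭 → ¬ 𝔯 ∣ I

theorem eq_of_dvd_of_prime {𝔯 𝔭 : Ideal (𝓞 K)} (h𝔯 : Prime 𝔯) (h𝔭 : Prime 𝔭) (h : 𝔯 ∣ 𝔭) :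
    𝔯 = 𝔭 :=
  associated_iff_eq.mp ((h𝔯.dvd_prime_iff_associated h𝔭).mp h)

theorem almostPrimeTo_and_not_dvd_iff {𝔇 𝔭 : Ideal (𝓞 K)} (h𝔭 : Prime 𝔭) (h : 𝔭 ∣ 𝔇)
    (I : Ideal (𝓞 K)) : AlmostPrimeTo 𝔇 𝔭 I ∧ ¬ 𝔭 ∣ I ↔ PrimeTo 𝔇 I := by
  constructor
  · rintro ⟨⟨-, h1⟩, h2⟩ 𝔯 h𝔯 hd
    by_cases hr : 𝔯 = 𝔭
    · rwa [hr]
    · exact h1 𝔯 h𝔯 hd hr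
  · intro h1
    exact ⟨⟨fun h2 => h1 𝔭 h𝔭 h ((dvd_pow_self 𝔭 two_ne_zero).trans h2),
      fun 𝔯 h𝔯 hd _ => h1 𝔯 h𝔯 hd⟩, h1 𝔭 h𝔭 h⟩

theorem almostPrimeTo_mul_iff {𝔇 𝔭 : Ideal (𝓞 K)} (h𝔭 : Prime 𝔭) (h : 𝔭 ∣ 𝔇)
    (I : Ideal (𝓞 K)) : AlmostPrimeTo 𝔇 𝔭 (𝔭 * I) ↔ PrimeTo 𝔇 I := by
  rw [← almostPrimeTo_and_not_dvd_iff h𝔭 h, AlmostPrimeTo, AlmostPrimeTo, sq,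
    mul_dvd_mul_iff_left h𝔭.ne_zero]
  have hr : ∀ 𝔯 : Ideal (𝓞 K), Prime 𝔯 → 𝔯 ≠ 𝔭 → (𝔯 ∣ 𝔭 * I ↔ 𝔯 ∣ I) := fun 𝔯 h𝔯 hne =>
    ⟨fun h1 => (h𝔯.dvd_or_dvd h1).resolve_left fun h2 => hne (eq_of_dvd_of_prime h𝔯 h𝔭 h2),
      fun h1 => h1.mul_left _⟩
  constructor
  · rintro ⟨h1, h2⟩
    exact ⟨⟨fun h3 => h1 ((dvd_mul_right _ _).trans h3),
      fun 𝔯 h𝔯 hd hne h3 => h2 𝔯 h𝔯 hd hne ((hr 𝔯 h𝔯 hne).mpr h3)⟩, h1⟩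
  · rintro ⟨⟨-, h2⟩, h1⟩
    exact ⟨h1, fun 𝔯 h𝔯 hd hne h3 => h2 𝔯 h𝔯 hd hne ((hr 𝔯 h𝔯 hne).mp h3)⟩

-- The extra divisors are those divisible exactly once by 𝔭; they are 𝔭I with I prime to 𝔇, which
-- contributes the factor N(𝔭).
open Classical in
theorem idealDivisorSum_almostPrimeTo {𝔇 𝔭 A : Ideal (𝓞 K)} (hA : A ≠ 0) (h𝔭 : Prime 𝔭)
    (h : 𝔭 ∣ 𝔇) : idealDivisorSum A (AlmostPrimeTo 𝔇 𝔭) =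
      (1 + if 𝔭 ∣ A then Ideal.absNorm 𝔭 else 0) * idealDivisorSum A (PrimeTo 𝔇) := by
  split_ifs with hd
  · obtain ⟨A', rfl⟩ := hd
    rw [idealDivisorSum_mul (right_ne_zero_of_mul hA) h𝔭.ne_zero,
      idealDivisorSum_congr fun I _ => almostPrimeTo_and_not_dvd_iff h𝔭 h I,
      idealDivisorSum_congr (A := A') fun I _ => almostPrimeTo_mul_iff h𝔭 h I,
      ← idealDivisorSum_ramified (A := A') h𝔭 h]
    ring
  · rw [idealDivisorSum_of_not_dvd hd,
      idealDivisorSum_congr fun I _ => almostPrimeTo_and_not_dvd_iff h𝔭 h I, add_zero, one_mul]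

theorem dvd_mul_iff_of_prime {𝔯 𝔮 𝔇 : Ideal (𝓞 K)} (h𝔯 : Prime 𝔯) (h𝔮 : Prime 𝔮) :
    𝔯 ∣ 𝔮 * 𝔇 ↔ 𝔯 = 𝔮 ∨ 𝔯 ∣ 𝔇 :=
  ⟨fun h => (h𝔯.dvd_or_dvd h).imp_left (eq_of_dvd_of_prime h𝔯 h𝔮), fun h =>
    h.elim (fun h => h ▸ dvd_mul_right _ _) fun h => h.mul_left _⟩

theorem primeTo_mul_left_iff {𝔇 𝔮 : Ideal (𝓞 K)} (h𝔮 : Prime 𝔮) (I : Ideal (𝓞 K)) :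
    PrimeTo (𝔮 * 𝔇) I ↔ PrimeTo 𝔇 I ∧ ¬ 𝔮 ∣ I := by
  refine ⟨fun h => ⟨fun 𝔯 h𝔯 hd => h 𝔯 h𝔯 (hd.mul_left _), h 𝔮 h𝔮 (dvd_mul_right _ _)⟩,
    fun h 𝔯 h𝔯 hd => ?_⟩
  rcases (dvd_mul_iff_of_prime h𝔯 h𝔮).mp hd with rfl | hd
  · exact h.2
  · exact h.1 𝔯 h𝔯 hd

theorem almostPrimeTo_mul_left_iff {𝔇 𝔭 𝔮 : Ideal (𝓞 K)} (h𝔮 : Prime 𝔮) (hne : 𝔮 ≠ 𝔭)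
    (I : Ideal (𝓞 K)) : AlmostPrimeTo (𝔮 * 𝔇) 𝔭 I ↔ ¬ 𝔮 ∣ I ∧ AlmostPrimeTo 𝔇 𝔭 I := by
  refine ⟨fun h => ⟨h.2 𝔮 h𝔮 (dvd_mul_right _ _) hne, h.1, fun 𝔯 h𝔯 hd =>
    h.2 𝔯 h𝔯 (hd.mul_left _)⟩, fun h => ⟨h.2.1, fun 𝔯 h𝔯 hd hr => ?_⟩⟩
  rcases (dvd_mul_iff_of_prime h𝔯 h𝔮).mp hd with rfl | hd
  · exact h.1
  · exact h.2.2 𝔯 h𝔯 hd hr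

/-- The divisors of 𝔮A are separated into those prime to 𝔮 and the multiples of 𝔮. -/
theorem idealDivisorSum_eq_add {𝔇 𝔮 A : Ideal (𝓞 K)} (hA : A ≠ 0) (h𝔮 : Prime 𝔮)
    (h : ¬ 𝔮 ∣ 𝔇) : idealDivisorSum (𝔮 * A) (PrimeTo 𝔇) =
      idealDivisorSum (𝔮 * A) (PrimeTo (𝔮 * 𝔇)) +
        Ideal.absNorm 𝔮 * idealDivisorSum A (PrimeTo 𝔇) := by
  rw [idealDivisorSum_unramified hA h𝔮 h, ← idealDivisorSum_mul_prime h𝔮,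
    idealDivisorSum_congr fun I _ => (primeTo_mul_left_iff h𝔮 I).symm]

theorem idealDivisorSum_eq_of_not_dvd {𝔇 𝔮 A : Ideal (𝓞 K)} (h𝔮 : Prime 𝔮) (h : ¬ 𝔮 ∣ A) :
    idealDivisorSum A (PrimeTo 𝔇) = idealDivisorSum A (PrimeTo (𝔮 * 𝔇)) := by
  rw [idealDivisorSum_of_not_dvd h,
    idealDivisorSum_congr fun I _ => (primeTo_mul_left_iff h𝔮 I).symm]

end SievedSums

section Counting

variable {K : Type*} [Field K] [NumberField K] [NumberField.IsTotallyReal K]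
  {H : Type*} [Ring H] [Algebra (𝓞 K) H] [HasReducedNorm (𝓞 K) H]

theorem ncard_level [Module.IsTorsionFree (𝓞 K) H] (hK : HasPositiveGenerators K)
    (hpos : ∀ x : H, x ≠ 0 → TotallyPositive (algebraMap (𝓞 K) K (rn x)))
    (hsat : NormSaturated (𝓞 K) H) (hP : PrincipalAtPrimes (𝓞 K) H)
    (B : Module.Basis (Fin 4) (𝓞 K) H) {𝔇 : Ideal (𝓞 K)}
    (h𝔇 : ∀ 𝔯 : Ideal (𝓞 K), 𝔯 ∣ 𝔇 ↔ ∀ x y z : H, discForm (𝓞 K) x y z ∈ 𝔯) {p q : 𝓞 K}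
    (hp : Prime p) (hq : Prime q) (hqpos : TotallyPositive (algebraMap (𝓞 K) K q))
    (hp𝔇 : Ideal.span {p} ∣ 𝔇) (hq𝔇 : ¬ Ideal.span {q} ∣ 𝔇) (hcop : IsCoprime p q)
    {l : H →ₗ[𝓞 K] 𝓞 K ⧸ Ideal.span {p}} {l' : H →ₗ[𝓞 K] 𝓞 K ⧸ Ideal.span {q}}
    (hl : IsLevel l) (hl' : IsLevel l')
    (hperc : ∀ x : H, ∃ u : H, (rn u : 𝓞 K) = 1 ∧ l (u * x) = 0 ∧ l' (u * x) = 0)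
    {α : 𝓞 K} (hα : TotallyPositive (algebraMap (𝓞 K) K α)) :
    ({x ∈ elementsOfNorm H α | l x = 0 ∧ l' x = 0}.ncard : ℤ) =
      2 * (translators l l' 1).ncard * idealDivisorSum (Ideal.span {α})
        (AlmostPrimeTo 𝔇 (Ideal.span {p})) -
      (translators l l' 1).ncard * idealDivisorSum (Ideal.span {α})
        (AlmostPrimeTo (Ideal.span {q} * 𝔇) (Ideal.span {p})) := by
  classical
  have hpid := hK.isPrincipalIdealRing
  have hfin : ∀ α : 𝓞 K, (elementsOfNorm H α).Finite := finite_elementsOfNorm hpos B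
  have hα0 : α ≠ 0 := fun h => hα.ne_zero (by rw [h, map_zero])
  have hA0 : Ideal.span {α} ≠ 0 := by simpa using hα0
  have hfp : Finite (𝓞 K ⧸ Ideal.span {p}) :=
    Ideal.finiteQuotientOfFreeOfNeBot _ (by simpa using hp.ne_zero)
  have hfq : Finite (𝓞 K ⧸ Ideal.span {q}) :=
    Ideal.finiteQuotientOfFreeOfNeBot _ (by simpa using hq.ne_zero)
  have hpI : Prime (Ideal.span {p}) := Ideal.prime_span_singleton_iff.mpr hp
  have hqI : Prime (Ideal.span {q}) := Ideal.prime_span_singleton_iff.mpr hq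
  have hE : ∀ β, Ideal.span {p} ∣ Ideal.span {β} ↔ p ∣ β := fun β => by
    rw [Ideal.dvd_span_singleton, Ideal.mem_span_singleton]
  -- At a ramified prime the ideal of norm p consists of all elements with norm divisible by p, so
  -- membership depends on α only.
  have hram : ∀ x, x ∈ kerIdeal l ↔ p ∣ (rn x : 𝓞 K) := by
    obtain ⟨y, hy, hly⟩ := hl.mem_idealsOfNorm hp hP B
    intro x
    rw [hly]
    exact mem_span_iff_of_ramified
      (fun x y z => Ideal.mem_span_singleton.mp ((h𝔇 _).mp hp𝔇 x y z)) hsat B hp hy x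
  have hmain := ncard_mul_ncard_level hl hl' hp hq hperc hcop (hfin 1) (hfin α) hram
  have hU : (elementsOfNorm H (1 : 𝓞 K)).ncard ≠ 0 :=
    (Set.ncard_pos (hfin 1)).mpr ⟨1, rn_one⟩ |>.ne'
  have hS := ncard_elementsOfNorm hK hpos hsat hP B hfin h𝔇
  -- The identity σ(α) + N(q)σ(α/q) = 2σ(α) - σ'(α), with σ' the part prime to 𝔮, times #H¹ and
  -- without subtraction.
  have hgen : (elementsOfNorm H α).ncard + Nat.card (𝓞 K ⧸ Ideal.span {q}) *
      (elementsOfNorm H α ∩ kerIdeal l').ncard + (elementsOfNorm H (1 : 𝓞 K)).ncard *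
        idealDivisorSum (Ideal.span {α}) (PrimeTo (Ideal.span {q} * 𝔇)) =
      2 * ((elementsOfNorm H (1 : 𝓞 K)).ncard *
        idealDivisorSum (Ideal.span {α}) (PrimeTo 𝔇)) := by
    rw [hS α hα]
    by_cases hd : q ∣ α
    · obtain ⟨β, rfl⟩ := hd
      obtain ⟨y, hy, hly⟩ := exists_rn_eq_of_mem hK hpos hqpos (hl'.mem_idealsOfNorm hq hP B)
      have hβ0 : Ideal.span {β} ≠ 0 := by simpa using right_ne_zero_of_mul hα0
      rw [hly, ncard_mem_span hq.ne_zero hy, hS β (TotallyPositive.of_mul hqpos hα),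
        ← Ideal.span_singleton_mul_span_singleton, idealDivisorSum_eq_add hβ0 hqI hq𝔇,
        show Ideal.absNorm (Ideal.span {q}) = Nat.card (𝓞 K ⧸ Ideal.span {q}) from rfl]
      ring
    · have he : elementsOfNorm H α ∩ kerIdeal l' = ∅ := by
        rw [Set.eq_empty_iff_forall_notMem]
        rintro x ⟨hx, hxl⟩
        refine hd ?_
        rw [← show (rn x : 𝓞 K) = α from hx]
        exact hl'.dvd_rn hq (PrincipalIdealRing.isMaximal_of_irreducible hq.irreducible) hxl
      rw [he, Set.ncard_empty, idealDivisorSum_eq_of_not_dvd hqI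
        (fun h => hd (by rwa [Ideal.dvd_span_singleton, Ideal.mem_span_singleton] at h))]
      ring
  rw [idealDivisorSum_almostPrimeTo hA0 hpI hp𝔇,
    idealDivisorSum_almostPrimeTo hA0 hpI (hp𝔇.mul_left _), if_congr (hE α) rfl rfl,
    show Ideal.absNorm (Ideal.span {p}) = Nat.card (𝓞 K ⧸ Ideal.span {p}) from rfl]
  generalize (1 + if p ∣ α then Nat.card (𝓞 K ⧸ Ideal.span {p}) else 0) = E at *
  zify at hmain hgen hU
  refine mul_left_cancel₀ hU ?_
  rw [hmain]
  push_cast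
  linear_combination ((translators l l' 1).ncard * E : ℤ) * hgen

end Counting

section Orders

variable {K : Type*} [Field K] [NumberField K] {a b : K}

theorem normSet_eq_image {G H : Subalgebra (𝓞 K) ℍ[K,a,b]} (hH : IsOrder H) (hGH : G ≤ H) (α : 𝓞 K) :
    letI := hH.hasReducedNorm
    normSet G (algebraMap (𝓞 K) K α) =
      Subtype.val '' {x ∈ elementsOfNorm H α | x ∈ G.comap H.val} := by
  let _ := hH.hasReducedNorm
  ext x
  constructor
  · rintro ⟨hx, hn⟩
    refine ⟨⟨x, hGH hx⟩, ⟨?_, hx⟩, rfl⟩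
    apply FaithfulSMul.algebraMap_injective (𝓞 K) K
    rw [← hn]
    exact (hH.nrd_eq ⟨x, hGH hx⟩).symm
  · rintro ⟨y, ⟨hy, hyG⟩, rfl⟩
    refine ⟨hyG, ?_⟩
    rw [hH.nrd_eq y]
    exact congrArg _ hy

end Orders

end QuatOrder

end

/-! ### The theorem for quaternion orders. -/

theorem mainTheorem9 {K : Type*} [Field K] [NumberField K] [NumberField.IsTotallyReal K]
    (a b : K) (hdef : QuatOrder.IsDefinite K a b)
    (G H : Subalgebra (𝓞 K) ℍ[K,a,b])
    (hH : QuatOrder.IsMaximalOrder H) (hG : QuatOrder.IsOrder G)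
    (hperc : QuatOrder.IsPerceptive G H)
    (hcls : QuatOrder.classNumber G = 1)
    (𝔇 𝔭 𝔮 : Ideal (𝓞 K))
    (h𝔇 : QuatOrder.discrd (Subalgebra.toSubmodule H) = IsLocalization.coeSubmodule K 𝔇)
    (h𝔭 : Prime 𝔭) (h𝔮 : Prime 𝔮) (h𝔭𝔇 : 𝔭 ∣ 𝔇) (h𝔮𝔇 : ¬ 𝔮 ∣ 𝔇)
    (hkind : QuatOrder.latticeIndex (Subalgebra.toSubmodule H) (Subalgebra.toSubmodule G) =
      IsLocalization.coeSubmodule K (𝔭 * 𝔮))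
    (α : 𝓞 K) (hα : QuatOrder.TotallyPositive (α : K)) :
    (QuatOrder.units1 G).Finite ∧
    (QuatOrder.normSet G (α : K)).Finite ∧
    (QuatOrder.repCount G α : ℤ) =
      2 * ((QuatOrder.units1 G).ncard : ℤ) *
        (QuatOrder.divisorSum α fun δ =>
          ¬ 𝔭 ^ 2 ∣ δ ∧ ∀ 𝔯 : Ideal (𝓞 K), Prime 𝔯 → 𝔯 ∣ 𝔇 → 𝔯 ≠ 𝔭 → ¬ 𝔯 ∣ δ) -
      ((QuatOrder.units1 G).ncard : ℤ) *
        (QuatOrder.divisorSum α fun δ =>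
          ¬ 𝔮 ∣ δ ∧ ¬ 𝔭 ^ 2 ∣ δ ∧
            ∀ 𝔯 : Ideal (𝓞 K), Prime 𝔯 → 𝔯 ∣ 𝔇 → 𝔯 ≠ 𝔭 → ¬ 𝔯 ∣ δ) := by
  classical
  let _ := QuatOrder.IsOrder.hasReducedNorm hH.1
  have hGH := hperc.1
  have hpos : ∀ x : H, x ≠ 0 → QuatOrder.TotallyPositive
      (algebraMap (𝓞 K) K (QuatOrder.HasReducedNorm.rn x)) := fun x hx => by
    have h := hdef x.1 fun h0 => hx (Subtype.ext h0)
    rwa [hH.1.nrd_eq x] at h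
  have hdvd := QuatOrder.dvd_discrd_iff hH.1 h𝔇
  have hsat := hH.normSaturated
  have h𝔇0 : 𝔇 ≠ ⊥ := by
    rintro rfl
    exact h𝔮𝔇 (dvd_zero _)
  -- The ideal (n), with nH ⊆ G, serves as a conductor; n need not be related to 𝔭𝔮.
  obtain ⟨n, hn0, hn⟩ := QuatOrder.exists_smul_mem hH.1.fg hG
  have h𝔫0 : Ideal.span {n} ≠ ⊥ := by simpa using hn0
  have hPA := QuatOrder.principalAwayFrom hH hG hGH hcls h𝔫0 fun r hr x hx => by
    obtain ⟨s, rfl⟩ := Ideal.mem_span_singleton'.mp hr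
    rw [mul_smul]
    exact G.smul_mem (hn x hx) s
  have hMF : Module.Finite (𝓞 K) H := Module.Finite.iff_fg.mpr hH.1.fg
  have hTF : Module.IsTorsionFree (𝓞 K) ℍ[K,a,b] := Module.IsTorsionFree.trans_faithfulSMul _ K _
  have hTH : Module.IsTorsionFree (𝓞 K) H := inferInstance
  have hK := hPA.hasPositiveGenerators h𝔫0 hpos h𝔇0 fun 𝔯 h => (hdvd 𝔯).mpr h
  have hpid := hK.isPrincipalIdealRing
  have hP := hPA.principalAtPrimes h𝔫0 hsat
  obtain ⟨p, -, rfl⟩ := hK 𝔭 h𝔭.ne_zero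
  obtain ⟨q, hqpos, rfl⟩ := hK 𝔮 h𝔮.ne_zero
  have hp : Prime p := Ideal.prime_span_singleton_iff.mp h𝔭
  have hq : Prime q := Ideal.prime_span_singleton_iff.mp h𝔮
  have hne : Ideal.span {q} ≠ Ideal.span {p} := fun h => h𝔮𝔇 (h ▸ h𝔭𝔇)
  have hcop : IsCoprime p q := by
    rw [hp.irreducible.coprime_iff_not_dvd]
    intro hd
    refine hne (QuatOrder.eq_of_dvd_of_prime h𝔭 h𝔮 ?_).symm
    rwa [Ideal.dvd_span_singleton, Ideal.mem_span_singleton]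
  obtain ⟨B, c, hB⟩ := QuatOrder.exists_adapted_basis hpid hH.1 hG hGH
  -- The index hypothesis in terms of elementary divisors.
  have hc : Associated (∏ i, c i) (p * q) := by
    rw [QuatOrder.latticeIndex_eq hH.1 hGH hB, Ideal.span_singleton_mul_span_singleton] at hkind
    exact Ideal.span_singleton_eq_span_singleton.mp (IsFractionRing.coeSubmodule_injective _ _ hkind)
  let B' : Module.Basis (Fin 4) (𝓞 K) H := B
  obtain ⟨l, l', hl, hl', hG'⟩ := QuatOrder.exists_levels hp hq hcop B' hc (G.comap H.val) hB
  have hperc' : ∀ x : H, ∃ u : H, (QuatOrder.HasReducedNorm.rn u : 𝓞 K) = 1 ∧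
      l (u * x) = 0 ∧ l' (u * x) = 0 := by
    intro x
    obtain ⟨u, ⟨huH, hu⟩, hux⟩ := hperc.2 x.1 x.2
    refine ⟨⟨u, huH⟩, ?_, (hG' (⟨u, huH⟩ * x)).mp hux⟩
    apply FaithfulSMul.algebraMap_injective (𝓞 K) K
    rw [← hH.1.nrd_eq ⟨u, huH⟩, map_one]
    exact hu
  have hset : ∀ β : 𝓞 K, QuatOrder.normSet G (algebraMap (𝓞 K) K β) = Subtype.val ''
      {x ∈ QuatOrder.elementsOfNorm H β | l x = 0 ∧ l' x = 0} := fun β => by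
    rw [QuatOrder.normSet_eq_image hH.1 hGH]
    simp only [hG']
  have hfin : ∀ β : 𝓞 K, (QuatOrder.normSet G (algebraMap (𝓞 K) K β)).Finite := fun β => by
    rw [hset]
    exact ((QuatOrder.finite_elementsOfNorm hpos B' β).subset fun x hx => hx.1).image _
  -- The elements of H¹ that move 1 into G are those of G¹.
  have hone : (QuatOrder.units1 G).ncard = (QuatOrder.translators l l' 1).ncard := by
    rw [QuatOrder.units1, ← map_one (algebraMap (𝓞 K) K), hset,
      Set.ncard_image_of_injective _ Subtype.val_injective]
    simp only [QuatOrder.translators, mul_one]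
  refine ⟨?_, hfin α, ?_⟩
  · rw [QuatOrder.units1, ← map_one (algebraMap (𝓞 K) K)]
    exact hfin 1
  · rw [QuatOrder.repCount, hset, Set.ncard_image_of_injective _ Subtype.val_injective, hone,
      QuatOrder.ncard_level hK hpos hsat hP B' hdvd hp hq hqpos h𝔭𝔇 h𝔮𝔇 hcop hl hl' hperc' hα,
      QuatOrder.divisorSum_eq hpid, QuatOrder.divisorSum_eq hpid,
      QuatOrder.idealDivisorSum_congr fun I _ => QuatOrder.almostPrimeTo_mul_left_iff h𝔮 hne I]
    rfl
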